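/- Let $n\ge 0$ and $d=n+1$. Let $\mathcal V$ be an NP-manifold of degree $n$ (an $\mathbb N$-graded manifold with a symplectic form $\omega$ of degree $n$) described by Darboux coordinates over an open set $U\subseteq\mathbb R^m$ (every NP-manifold is locally of this form): coordinates $x^\mu,p_\mu$ of degrees $0,n$; $\psi^{\alpha_i},\chi_{\alpha_i}$ of degrees $i,n-i$ for $1\le i<n/2$; and, for $n$ even only, $\xi^a$ of degree $n/2$; with $$\omega=dx^\mu\wedge dp_\mu+\sum_i d\psi^{\alpha_i}\wedge d\chi_{\alpha_i}+\tfrac12\kappa_{ab}\,d\xi^a\wedge d\xi^b,\qquad \kappa \text{ invertible},\ \kappa_{ab}=-(-1)^{n/2}\kappa_{ba},$$ and let $(\kappa^{ab})$ be the inverse matrix. The coordinates of degree $0$ are the coordinates of $U$, and $C^\infty(\mathcal V)$ is the graded algebra of polynomials in the graded commutative coordinates of positive degree with coefficients in $C^\infty(U)$. Let $\mathsf{dGra}_d(N)$, $N\ge1$, be the real vector space spanned by the directed graphs (loops and multiple edges allowed) with $N$ labelled vertices and any number $k$ of labelled edges, where permuting the edge labels by $\sigma$ gives the sign $\mathrm{sgn}(\sigma)^{d+1}$;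 a graph with $k$ edges has degree $k(1-d)$. Let $\mathsf{Gra}_d(N)$ be the quotient of this space in which moreover reversing an edge gives the sign $(-1)^d$. Both are operads: a permutation $\sigma$ of the vertices acts on the right by renaming each vertex $v$ as $\sigma^{-1}(v)$; $\gamma\circ_i\gamma'$ is the sum of the graphs obtained by replacing the $i$-th vertex of $\gamma$ by $\gamma'$ and reconnecting each half-edge of $\gamma$ at that vertex to a vertex of $\gamma'$ in all possible ways, the edges of $\gamma$ preceding those of $\gamma'$; the unit is the graph with one vertex and no edge. In $\mathsf{End}_{C^\infty(\mathcal V)}$ the compositions and the symmetric group actions carry Koszul signs. (1) There is a morphism of operads of graded vector spaces $\mathsf{dRep}^{(d)}:\mathsf{dGra}_d\to\mathsf{End}_{C^\infty(\mathcal V)}$, i.e. a $\mathsf{dGra}_d$-algebra structure on $C^\infty(\mathcal V)$, given on a graph $\gamma$ with $N$ vertices and ordered edges $e_1=(i_1,j_1),\dots,e_k=(i_k,j_k)$ by $$\mathsf{dRep}^{(d)}_N(\gamma)(f_1\otimes\cdots\otimes f_N)=\mu_N\big(\bar\Delta_{i_1j_1}\cdots\bar\Delta_{i_kj_k}(f_1\otimes\cdots\otimes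 f_N)\big),$$ $$\bar\Delta_{ij}=\frac{\partial}{\partial x^\mu_{(i)}}\frac{\partial}{\partial p_\mu^{(j)}}+\frac{\partial}{\partial \psi^{\alpha_k}_{(i)}}\frac{\partial}{\partial \chi_{\alpha_k}^{(j)}}+\frac12\frac{\partial}{\partial \xi^a_{(i)}}\kappa^{ab}\frac{\partial}{\partial \xi^b_{(j)}}$$ (the last term occurs only for $d$ odd). Here $\mu_N$ is the multiplication of $N$ functions and an index $(i)$ means that the left partial derivative acts on the $i$-th tensor factor, with the Koszul sign. (2) There is an injective morphism of operads $\mathsf{Or}:\mathsf{Gra}_d\to\mathsf{dGra}_d$ (the orientation morphism) sending the class of a graph $\gamma$ to $\sum_{S}(-1)^{d|S|}\gamma^S$, where $S$ runs over the sets of edges of $\gamma$ and $\gamma^S$ is $\gamma$ with the edges in $S$ reversed. (3) The composite $\mathsf{Rep}^{(d)}=\mathsf{dRep}^{(d)}\circ\mathsf{Or}:\mathsf{Gra}_d\to\mathsf{End}_{C^\infty(\mathcal V)}$ is a morphism of operads, i.e. a $\mathsf{Gra}_d$-algebra structure on $C^\infty(\mathcal V)$. It is given by the formula of (1) with $\bar\Delta_{ij}$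 replaced by $\Delta_{ij}$, where, for $d$ even, $$\Delta_{ij}=\frac{\partial}{\partial x^\mu_{(i)}}\frac{\partial}{\partial p_\mu^{(j)}}+\frac{\partial}{\partial p_\mu^{(i)}}\frac{\partial}{\partial x^\mu_{(j)}}+\frac{\partial}{\partial \psi^{\alpha_k}_{(i)}}\frac{\partial}{\partial \chi_{\alpha_k}^{(j)}}+\frac{\partial}{\partial \chi_{\alpha_k}^{(i)}}\frac{\partial}{\partial \psi^{\alpha_k}_{(j)}},$$ and, for $d$ odd, $$\Delta_{ij}=\frac{\partial}{\partial x^\mu_{(i)}}\frac{\partial}{\partial p_\mu^{(j)}}-\frac{\partial}{\partial p_\mu^{(i)}}\frac{\partial}{\partial x^\mu_{(j)}}+\frac{\partial}{\partial \psi^{\alpha_k}_{(i)}}\frac{\partial}{\partial \chi_{\alpha_k}^{(j)}}-(-1)^k\frac{\partial}{\partial \chi_{\alpha_k}^{(i)}}\frac{\partial}{\partial \psi^{\alpha_k}_{(j)}}+\frac{\partial}{\partial \xi^a_{(i)}}\kappa^{ab}\frac{\partial}{\partial \xi^b_{(j)}}.$$ -/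

import Mathlib

open scoped TensorProduct ContDiff

noncomputable section

namespace NPGraph

/-! ## Operads of graded vector spaces over the reals (arities at least one)

`obj N` is the space of operations with `N + 1` inputs. It is graded by the subspaces `homog N a`,
`a ∈ ℤ`; it carries a right action of the symmetric group on the `N + 1` inputs, and the partial
compositions `∘_i` send arities `M + 1`, `N + 1` to arity `M + N + 1`. -/

/-- The underlying data of an operad in graded vector spaces: the spaces and the structure maps. -/
structure OperadData where
  obj : ℕ → Type
  [grp : ∀ N, AddCommGroup (obj N)]
  [mod : ∀ N, Module ℝ (obj N)]
  homog : ∀ N, ℤ → Submodule ℝ (obj N)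
  one : obj 0
  act : ∀ N, Equiv.Perm (Fin (N + 1)) → obj N →ₗ[ℝ] obj N
  comp : ∀ M N, Fin (M + 1) → obj M →ₗ[ℝ] obj N →ₗ[ℝ] obj (M + N)

attribute [instance] OperadData.grp OperadData.mod

/-- Morphisms of operads in graded vector spaces: linear maps of degree zero in every arity,
compatible with the identities, the partial compositions and the symmetric group actions. -/
structure OperadHom (P Q : OperadData) where
  toFun : ∀ N, P.obj N →ₗ[ℝ] Q.obj N
  map_homog : ∀ N a x, x ∈ P.homog N a → toFun N x ∈ Q.homog N a
  map_one : toFun 0 P.one = Q.one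
  map_comp : ∀ M N i x y, toFun (M + N) (P.comp M N i x y) = Q.comp M N i (toFun M x) (toFun N y)
  map_act : ∀ N σ x, toFun N (P.act N σ x) = Q.act N σ (toFun N x)

/-- Composition of morphisms of operads. -/
def OperadHom.comp {P Q R : OperadData} (g : OperadHom Q R) (f : OperadHom P Q) :
    OperadHom P R where
  toFun N := (g.toFun N).comp (f.toFun N)
  map_homog N a x hx := g.map_homog N a _ (f.map_homog N a x hx)
  map_one := by simp [f.map_one, g.map_one]
  map_comp M N i x y := by simp [f.map_comp, g.map_comp]
  map_act N σ x := by simp [f.map_act, g.map_act]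

/-! ## Labels after inserting `N + 1` labels in place of the label `i` (labels start at zero) -/

section Labels

variable {M N : ℕ}

/-- The new label of the inserted label `l`: it is shifted up by `i`. -/
def inner (i : Fin (M + 1)) (l : Fin (N + 1)) : Fin (M + N + 1) := ⟨i + l, by omega⟩

/-- The new label of an outer label `j ≠ i`: unchanged before `i`, shifted up by `N` after `i`. -/
def outer (i j : Fin (M + 1)) : Fin (M + N + 1) :=
  if j < i then ⟨j, by omega⟩ else ⟨j + N, by omega⟩

/-- The map which collapses the inserted labels to `i` and undoes `outer` elsewhere. -/
def collapse (i : Fin (M + 1)) (t : Fin (M + N + 1)) : Fin (M + 1) :=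
  if h : (t : ℕ) < i then ⟨t, by omega⟩
  else if h' : (t : ℕ) ≤ i + N then i
  else ⟨t - N, by omega⟩

end Labels

/-! ## The endomorphism operad of a graded vector space

`G a` is the subspace of degree `a`, and `P` is the map acting on it as `(-1) ^ a`. Signs follow
the Koszul rule. -/

section End

variable {V : Type} [AddCommGroup V] [Module ℝ V]

/-- The part of a multilinear map whose degree is congruent to `p` modulo two. -/
def parityPart (P : V →ₗ[ℝ] V) (N p : ℕ) :
    MultilinearMap ℝ (fun _ : Fin (N + 1) => V) V →ₗ[ℝ]
      MultilinearMap ℝ (fun _ : Fin (N + 1) => V) V where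
  toFun θ := (1 / 2 : ℝ) •
    (θ + (-1 : ℝ) ^ p • P.compMultilinearMap (θ.compLinearMap fun _ => P))
  map_add' θ φ := by
    ext f; simp [smul_add]; abel
  map_smul' c θ := by
    ext f; simp [smul_add, smul_comm c]

/-- The inputs of the outer operation when `φ` is inserted in its `i`-th input and `Q` is applied to
the inputs before it. -/
def insertFun {M N : ℕ} (i : Fin (M + 1)) (Q : V →ₗ[ℝ] V) (φ : (Fin (N + 1) → V) → V)
    (f : Fin (M + N + 1) → V) (j : Fin (M + 1)) : V :=
  if j < i then Q (f (outer i j)) else if j = i then φ fun l => f (inner i l) else f (outer i j)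

theorem inner_injective {M N : ℕ} (i : Fin (M + 1)) :
    Function.Injective (inner (N := N) i) := by
  intro a b h
  simp only [inner, Fin.mk.injEq] at h
  omega

theorem exists_inner_or_outer {M N : ℕ} (i : Fin (M + 1)) (t : Fin (M + N + 1)) :
    (∃ l : Fin (N + 1), t = inner i l ∧ ∀ j, j ≠ i → outer i j ≠ t) ∨
      (∃ j, j ≠ i ∧ t = outer i j ∧ (∀ j', j' ≠ j → j' ≠ i → outer (N := N) i j' ≠ t) ∧
        ∀ l : Fin (N + 1), inner i l ≠ t) := by
  by_cases h1 : (t : ℕ) < i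
  · right
    refine ⟨⟨t, by omega⟩, ?_, ?_, ?_, ?_⟩
    · simp [Fin.ext_iff]; omega
    · simp [outer, Fin.lt_def, h1]
    · intro j' h h'
      simp only [outer, Fin.lt_def, Fin.ext_iff, ne_eq] at *
      split_ifs <;> simp <;> omega
    · intro l; simp only [inner, Fin.ext_iff, ne_eq]; omega
  · by_cases h2 : (t : ℕ) ≤ i + N
    · left
      refine ⟨⟨t - i, by omega⟩, ?_, ?_⟩
      · simp only [inner, Fin.ext_iff]; omega
      · intro j h
        simp only [outer, Fin.lt_def, Fin.ext_iff, ne_eq] at *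
        split_ifs <;> simp <;> omega
    · right
      refine ⟨⟨t - N, by omega⟩, ?_, ?_, ?_, ?_⟩
      · simp only [Fin.ext_iff, ne_eq]; omega
      · simp only [outer, Fin.lt_def, Fin.ext_iff]
        split_ifs <;> simp <;> omega
      · intro j' h h'
        simp only [outer, Fin.lt_def, Fin.ext_iff, ne_eq] at *
        split_ifs <;> simp <;> omega
      · intro l; simp only [inner, Fin.ext_iff, ne_eq]; omega

/-- An update of one input of the composite updates one input of the outer operation. -/
theorem insertFun_update {M N : ℕ} (i : Fin (M + 1)) (Q : V →ₗ[ℝ] V)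
    (φ : MultilinearMap ℝ (fun _ : Fin (N + 1) => V) V) (f : Fin (M + N + 1) → V)
    (t : Fin (M + N + 1)) :
    ∃ (j : Fin (M + 1)) (L : V →ₗ[ℝ] V), ∀ v, insertFun i Q φ (Function.update f t v) =
      Function.update (insertFun i Q φ f) j (L v) := by
  rcases exists_inner_or_outer (N := N) i t with ⟨l, rfl, h⟩ | ⟨j, hj, rfl, h, h'⟩
  · refine ⟨i, φ.toLinearMap (fun l => f (inner i l)) l, fun v => funext fun j => ?_⟩
    by_cases hj : j = i
    · subst hj
      have : (fun l' => Function.update f (inner j l) v (inner j l')) =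
          Function.update (fun l' => f (inner j l')) l v := by
        funext l'
        by_cases hl : l' = l
        · subst hl; simp
        · rw [Function.update_of_ne hl, Function.update_of_ne]
          exact fun e => hl (inner_injective _ e)
      simp [insertFun, this]
    · simp [insertFun, hj, Function.update_of_ne (h j hj)]
  · refine ⟨j, if j < i then Q else LinearMap.id, fun v => funext fun j' => ?_⟩
    have e : (fun l' => Function.update f (outer i j) v (inner i l')) =
        fun l' => f (inner i l') := by
      funext l'
      exact Function.update_of_ne (h' l') _ _
    by_cases hj' : j' = j
    · subst hj'
      by_cases hlt : j' < i <;> simp [insertFun, hlt, hj]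
    · rw [Function.update_of_ne hj']
      by_cases hi : j' = i
      · subst hi; simp [insertFun, e]
      · simp [insertFun, hi, Function.update_of_ne (h j' hj' hi)]

/-- `θ ∘ (Q ⊗ ⋯ ⊗ Q ⊗ φ ⊗ 1 ⊗ ⋯ ⊗ 1)` with `φ` in the `i`-th place. -/
def insertOp {M N : ℕ} (i : Fin (M + 1)) (Q : V →ₗ[ℝ] V)
    (θ : MultilinearMap ℝ (fun _ : Fin (M + 1) => V) V)
    (φ : MultilinearMap ℝ (fun _ : Fin (N + 1) => V) V) :
    MultilinearMap ℝ (fun _ : Fin (M + N + 1) => V) V :=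
  MultilinearMap.mk' (fun f => θ (insertFun i Q φ f))
    (fun f t v w => by
      obtain ⟨j, L, h⟩ := insertFun_update i Q φ f t
      simp [h])
    (fun f t c v => by
      obtain ⟨j, L, h⟩ := insertFun_update i Q φ f t
      simp [h])

theorem insertOp_apply {M N : ℕ} (i : Fin (M + 1)) (Q : V →ₗ[ℝ] V)
    (θ : MultilinearMap ℝ (fun _ : Fin (M + 1) => V) V)
    (φ : MultilinearMap ℝ (fun _ : Fin (N + 1) => V) V) (f : Fin (M + N + 1) → V) :
    insertOp i Q θ φ f = θ (insertFun i Q φ f) := rfl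

theorem insertFun_eq_update {M N : ℕ} (i : Fin (M + 1)) (Q : V →ₗ[ℝ] V)
    (φ : (Fin (N + 1) → V) → V) (f : Fin (M + N + 1) → V) :
    insertFun i Q φ f =
      Function.update (insertFun i Q (fun _ => 0) f) i (φ fun l => f (inner i l)) := by
  funext j
  by_cases hj : j = i
  · subst hj; simp [insertFun]
  · simp [insertFun, hj]

/-- The partial composition `θ ∘_i φ = θ ∘ (1 ⊗ ⋯ ⊗ 1 ⊗ φ ⊗ 1 ⊗ ⋯ ⊗ 1)`. By the Koszul rule the
component of `φ` of parity `p` passes the inputs before it at the cost of `P ^ p` on each. -/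
def endComp (P : V →ₗ[ℝ] V) (M N : ℕ) (i : Fin (M + 1)) :
    MultilinearMap ℝ (fun _ : Fin (M + 1) => V) V →ₗ[ℝ]
      MultilinearMap ℝ (fun _ : Fin (N + 1) => V) V →ₗ[ℝ]
        MultilinearMap ℝ (fun _ : Fin (M + N + 1) => V) V :=
  ∑ p ∈ Finset.range 2, (LinearMap.mk₂ ℝ (insertOp i (P ^ p))
    (fun θ θ' φ => by ext f; simp [insertOp])
    (fun c θ φ => by ext f; simp [insertOp])
    (fun θ φ φ' => by
      ext f
      simp only [insertOp_apply, add_apply]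
      rw [insertFun_eq_update, insertFun_eq_update (φ := φ), insertFun_eq_update (φ := φ')]
      simp)
    (fun c θ φ => by
      ext f
      simp only [insertOp_apply, smul_apply]
      rw [insertFun_eq_update, insertFun_eq_update (φ := φ)]
      simp)).compl₂ (parityPart P N p)

/-- The Koszul sign of moving the `a`-th input to the place `σ a` for all `a`, where `S` is the set
of the inputs of odd degree. -/
def koszulSign {N : ℕ} (σ : Equiv.Perm (Fin (N + 1))) (S : Finset (Fin (N + 1))) : ℝ :=
  ∏ _q ∈ (S ×ˢ S).filter (fun q => q.1 < q.2 ∧ σ q.2 < σ q.1), (-1 : ℝ)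

/-- The right action `(θ · σ) (f₁, …, f_N) = ± θ (f_{σ⁻¹ 1}, …, f_{σ⁻¹ N})`, with the Koszul sign
for inputs of definite parity. -/
def endAct (P : V →ₗ[ℝ] V) (N : ℕ) (σ : Equiv.Perm (Fin (N + 1))) :
    MultilinearMap ℝ (fun _ : Fin (N + 1) => V) V →ₗ[ℝ]
      MultilinearMap ℝ (fun _ : Fin (N + 1) => V) V where
  toFun θ := ∑ S : Finset (Fin (N + 1)), koszulSign σ S •
    (θ.domDomCongr σ⁻¹).compLinearMap fun a =>
      (1 / 2 : ℝ) • (if a ∈ S then LinearMap.id - P else LinearMap.id + P)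
  map_add' θ φ := by
    ext f; simp [smul_add, Finset.sum_add_distrib]
  map_smul' c θ := by
    ext f; simp [Finset.smul_sum, smul_comm c]

/-- The endomorphism operad of a graded vector space. -/
def EndOperad (G : ℤ → Submodule ℝ V) (P : V →ₗ[ℝ] V) : OperadData where
  obj N := MultilinearMap ℝ (fun _ : Fin (N + 1) => V) V
  homog N a :=
    { carrier := {θ | ∀ (b : Fin (N + 1) → ℤ) (f : Fin (N + 1) → V),
        (∀ i, f i ∈ G (b i)) → θ f ∈ G (a + ∑ i, b i)}
      add_mem' := fun hθ hφ b f hf => add_mem (hθ b f hf) (hφ b f hf)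
      zero_mem' := fun _ _ _ => zero_mem _
      smul_mem' := fun c _ hθ b f hf => Submodule.smul_mem _ c (hθ b f hf) }
  one := MultilinearMap.ofSubsingleton ℝ V V (0 : Fin 1) LinearMap.id
  act := endAct P
  comp := endComp P

end End

/-! ## The graph operads -/

/-- Multidigraphs with `N + 1` labelled vertices and `k` labelled edges, `k ≥ 0` arbitrary, given by
the list of the pairs (source, target). Loops and multiple edges are allowed. -/
abbrev Multidigraph (N : ℕ) : Type := Σ k : ℕ, Fin k → Fin (N + 1) × Fin (N + 1)

/-- Reverse the edges selected by `s`. -/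
def flipEdges {A : Type} {k : ℕ} (s : Fin k → Bool) (γ : Fin k → A × A) (e : Fin k) : A × A :=
  if s e then (γ e).swap else γ e

/-- The sign `(-1) ^ (d |s|)` of reversing the edges selected by `s`. -/
def flipSign (d : ℤ) {k : ℕ} (s : Fin k → Bool) : ℤˣ := ∏ e, if s e then (-1) ^ d else 1

/-- The sign `(-1) ^ ((d + 1) |σ|)` of permuting the labels of the edges. -/
def orderSign (d : ℤ) {k : ℕ} (σ : Equiv.Perm (Fin k)) : ℤˣ := Equiv.Perm.sign σ ^ (d + 1)

/-- The relations among graphs: permuting the labels of the edges by `σ` gives the sign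
`(-1) ^ ((d + 1) |σ|)` and, if `undirected` holds, reversing the edges selected by `s` gives the sign
`(-1) ^ (d |s|)`. -/
def graphRel (undirected : Prop) (d : ℤ) (N : ℕ) : Submodule ℝ (Multidigraph N →₀ ℝ) :=
  Submodule.span ℝ {v | ∃ (k : ℕ) (γ : Fin k → Fin (N + 1) × Fin (N + 1))
    (σ : Equiv.Perm (Fin k)) (s : Fin k → Bool), (undirected ∨ ∀ e, s e = false) ∧
      v = Finsupp.single ⟨k, flipEdges s (γ ∘ σ)⟩ 1 -
        (((orderSign d σ * flipSign d s : ℤˣ) : ℤ) : ℝ) • Finsupp.single ⟨k, γ⟩ 1}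

/-- Finite linear combinations of graphs with `N + 1` vertices, modulo the relations. For `d ≠ 1` its
homogeneous components are those of the product over `k` of the spaces of graphs with `k` edges. -/
abbrev GraphSpace (undirected : Prop) (d : ℤ) (N : ℕ) : Type :=
  (Multidigraph N →₀ ℝ) ⧸ graphRel undirected d N

/-- The class of a graph. -/
def graphClass (undirected : Prop) (d : ℤ) {N : ℕ} (Γ : Multidigraph N) :
    GraphSpace undirected d N :=
  (graphRel undirected d N).mkQ (Finsupp.single Γ 1)

/-- The graph obtained by renaming the vertex `v` to `σ⁻¹ v`. -/
def relabel {N : ℕ} (σ : Equiv.Perm (Fin (N + 1))) (Γ : Multidigraph N) : Multidigraph N :=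
  ⟨Γ.1, fun e => Prod.map ⇑σ⁻¹ ⇑σ⁻¹ (Γ.2 e)⟩

/-- Insertion of `Γ'` in place of the `i`-th vertex of `Γ`: the sum over all ways of reconnecting
every half-edge of `Γ` at the vertex `i` to a vertex of `Γ'`. A way of reconnecting is recorded by the
reconnected edges `δ` of `Γ`: these give back the edges of `Γ` when the vertices of `Γ'` are collapsed
to `i`. The edges of `Γ` come before those of `Γ'`. -/
def insertGraph {M N : ℕ} (i : Fin (M + 1)) (Γ : Multidigraph M) (Γ' : Multidigraph N) :
    Multidigraph (M + N) →₀ ℝ :=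
  ∑ δ : Fin Γ.1 → Fin (M + N + 1) × Fin (M + N + 1) with
      ∀ e, Prod.map (collapse (N := N) i) (collapse (N := N) i) (δ e) = Γ.2 e,
    Finsupp.single ⟨Γ.1 + Γ'.1, Fin.append δ fun e => Prod.map (inner i) (inner i) (Γ'.2 e)⟩ 1

section Lift

theorem flipEdges_comp_map {A B : Type} {k : ℕ} (s : Fin k → Bool) (γ : Fin k → A × A)
    (g : A → B) :
    (fun e => Prod.map g g (flipEdges s γ e)) = flipEdges s fun e => Prod.map g g (γ e) := by
  funext e
  simp only [flipEdges]
  split_ifs <;> rfl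

theorem flipEdges_flipEdges {A : Type} {k : ℕ} (s : Fin k → Bool) (γ : Fin k → A × A) :
    flipEdges s (flipEdges s γ) = γ := by
  funext e
  simp only [flipEdges]
  split_ifs <;> simp

/-- Permuting the first `j` and the last `k` edges separately. -/
def permAppend {j k : ℕ} (σ : Equiv.Perm (Fin j)) (τ : Equiv.Perm (Fin k)) :
    Equiv.Perm (Fin (j + k)) :=
  finSumFinEquiv.permCongr (Equiv.Perm.sumCongr σ τ)

theorem append_flip {A : Type} {j k : ℕ} (σ : Equiv.Perm (Fin j)) (τ : Equiv.Perm (Fin k))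
    (s : Fin j → Bool) (t : Fin k → Bool) (γ : Fin j → A × A) (γ' : Fin k → A × A) :
    Fin.append (flipEdges s (γ ∘ σ)) (flipEdges t (γ' ∘ τ)) =
      flipEdges (Fin.append s t) (Fin.append γ γ' ∘ permAppend σ τ) := by
  funext e
  refine Fin.addCases (fun e => ?_) (fun e => ?_) e <;>
    simp [flipEdges, permAppend, Equiv.permCongr_apply]

theorem sign_append (d : ℤ) {j k : ℕ} (σ : Equiv.Perm (Fin j)) (τ : Equiv.Perm (Fin k))
    (s : Fin j → Bool) (t : Fin k → Bool) :
    orderSign d (permAppend σ τ) * flipSign d (Fin.append s t) =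
      (orderSign d σ * flipSign d s) * (orderSign d τ * flipSign d t) := by
  simp only [orderSign, flipSign, permAppend, Equiv.Perm.sign_permCongr,
    Equiv.Perm.sign_sumCongr, Fin.prod_univ_add, Fin.append_left, Fin.append_right, mul_zpow]
  exact mul_mul_mul_comm _ _ _ _

variable (undirected : Prop) (d : ℤ)

theorem graphClass_flip {N k : ℕ} (γ : Fin k → Fin (N + 1) × Fin (N + 1))
    (σ : Equiv.Perm (Fin k)) (s : Fin k → Bool) (hs : undirected ∨ ∀ e, s e = false) :
    graphClass undirected d (⟨k, flipEdges s (γ ∘ σ)⟩ : Multidigraph N) =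
      (((orderSign d σ * flipSign d s : ℤˣ) : ℤ) : ℝ) • graphClass undirected d ⟨k, γ⟩ := by
  rw [graphClass, graphClass, ← map_smul, ← sub_eq_zero, ← map_sub]
  exact (Submodule.Quotient.mk_eq_zero _).2 (Submodule.subset_span ⟨k, γ, σ, s, hs, rfl⟩)

theorem sign_one (d : ℤ) (k : ℕ) :
    orderSign d (1 : Equiv.Perm (Fin k)) * flipSign d (fun _ : Fin k => false) = 1 := by
  simp [orderSign, flipSign]

theorem insertGraph_left {M N : ℕ} (i : Fin (M + 1)) (Γ' : Multidigraph N) {k : ℕ}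
    (γ : Fin k → Fin (M + 1) × Fin (M + 1)) (σ : Equiv.Perm (Fin k)) (s : Fin k → Bool)
    (hs : undirected ∨ ∀ e, s e = false) :
    (graphRel undirected d (M + N)).mkQ (insertGraph i ⟨k, flipEdges s (γ ∘ σ)⟩ Γ') =
      (((orderSign d σ * flipSign d s : ℤˣ) : ℤ) : ℝ) •
        (graphRel undirected d (M + N)).mkQ (insertGraph i ⟨k, γ⟩ Γ') := by
  simp only [insertGraph, map_sum, Finset.smul_sum]
  symm
  refine Finset.sum_nbij' (fun δ => flipEdges s (δ ∘ σ))
    (fun δ => flipEdges s δ ∘ ⇑σ⁻¹) ?_ ?_ ?_ ?_ ?_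
  · intro δ hδ
    simp only [Finset.mem_filter, Finset.mem_univ, true_and] at hδ ⊢
    intro e
    have := congrFun (flipEdges_comp_map s (δ ∘ σ) (collapse (N := N) i)) e
    rw [this]
    simp [flipEdges, hδ]
  · intro δ hδ
    simp only [Finset.mem_filter, Finset.mem_univ, true_and] at hδ ⊢
    intro e
    have := congrFun (flipEdges_comp_map s δ (collapse (N := N) i)) (σ⁻¹ e)
    rw [Function.comp_apply, this]
    simp only [flipEdges, hδ]
    split_ifs <;> simp
  · intro δ hδ
    funext e
    simp [flipEdges_flipEdges]
  · intro δ hδ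
    have : (flipEdges s δ ∘ ⇑σ⁻¹) ∘ ⇑σ = flipEdges s δ := by funext e; simp
    simp only [this, flipEdges_flipEdges]
  · intro δ hδ
    have h := graphClass_flip undirected d
      (Fin.append δ fun e => Prod.map (inner i) (inner i) (Γ'.2 e)) (permAppend σ 1)
      (Fin.append s fun _ => false) (by
        refine hs.imp id fun h e => ?_
        refine Fin.addCases (fun e => ?_) (fun e => ?_) e <;> simp [h])
    rw [← append_flip, sign_append, sign_one, mul_one] at h
    exact h.symm

theorem insertGraph_right {M N : ℕ} (i : Fin (M + 1)) (Γ : Multidigraph M) {k : ℕ}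
    (γ : Fin k → Fin (N + 1) × Fin (N + 1)) (σ : Equiv.Perm (Fin k)) (s : Fin k → Bool)
    (hs : undirected ∨ ∀ e, s e = false) :
    (graphRel undirected d (M + N)).mkQ (insertGraph i Γ ⟨k, flipEdges s (γ ∘ σ)⟩) =
      (((orderSign d σ * flipSign d s : ℤˣ) : ℤ) : ℝ) •
        (graphRel undirected d (M + N)).mkQ (insertGraph i Γ ⟨k, γ⟩) := by
  simp only [insertGraph, map_sum, Finset.smul_sum]
  refine Finset.sum_congr rfl fun δ _ => ?_
  have h := graphClass_flip undirected d
    (Fin.append δ fun e => Prod.map (inner i) (inner i) (γ e)) (permAppend 1 σ)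
    (Fin.append (fun _ => false) s) (by
      refine hs.imp id fun h e => ?_
      refine Fin.addCases (fun e => ?_) (fun e => ?_) e <;> simp [h])
  rw [← append_flip, sign_append, sign_one, one_mul] at h
  rw [flipEdges_comp_map]
  exact h

/-- The bilinear extension of `insertGraph`. -/
def preComp (M N : ℕ) (i : Fin (M + 1)) :
    (Multidigraph M →₀ ℝ) →ₗ[ℝ] (Multidigraph N →₀ ℝ) →ₗ[ℝ] GraphSpace undirected d (M + N) :=
  Finsupp.linearCombination ℝ fun Γ => Finsupp.linearCombination ℝ fun Γ' =>
    (graphRel undirected d (M + N)).mkQ (insertGraph i Γ Γ')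

theorem preComp_single {M N : ℕ} (i : Fin (M + 1)) (Γ : Multidigraph M) (Γ' : Multidigraph N) :
    preComp undirected d M N i (Finsupp.single Γ 1) (Finsupp.single Γ' 1) =
      (graphRel undirected d (M + N)).mkQ (insertGraph i Γ Γ') := by
  rw [preComp, Finsupp.linearCombination_single, one_smul, Finsupp.linearCombination_single,
    one_smul]

theorem preComp_right {M N : ℕ} (i : Fin (M + 1)) (x : Multidigraph M →₀ ℝ) :
    graphRel undirected d N ≤ LinearMap.ker (preComp undirected d M N i x) := by
  refine Submodule.span_le.2 ?_
  rintro _ ⟨k, γ, σ, s, hs, rfl⟩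
  rw [SetLike.mem_coe, LinearMap.mem_ker]
  induction x using Finsupp.induction_linear with
  | zero => rw [map_zero, LinearMap.zero_apply]
  | add x y hx hy => rw [map_add, LinearMap.add_apply, hx, hy, add_zero]
  | single Γ c =>
    have h : Finsupp.single Γ c = c • Finsupp.single Γ (1 : ℝ) := by simp
    rw [h, map_smul, LinearMap.smul_apply, map_sub, map_smul, preComp_single, preComp_single,
      insertGraph_right undirected d i Γ γ σ s hs, sub_self, smul_zero]

/-- The partial composition of classes of graphs. -/
def graphComp (M N : ℕ) (i : Fin (M + 1)) :
    GraphSpace undirected d M →ₗ[ℝ] GraphSpace undirected d N →ₗ[ℝ]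
      GraphSpace undirected d (M + N) :=
  (graphRel undirected d M).liftQ
    { toFun := fun x => (graphRel undirected d N).liftQ (preComp undirected d M N i x)
        (preComp_right undirected d i x)
      map_add' := fun x y => Submodule.linearMap_qext _ (LinearMap.ext fun z =>
        LinearMap.congr_fun (map_add (preComp undirected d M N i) x y) z)
      map_smul' := fun c x => Submodule.linearMap_qext _ (LinearMap.ext fun z =>
        LinearMap.congr_fun (map_smul (preComp undirected d M N i) c x) z) } (by
    refine Submodule.span_le.2 ?_
    rintro _ ⟨k, γ, σ, s, hs, rfl⟩
    rw [SetLike.mem_coe, LinearMap.mem_ker]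
    refine Submodule.linearMap_qext _ (Finsupp.lhom_ext' fun Γ' => LinearMap.ext_ring ?_)
    change preComp undirected d M N i _ (Finsupp.single Γ' 1) = 0
    rw [map_sub, map_smul, LinearMap.sub_apply, LinearMap.smul_apply, preComp_single,
      preComp_single, insertGraph_left undirected d i Γ' γ σ s hs, sub_self])

/-- The action of a permutation of the vertices on classes of graphs. -/
def graphAct (N : ℕ) (σ : Equiv.Perm (Fin (N + 1))) :
    GraphSpace undirected d N →ₗ[ℝ] GraphSpace undirected d N :=
  Submodule.mapQ _ _ (Finsupp.lmapDomain ℝ ℝ (relabel σ)) (by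
    refine Submodule.span_le.2 ?_
    rintro _ ⟨k, γ, τ, s, hs, rfl⟩
    refine Submodule.subset_span
      ⟨k, fun e => Prod.map ⇑σ⁻¹ ⇑σ⁻¹ (γ e), τ, s, hs, ?_⟩
    simp only [map_sub, map_smul, Finsupp.lmapDomain_apply, Finsupp.mapDomain_single, relabel,
      flipEdges_comp_map]
    rfl)

end Lift

/-- The operad of classes of graphs. A graph with `k` edges has degree `k (1 - d)`, and the identity is
the graph with one vertex and no edge. -/
def GraphOperad (undirected : Prop) (d : ℤ) : OperadData where
  obj N := GraphSpace undirected d N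
  homog N a := Submodule.span ℝ
    {x | ∃ Γ : Multidigraph N, (Γ.1 : ℤ) * (1 - d) = a ∧ x = graphClass undirected d Γ}
  one := graphClass undirected d ⟨0, Fin.elim0⟩
  act := graphAct undirected d
  comp := graphComp undirected d

/-- The operad `Gra_d` of undirected graphs. -/
abbrev Gra (d : ℤ) : OperadData := GraphOperad True d

/-- The operad `dGra_d` of directed graphs. -/
abbrev dGra (d : ℤ) : OperadData := GraphOperad False d

/-! ## Functions on an NP-manifold in Darboux coordinates -/

/-- The type of a Darboux coordinate system on an NP-manifold of degree `n`, for which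
`ω = ∑ dx^μ ∧ dp_μ + ∑ dψ^α ∧ dχ_α + 1/2 ∑ κ_ab dξ^a ∧ dξ^b`: the numbers of coordinates of each kind,
and the matrix `κ`. The coordinates `x`, `p` have degrees `0`, `n`, the `i`-th kind of coordinates `ψ`,
`χ` has degrees `i`, `n - i` for `1 ≤ i`, `2 i < n`, and the coordinates `ξ`, which only occur for `n`
even, have degree `n / 2`. -/
structure Darboux (n : ℕ) where
  numX : ℕ
  numPsi : Fin ((n - 1) / 2) → ℕ
  numXi : ℕ
  κ : Matrix (Fin numXi) (Fin numXi) ℝ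
  isUnit_det : IsUnit κ.det
  symm : ∀ a b, κ a b = -(-1) ^ (n / 2) * κ b a
  numXi_of_odd : Odd n → numXi = 0

namespace Darboux

variable {n : ℕ} (D : Darboux n)

/-- The coordinates. The `i`-th kind of `ψ`, `χ` is indexed by `i - 1 ∈ Fin ((n - 1) / 2)`. -/
inductive Coord
  | x (μ : Fin D.numX)
  | psi (i : Fin ((n - 1) / 2)) (α : Fin (D.numPsi i))
  | xi (a : Fin D.numXi)
  | chi (i : Fin ((n - 1) / 2)) (α : Fin (D.numPsi i))
  | p (μ : Fin D.numX)
  deriving DecidableEq, Fintype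

variable {D} in
/-- The degree of a coordinate. -/
def Coord.deg : D.Coord → ℕ
  | x _ => 0
  | psi i _ => i + 1
  | xi _ => n / 2
  | chi i _ => n - (i + 1)
  | p _ => n

/-- The coordinates on the base: those of degree zero. -/
abbrev BaseCoord : Type := {c : D.Coord // c.deg = 0}

/-- The coordinates of positive even degree; they commute with all coordinates. -/
abbrev EvenCoord : Type := {c : D.Coord // c.deg ≠ 0 ∧ Even c.deg}

/-- The coordinates of odd degree; they anticommute among each other. -/
abbrev OddCoord : Type := {c : D.Coord // Odd c.deg}

end Darboux

section Smooth

theorem extend_apply {ι : Type} {U : TopologicalSpace.Opens (ι → ℝ)} (f : U → ℝ) {y : ι → ℝ}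
    (hy : y ∈ U) : Function.extend Subtype.val f (0 : (ι → ℝ) → ℝ) y = f ⟨y, hy⟩ :=
  Subtype.val_injective.extend_apply f 0 ⟨y, hy⟩

variable {ι : Type} [Fintype ι]

/-- The smooth functions on an open subset of `ℝ ^ ι`. -/
def smoothSubalgebra (U : TopologicalSpace.Opens (ι → ℝ)) : Subalgebra ℝ (U → ℝ) where
  carrier := {f | ContDiffOn ℝ ∞ (Function.extend Subtype.val f 0) U}
  mul_mem' {f g} hf hg := (ContDiffOn.mul hf hg).congr fun y hy => by
    have h (k : U → ℝ) := extend_apply k (y := y) hy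
    simp [h]
  add_mem' {f g} hf hg := (ContDiffOn.add hf hg).congr fun y hy => by
    have h (k : U → ℝ) := extend_apply k (y := y) hy
    simp [h]
  algebraMap_mem' c := (contDiffOn_const (c := c)).congr fun y hy => by
    have h (k : U → ℝ) := extend_apply k (y := y) hy
    simp [h]

/-- The algebra of smooth functions on an open subset of `ℝ ^ ι`. -/
def Smooth (U : TopologicalSpace.Opens (ι → ℝ)) : Type := smoothSubalgebra U

instance (U : TopologicalSpace.Opens (ι → ℝ)) : CommRing (Smooth U) :=
  inferInstanceAs (CommRing (smoothSubalgebra U))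

instance (U : TopologicalSpace.Opens (ι → ℝ)) : Algebra ℝ (Smooth U) :=
  inferInstanceAs (Algebra ℝ (smoothSubalgebra U))

variable {U : TopologicalSpace.Opens (ι → ℝ)}

theorem differentiableAt_extend (f : Smooth U) (y : U) :
    DifferentiableAt ℝ (Function.extend Subtype.val f.1 0) (y : ι → ℝ) :=
  ((f.2 : ContDiffOn ℝ ∞ _ _).contDiffAt (U.isOpen.mem_nhds y.2)).differentiableAt (by simp)

open Classical in
/-- The partial derivative of a smooth function with respect to the coordinate `c`. -/
def Smooth.pderiv (c : ι) : Smooth U →ₗ[ℝ] Smooth U where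
  toFun f :=
    ⟨fun y => fderiv ℝ (Function.extend Subtype.val f.1 0) (y : ι → ℝ) (Pi.single c 1), by
      have h := ((f.2 : ContDiffOn ℝ ∞ _ _).fderiv_of_isOpen U.isOpen
        (m := ∞) (by simp)).clm_apply (contDiffOn_const (c := (Pi.single c 1 : ι → ℝ)))
      exact h.congr fun y hy => extend_apply _ hy⟩
  map_add' f g := by
    refine Subtype.ext (funext fun y => ?_)
    have h : Function.extend Subtype.val (f + g).1 (0 : (ι → ℝ) → ℝ) =
        Function.extend Subtype.val f.1 0 + Function.extend Subtype.val g.1 0 := by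
      funext z
      by_cases hz : z ∈ U
      · simp [extend_apply _ hz]; rfl
      · simp [Function.extend_apply', hz]
    simp only [h, fderiv_add (differentiableAt_extend f y) (differentiableAt_extend g y)]
    rfl
  map_smul' a f := by
    refine Subtype.ext (funext fun y => ?_)
    have h : Function.extend Subtype.val (a • f).1 (0 : (ι → ℝ) → ℝ) =
        a • Function.extend Subtype.val f.1 0 := by
      funext z
      by_cases hz : z ∈ U
      · simp [extend_apply _ hz]; rfl
      · simp [Function.extend_apply', hz]
    simp only [h, fderiv_const_smul (differentiableAt_extend f y) a]
    rfl

/-- Polynomials in graded commutative variables, with smooth functions on `U` as coefficients: the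
variables indexed by `E` are even, those indexed by `O` are odd. -/
def GradedFun (U : TopologicalSpace.Opens (ι → ℝ)) (E O : Type) : Type :=
  Smooth U ⊗[ℝ] MvPolynomial E ℝ ⊗[ℝ] ExteriorAlgebra ℝ (O →₀ ℝ)

namespace GradedFun

variable {E O : Type}

instance : Ring (GradedFun U E O) :=
  inferInstanceAs (Ring (Smooth U ⊗[ℝ] MvPolynomial E ℝ ⊗[ℝ] ExteriorAlgebra ℝ (O →₀ ℝ)))

instance : Algebra ℝ (GradedFun U E O) :=
  inferInstanceAs (Algebra ℝ (Smooth U ⊗[ℝ] MvPolynomial E ℝ ⊗[ℝ] ExteriorAlgebra ℝ (O →₀ ℝ)))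

/-- The function `f · c₁ ⋯ c_k · θ₁ ⋯ θ_l` with a smooth function `f` on `U`, even variables `c_i` and
odd variables `θ_i`. -/
def monomial (f : Smooth U) (s : Multiset E) (t : List O) : GradedFun U E O :=
  (f ⊗ₜ[ℝ] (s.map (MvPolynomial.X (R := ℝ))).prod) ⊗ₜ[ℝ]
    (t.map fun c => ExteriorAlgebra.ι ℝ (Finsupp.single c (1 : ℝ))).prod

/-- The algebra automorphism which changes the sign of the odd variables. -/
def parity : GradedFun U E O →ₗ[ℝ] GradedFun U E O :=
  TensorProduct.map LinearMap.id
    (CliffordAlgebra.involute (Q := (0 : QuadraticForm ℝ (O →₀ ℝ)))).toLinearMap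

/-- The partial derivative with respect to a coordinate of `U`. -/
def basePartial (c : ι) : GradedFun U E O →ₗ[ℝ] GradedFun U E O :=
  TensorProduct.map (TensorProduct.map (Smooth.pderiv c) LinearMap.id) LinearMap.id

/-- The partial derivative with respect to an even variable. -/
def evenPartial (c : E) : GradedFun U E O →ₗ[ℝ] GradedFun U E O :=
  TensorProduct.map
    (TensorProduct.map LinearMap.id (MvPolynomial.pderiv (R := ℝ) c).toLinearMap) LinearMap.id

/-- The left partial derivative with respect to an odd variable. -/
def oddPartial (c : O) : GradedFun U E O →ₗ[ℝ] GradedFun U E O :=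
  TensorProduct.map LinearMap.id
    (CliffordAlgebra.contractLeft (Q := (0 : QuadraticForm ℝ (O →₀ ℝ))) (Finsupp.lapply c))

end GradedFun

end Smooth

namespace Darboux

variable {n : ℕ} (D : Darboux n) (U : TopologicalSpace.Opens (D.BaseCoord → ℝ))

/-- The algebra `C^∞(V)` of functions on the NP-manifold `V` with base `U` and Darboux coordinates of
type `D`. -/
abbrev Fun : Type := GradedFun U D.EvenCoord D.OddCoord

/-- The homogeneous functions of degree `a`. -/
def homog (a : ℤ) : Submodule ℝ (D.Fun U) :=
  Submodule.span ℝ {F | ∃ (f : Smooth U) (s : Multiset D.EvenCoord) (t : List D.OddCoord),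
    (((s.map fun c => c.1.deg).sum + (t.map fun c => c.1.deg).sum : ℕ) : ℤ) = a ∧
      F = GradedFun.monomial f s t}

/-- The left partial derivative with respect to a coordinate. -/
def partialDeriv (c : D.Coord) : D.Fun U →ₗ[ℝ] D.Fun U :=
  if h : c.deg = 0 then GradedFun.basePartial ⟨c, h⟩
  else if h' : Even c.deg then GradedFun.evenPartial ⟨c, h, h'⟩
  else GradedFun.oddPartial ⟨c, Nat.not_even_iff_odd.1 h'⟩

variable {U}

/-- The `N`-fold tensor power of the space of functions. -/
abbrev Tensor (U : TopologicalSpace.Opens (D.BaseCoord → ℝ)) (N : ℕ) : Type :=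
  ⨂[ℝ] _ : Fin N, D.Fun U

variable {N : ℕ}

/-- The partial derivative with respect to `c` acting on the `i`-th factor, with the Koszul sign. -/
def derivAt (c : D.Coord) (i : Fin N) : D.Tensor U N →ₗ[ℝ] D.Tensor U N :=
  PiTensorProduct.map fun j =>
    if j < i then GradedFun.parity ^ c.deg else if j = i then D.partialDeriv U c else LinearMap.id

/-- `∂/∂c` on the `i`-th factor composed with `∂/∂c'` on the `j`-th factor, acting first. -/
def deriv₂ (c c' : D.Coord) (i j : Fin N) : D.Tensor U N →ₗ[ℝ] D.Tensor U N :=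
  D.derivAt c i ∘ₗ D.derivAt c' j

/-- The operator of a directed edge from `i` to `j`:
`∂/∂x^μ_(i) ∂/∂p_μ^(j) + ∂/∂ψ^α_(i) ∂/∂χ_α^(j) + 1/2 ∂/∂ξ^a_(i) κ^ab ∂/∂ξ^b_(j)`. The last sum is empty
for `n` odd. -/
def directedEdge (i j : Fin N) : D.Tensor U N →ₗ[ℝ] D.Tensor U N :=
  (∑ μ, D.deriv₂ (.x μ) (.p μ) i j)
    + (∑ k, ∑ α, D.deriv₂ (.psi k α) (.chi k α) i j)
    + (1 / 2 : ℝ) • ∑ a, ∑ b, D.κ⁻¹ a b • D.deriv₂ (.xi a) (.xi b) i j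

/-- The operator of an undirected edge for `n` odd:
`∂/∂x^μ_(i) ∂/∂p_μ^(j) + ∂/∂p_μ^(i) ∂/∂x^μ_(j) + ∂/∂ψ^α_(i) ∂/∂χ_α^(j) + ∂/∂χ_α^(i) ∂/∂ψ^α_(j)`. -/
def undirectedEdgeOdd (i j : Fin N) : D.Tensor U N →ₗ[ℝ] D.Tensor U N :=
  (∑ μ, D.deriv₂ (.x μ) (.p μ) i j) + (∑ μ, D.deriv₂ (.p μ) (.x μ) i j)
    + (∑ k, ∑ α, D.deriv₂ (.psi k α) (.chi k α) i j)
    + (∑ k, ∑ α, D.deriv₂ (.chi k α) (.psi k α) i j)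

/-- The operator of an undirected edge for `n` even:
`∂/∂x^μ_(i) ∂/∂p_μ^(j) - ∂/∂p_μ^(i) ∂/∂x^μ_(j) + ∂/∂ψ^α_(i) ∂/∂χ_α^(j)
- (-1) ^ |ψ^α| ∂/∂χ_α^(i) ∂/∂ψ^α_(j) + ∂/∂ξ^a_(i) κ^ab ∂/∂ξ^b_(j)`. -/
def undirectedEdgeEven (i j : Fin N) : D.Tensor U N →ₗ[ℝ] D.Tensor U N :=
  (∑ μ, D.deriv₂ (U := U) (.x μ) (.p μ) i j) - (∑ μ, D.deriv₂ (.p μ) (.x μ) i j)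
    + (∑ k, ∑ α, D.deriv₂ (.psi k α) (.chi k α) i j)
    - (∑ k, ∑ α, (-1 : ℝ) ^ (Coord.psi k α : D.Coord).deg •
        D.deriv₂ (.chi k α) (.psi k α) i j)
    + ∑ a, ∑ b, D.κ⁻¹ a b • D.deriv₂ (.xi a) (.xi b) i j

/-- The operator of an undirected edge. -/
def undirectedEdge (i j : Fin N) : D.Tensor U N →ₗ[ℝ] D.Tensor U N :=
  if Odd n then D.undirectedEdgeOdd i j else D.undirectedEdgeEven i j

/-- The multiplication map `f₁ ⊗ ⋯ ⊗ f_N ↦ f₁ ⋯ f_N`. -/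
def mult (U : TopologicalSpace.Opens (D.BaseCoord → ℝ)) (N : ℕ) : D.Tensor U N →ₗ[ℝ] D.Fun U :=
  PiTensorProduct.lift (MultilinearMap.mkPiAlgebraFin ℝ N (D.Fun U))

/-- Apply to `f₁ ⊗ ⋯ ⊗ f_N` the product over the edges of `Γ`, in their order, of the operators `Δ i j`,
and multiply the factors. -/
def graphAction (Δ : Fin (N + 1) → Fin (N + 1) → D.Tensor U (N + 1) →ₗ[ℝ] D.Tensor U (N + 1))
    (Γ : Multidigraph N) (f : Fin (N + 1) → D.Fun U) : D.Fun U :=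
  D.mult U (N + 1) ((List.ofFn fun e => Δ (Γ.2 e).1 (Γ.2 e).2).prod
    (PiTensorProduct.tprod ℝ f))

variable (U) in
/-- The endomorphism operad of the graded vector space of functions. -/
abbrev End : OperadData := EndOperad (V := D.Fun U) (D.homog U) GradedFun.parity

/-- The value of an operation of the endomorphism operad. -/
def eval (θ : (D.End U).obj N) (f : Fin (N + 1) → D.Fun U) : D.Fun U :=
  (show MultilinearMap ℝ (fun _ : Fin (N + 1) => D.Fun U) (D.Fun U) from θ) f

end Darboux

end NPGraph
end

noncomputable section

namespace NPGraph

/-! ## Operators on tensor powers of a graded commutative algebra -/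

section Super

variable {V : Type} [Ring V] [Algebra ℝ V]

/-! An edge acts on the tensor powers of the function algebra as a sum of products of two coordinate
derivations whose degrees add up to n = d - 1, each placed in its factor by the Koszul rule.
Everything follows from the coordinate derivations being graded derivations which commute up to the
Koszul sign.

Two edge operators commute up to (-1)^(n * n) = (-1)^n. This matches the sign sgn(σ)^(d + 1) of
reordering edges, so the formula of a graph descends to classes (`graphOp_perm`, `rep`).

Compatibility with composition is the Leibniz rule: differentiating the product inserted at a vertex
is the sum of the derivatives of its factors (`opAt_comp_insertT`), which is the reconnection of a
half-edge in all possible ways. The edges of the inserted graph leave the inserted place at the cost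
of a power of the parity on the factors before it, and this is the Koszul sign built into the
endomorphism operad (`insertT_edgeProd`). Associativity of the product concludes
(`endComp_graphOp`). For equivariance, the Koszul permutation of the factors carries a derivation in
place a to the same derivation in place σ a (`koszulMap_comp_opAt`), and multiplication is invariant
under it (`mulAll_comp_koszulMap`). `IsEdgeOperator` isolates what is needed of the edge operators,
and `SuperCalculus.isEdgeOperator` derives it from graded commuting derivations. The coordinate
derivations are a case of this: partial derivatives of smooth functions, of polynomials and
contractions of the exterior algebra, on the tensor product of the three algebras.

The signed sum over all reversals of edges changes by exactly the undirected sign when edges are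
reversed, so it is defined on undirected classes (`orSum_flip`). Reversal commutes with reconnection
and relabelling, which makes it an operad morphism. Forgetting directions with the weight 2^(-k) is
a left inverse (`orMap_injective`). Expanding the ordered product over the edges of Δ_ij + (-1)^d
Δ_ji, with Δ the directed operator, gives this same sum (`sum_flip_edgeProd`). It remains to
identify this binomial in coordinates, where the symmetry of the inverse of κ makes the two halves
of the ξ term add up (`undirectedEdge_eq`). -/

/-- The tensor powers of an algebra. -/
abbrev TensorPow (V : Type) [Ring V] [Algebra ℝ V] (N : ℕ) : Type := ⨂[ℝ] _ : Fin N, V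

theorem tprod_eq_smul {N : ℕ} {f g : Fin N → V} {c : ℝ} (a : Fin N) (ha : f a = c • g a)
    (h : ∀ j, j ≠ a → f j = g j) :
    PiTensorProduct.tprod ℝ f = c • PiTensorProduct.tprod ℝ g := by
  have : f = Function.update g a (c • g a) := by
    funext j
    by_cases hj : j = a
    · subst hj; simp [ha]
    · simp [hj, h j hj]
  rw [this, MultilinearMap.map_update_smul, Function.update_eq_self]

/-- The operator `A`, of parity `p`, acting on the `a`-th factor with the Koszul sign. -/
def opAt (P : V →ₗ[ℝ] V) (p : ℕ) (A : V →ₗ[ℝ] V) {N : ℕ} (a : Fin N) :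
    TensorPow V N →ₗ[ℝ] TensorPow V N :=
  PiTensorProduct.map fun j => if j < a then P ^ p else if j = a then A else LinearMap.id

theorem opAt_tprod (P : V →ₗ[ℝ] V) (p : ℕ) (A : V →ₗ[ℝ] V) {N : ℕ} (a : Fin N) (f : Fin N → V) :
    opAt P p A a (PiTensorProduct.tprod ℝ f) = PiTensorProduct.tprod ℝ fun j =>
      if j < a then (P ^ p) (f j) else if j = a then A (f j) else f j := by
  rw [opAt, PiTensorProduct.map_tprod]
  congr 1
  funext j
  split_ifs <;> rfl

theorem apply_pow_of_anticomm {P A : V →ₗ[ℝ] V} {p : ℕ}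
    (h : ∀ v, A (P v) = (-1 : ℝ) ^ p • P (A v)) (q : ℕ) (v : V) :
    A ((P ^ q) v) = (-1 : ℝ) ^ (p * q) • (P ^ q) (A v) := by
  induction q generalizing v with
  | zero => simp
  | succ q ih =>
    rw [pow_succ, Module.End.mul_apply, Module.End.mul_apply, ih, h, map_smul, smul_smul,
      ← pow_add, mul_add, mul_one]

theorem neg_one_pow_smul_smul (p : ℕ) (v : V) : (-1 : ℝ) ^ p • (-1 : ℝ) ^ p • v = v := by
  rw [smul_smul, ← mul_pow]; simp

/-- For distinct places the sign arises only in the leftmost one, where one operator meets the power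
of `P` belonging to the other. In a common place it is the sign `hAB`. The powers of `P` further
left commute. -/
theorem opAt_comm {P A B : V →ₗ[ℝ] V} {p q : ℕ}
    (hA : ∀ v, A (P v) = (-1 : ℝ) ^ p • P (A v)) (hB : ∀ v, B (P v) = (-1 : ℝ) ^ q • P (B v))
    (hAB : ∀ v, A (B v) = (-1 : ℝ) ^ (p * q) • B (A v)) {N : ℕ} (a b : Fin N) :
    opAt P p A a ∘ₗ opAt P q B b = (-1 : ℝ) ^ (p * q) • (opAt P q B b ∘ₗ opAt P p A a) := by
  refine PiTensorProduct.ext (MultilinearMap.ext fun f => ?_)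
  have hP (v : V) : (P ^ p) ((P ^ q) v) = (P ^ q) ((P ^ p) v) := by
    rw [← Module.End.mul_apply, ← Module.End.mul_apply, ← pow_add, ← pow_add, add_comm]
  simp only [LinearMap.compMultilinearMap_apply, LinearMap.comp_apply, LinearMap.smul_apply,
    opAt_tprod]
  rcases lt_trichotomy a b with h | rfl | h
  · refine tprod_eq_smul a ?_ fun j hj => ?_
    · simp [h, apply_pow_of_anticomm hA]
    · simp only [hj, if_false]
      split_ifs <;> first | rfl | exact hP _ | omega
  · refine tprod_eq_smul a (by simp [hAB]) fun j hj => ?_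
    simp only [hj, if_false]
    split_ifs <;> first | rfl | exact hP _
  · refine tprod_eq_smul b ?_ fun j hj => ?_
    · simp [h, apply_pow_of_anticomm hB, mul_comm q p, neg_one_pow_smul_smul]
    · simp only [hj, if_false]
      split_ifs <;> first | rfl | exact hP _ | omega

/-- The multiplication map of a tensor power. -/
def mulAll (V : Type) [Ring V] [Algebra ℝ V] (N : ℕ) : TensorPow V N →ₗ[ℝ] V :=
  PiTensorProduct.lift (MultilinearMap.mkPiAlgebraFin ℝ N V)

theorem mulAll_tprod {N : ℕ} (f : Fin N → V) :
    mulAll V N (PiTensorProduct.tprod ℝ f) = (List.ofFn f).prod := by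
  simp [mulAll]

/-! ### Insertion -/

/-- The map of tensor powers which applies `Φ` to the factors inserted in the place `i`, and `Q` to
the factors before them. -/
def insertT {M N : ℕ} (i : Fin (M + 1)) (Q : V →ₗ[ℝ] V) :
    (TensorPow V (N + 1) →ₗ[ℝ] V) →ₗ[ℝ] TensorPow V (M + N + 1) →ₗ[ℝ] TensorPow V (M + 1) where
  toFun Φ := PiTensorProduct.lift (MultilinearMap.mk'
    (fun f => PiTensorProduct.tprod ℝ
      (insertFun i Q (Φ.compMultilinearMap (PiTensorProduct.tprod ℝ)) f))
    (fun f t v w => by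
      obtain ⟨j, L, h⟩ := insertFun_update i Q (Φ.compMultilinearMap (PiTensorProduct.tprod ℝ)) f t
      simp only [h, map_add, MultilinearMap.map_update_add])
    (fun f t c v => by
      obtain ⟨j, L, h⟩ := insertFun_update i Q (Φ.compMultilinearMap (PiTensorProduct.tprod ℝ)) f t
      simp only [h, map_smul, MultilinearMap.map_update_smul]))
  map_add' Φ Ψ := by
    refine PiTensorProduct.ext (MultilinearMap.ext fun f => ?_)
    simp only [LinearMap.compMultilinearMap_apply, LinearMap.add_apply, PiTensorProduct.lift.tprod]
    simp only [MultilinearMap.mk', MultilinearMap.coe_mk]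
    rw [insertFun_eq_update,
      insertFun_eq_update (φ := Φ.compMultilinearMap (PiTensorProduct.tprod ℝ)),
      insertFun_eq_update (φ := Ψ.compMultilinearMap (PiTensorProduct.tprod ℝ))]
    simp
  map_smul' c Φ := by
    refine PiTensorProduct.ext (MultilinearMap.ext fun f => ?_)
    simp only [LinearMap.compMultilinearMap_apply, LinearMap.smul_apply, PiTensorProduct.lift.tprod,
      RingHom.id_apply]
    simp only [MultilinearMap.mk', MultilinearMap.coe_mk]
    rw [insertFun_eq_update,
      insertFun_eq_update (φ := Φ.compMultilinearMap (PiTensorProduct.tprod ℝ))]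
    simp

theorem insertT_tprod {M N : ℕ} (i : Fin (M + 1)) (Q : V →ₗ[ℝ] V)
    (Φ : TensorPow V (N + 1) →ₗ[ℝ] V) (f : Fin (M + N + 1) → V) :
    insertT i Q Φ (PiTensorProduct.tprod ℝ f) =
      PiTensorProduct.tprod ℝ (insertFun i Q (fun g => Φ (PiTensorProduct.tprod ℝ g)) f) := by
  simp only [insertT, LinearMap.coe_mk, AddHom.coe_mk, PiTensorProduct.lift.tprod]
  rfl

/-! ### Order of the new labels and the fibres of `collapse`. -/

theorem inner_lt_inner {M N : ℕ} (i : Fin (M + 1)) (l l' : Fin (N + 1)) :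
    inner i l < inner i l' ↔ l < l' := by
  simp only [inner, Fin.lt_def]
  omega

theorem outer_lt_inner {M N : ℕ} {i j : Fin (M + 1)} (hj : j ≠ i) (l : Fin (N + 1)) :
    outer i j < inner i l ↔ j < i := by
  have hj' := Fin.val_ne_of_ne hj
  simp only [inner, outer, Fin.lt_def]
  split_ifs <;> simp <;> omega

theorem inner_lt_outer {M N : ℕ} {i j : Fin (M + 1)} (hj : j ≠ i) (l : Fin (N + 1)) :
    inner i l < outer i j ↔ i < j := by
  have hj' := Fin.val_ne_of_ne hj
  simp only [inner, outer, Fin.lt_def]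
  split_ifs <;> simp <;> omega

theorem outer_lt_outer {M N : ℕ} {i j k : Fin (M + 1)} (hj : j ≠ i) (hk : k ≠ i) :
    outer (N := N) i j < outer i k ↔ j < k := by
  have hj' := Fin.val_ne_of_ne hj
  have hk' := Fin.val_ne_of_ne hk
  simp only [outer, Fin.lt_def]
  split_ifs <;> simp <;> omega

theorem outer_ne_inner {M N : ℕ} {i j : Fin (M + 1)} (hj : j ≠ i) (l : Fin (N + 1)) :
    outer i j ≠ inner i l := by
  have hj' := Fin.val_ne_of_ne hj
  simp only [inner, outer, Fin.lt_def, Fin.ext_iff, ne_eq]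
  split_ifs <;> simp <;> omega

theorem outer_injective {M N : ℕ} {i j k : Fin (M + 1)} (hj : j ≠ i) (hk : k ≠ i) :
    outer (N := N) i j = outer i k ↔ j = k := by
  have hj' := Fin.val_ne_of_ne hj
  have hk' := Fin.val_ne_of_ne hk
  simp only [outer, Fin.lt_def, Fin.ext_iff]
  split_ifs <;> simp <;> omega

theorem inner_eq_inner {M N : ℕ} (i : Fin (M + 1)) (l l' : Fin (N + 1)) :
    inner i l = inner i l' ↔ l = l' := (inner_injective i).eq_iff

theorem collapse_inner {M N : ℕ} (i : Fin (M + 1)) (l : Fin (N + 1)) :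
    collapse (N := N) i (inner i l) = i := by
  have h1 : ¬(i + l : ℕ) < i := by omega
  have h2 : (i + l : ℕ) ≤ i + N := by omega
  simp [collapse, inner, h2]

theorem collapse_outer {M N : ℕ} {i j : Fin (M + 1)} (hj : j ≠ i) :
    collapse (N := N) i (outer i j) = j := by
  have hj' : (j : ℕ) ≠ i := fun h => hj (Fin.ext h)
  by_cases h : (j : ℕ) < i
  · simp [collapse, outer, Fin.lt_def, h]
  · have h1 : ¬(j + N : ℕ) < i := by omega
    have h2 : ¬(j + N : ℕ) ≤ i + N := by omega
    simp [collapse, outer, Fin.lt_def, h, h1, h2]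

theorem filter_collapse_self {M N : ℕ} (i : Fin (M + 1)) :
    (Finset.univ.filter fun t => collapse (N := N) i t = i) = Finset.univ.image (inner i) := by
  ext t
  simp only [Finset.mem_filter, Finset.mem_univ, true_and, Finset.mem_image]
  constructor
  · intro h
    rcases exists_inner_or_outer (N := N) i t with ⟨l, rfl, -⟩ | ⟨j, hj, rfl, -⟩
    · exact ⟨l, rfl⟩
    · exact absurd (collapse_outer hj ▸ h) hj
  · rintro ⟨l, rfl⟩
    exact collapse_inner i l

theorem filter_collapse_of_ne {M N : ℕ} {i j : Fin (M + 1)} (hj : j ≠ i) :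
    (Finset.univ.filter fun t => collapse (N := N) i t = j) = {outer i j} := by
  ext t
  simp only [Finset.mem_filter, Finset.mem_univ, true_and, Finset.mem_singleton]
  constructor
  · rintro rfl
    rcases exists_inner_or_outer (N := N) i t with ⟨l, rfl, -⟩ | ⟨j, hj', rfl, -⟩
    · exact absurd (collapse_inner i l) hj
    · rw [collapse_outer hj']
  · rintro rfl
    exact collapse_outer hj

/-- The Koszul factors `P ^ p` of an operator in an inserted place split in two: those on inserted
factors belong to the operator seen by `Φ`, those on factors before the insertion join the existing
`P ^ m`. -/
theorem insertT_comp_opAt_inner {M N : ℕ} (i : Fin (M + 1)) (P : V →ₗ[ℝ] V) (m : ℕ)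
    (Φ : TensorPow V (N + 1) →ₗ[ℝ] V) (p : ℕ) (A : V →ₗ[ℝ] V) (l : Fin (N + 1)) :
    insertT i (P ^ m) Φ ∘ₗ opAt P p A (inner i l) =
      insertT i (P ^ (m + p)) (Φ ∘ₗ opAt P p A l) := by
  refine PiTensorProduct.ext (MultilinearMap.ext fun f => ?_)
  simp only [LinearMap.compMultilinearMap_apply, LinearMap.comp_apply, opAt_tprod, insertT_tprod]
  congr 1
  funext j
  rcases lt_trichotomy j i with h | rfl | h
  · simp [insertFun, h, outer_lt_inner h.ne, pow_add]
  · simp [insertFun, inner_lt_inner, inner_eq_inner]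
  · simp [insertFun, h.not_gt, h.ne', outer_lt_inner h.ne', outer_ne_inner h.ne']

/-! ### Parity automorphisms and graded derivations. -/

/-- `P` is the parity automorphism of a graded commutative algebra. -/
structure IsParity (P : V →ₗ[ℝ] V) : Prop where
  apply_apply : ∀ v, P (P v) = v
  map_one : P 1 = 1
  map_mul : ∀ u v, P (u * v) = P u * P v
  comm_even : ∀ u v, P u = u → u * v = v * u
  comm_odd : ∀ u v, P u = -u → u * v = P v * u

/-- `A` is a derivation of parity `p` (acting from the left). -/
structure IsSuperDerivation (P : V →ₗ[ℝ] V) (p : ℕ) (A : V →ₗ[ℝ] V) : Prop where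
  anticomm : ∀ v, A (P v) = (-1 : ℝ) ^ p • P (A v)
  leibniz : ∀ u v, A (u * v) = A u * v + (P ^ p) u * A v

namespace IsParity

variable {P : V →ₗ[ℝ] V} (hP : IsParity P)

include hP

theorem pow_one_apply (p : ℕ) : (P ^ p) 1 = 1 := by
  induction p with
  | zero => rfl
  | succ p ih => rw [pow_succ, Module.End.mul_apply, hP.map_one, ih]

theorem pow_mul_apply (p : ℕ) (u v : V) : (P ^ p) (u * v) = (P ^ p) u * (P ^ p) v := by
  induction p generalizing u v with
  | zero => rfl
  | succ p ih => simp only [pow_succ, Module.End.mul_apply, hP.map_mul, ih]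

theorem pow_prod (p : ℕ) {N : ℕ} (f : Fin N → V) :
    (P ^ p) (List.ofFn f).prod = (List.ofFn fun j => (P ^ p) (f j)).prod := by
  induction N with
  | zero => simp [hP.pow_one_apply]
  | succ N ih => simp [List.ofFn_succ, hP.pow_mul_apply, ih]

theorem leibniz_prod {p : ℕ} {A : V →ₗ[ℝ] V} (hA : IsSuperDerivation P p A) {N : ℕ}
    (f : Fin N → V) :
    A (List.ofFn f).prod = ∑ a, (List.ofFn fun j =>
      if j < a then (P ^ p) (f j) else if j = a then A (f j) else f j).prod := by
  induction N with
  | zero =>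
    -- The Leibniz rule for 1 = 1 * 1 gives A 1 = A 1 + A 1, so A kills the empty product.
    have h := hA.leibniz 1 1
    rw [hP.pow_one_apply] at h
    simpa using h
  | succ N ih =>
    rw [List.ofFn_succ, List.prod_cons, hA.leibniz, ih, Fin.sum_univ_succ, Finset.mul_sum]
    congr 1
    · simp [List.ofFn_succ]
    · refine Finset.sum_congr rfl fun a _ => ?_
      rw [List.ofFn_succ, List.prod_cons]
      simp [Fin.succ_inj]

theorem mulAll_opAt {p : ℕ} {A : V →ₗ[ℝ] V} (hA : IsSuperDerivation P p A) {N : ℕ} :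
    A ∘ₗ mulAll V N = ∑ a, mulAll V N ∘ₗ opAt P p A a := by
  refine PiTensorProduct.ext (MultilinearMap.ext fun f => ?_)
  simp [mulAll_tprod, opAt_tprod, hP.leibniz_prod hA]

/-- When the derivation sits to the right of the insertion, its factor `P ^ p` lands on the inserted
product and distributes over it because `P` is multiplicative. -/
theorem opAt_comp_insertT_of_ne {M N : ℕ} {i j : Fin (M + 1)} (hj : j ≠ i) (p : ℕ)
    (A : V →ₗ[ℝ] V) :
    opAt P p A j ∘ₗ insertT i (P ^ 0) (mulAll V (N + 1)) =
      insertT i (P ^ 0) (mulAll V (N + 1)) ∘ₗ opAt P p A (outer i j) := by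
  refine PiTensorProduct.ext (MultilinearMap.ext fun f => ?_)
  simp only [LinearMap.compMultilinearMap_apply, LinearMap.comp_apply, opAt_tprod, insertT_tprod,
    mulAll_tprod]
  congr 1
  funext k
  by_cases hk : k = i
  · subst hk
    simp only [insertFun, lt_irrefl, if_false, if_true, hj.symm, inner_lt_outer hj,
      (outer_ne_inner hj _).symm, hP.pow_prod]
    split_ifs <;> rfl
  · simp [insertFun, hk, outer_lt_outer hk hj, outer_injective hk hj]

theorem opAt_comp_insertT_self {M N : ℕ} (i : Fin (M + 1)) {p : ℕ} {A : V →ₗ[ℝ] V}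
    (hA : IsSuperDerivation P p A) :
    opAt P p A i ∘ₗ insertT i (P ^ 0) (mulAll V (N + 1)) =
      ∑ l, insertT i (P ^ 0) (mulAll V (N + 1)) ∘ₗ opAt P p A (inner i l) := by
  have key (Φ : TensorPow V (N + 1) →ₗ[ℝ] V) :
      opAt P p A i ∘ₗ insertT i (P ^ 0) Φ = insertT i (P ^ (0 + p)) (A ∘ₗ Φ) := by
    refine PiTensorProduct.ext (MultilinearMap.ext fun f => ?_)
    simp only [LinearMap.compMultilinearMap_apply, LinearMap.comp_apply, opAt_tprod, insertT_tprod]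
    congr 1
    funext k
    simp only [insertFun]
    split_ifs <;> simp
  rw [key, hP.mulAll_opAt hA, map_sum]
  exact Finset.sum_congr rfl fun l _ => (insertT_comp_opAt_inner i P 0 _ p A l).symm

/-- This is the analytic form of reconnecting one half-edge: the fibre of `collapse` over `j` is the
set of its possible new ends. Over `i` the identity is the Leibniz rule; elsewhere the fibre is a
single place. -/
theorem opAt_comp_insertT {M N : ℕ} (i j : Fin (M + 1)) {p : ℕ} {A : V →ₗ[ℝ] V}
    (hA : IsSuperDerivation P p A) :
    opAt P p A j ∘ₗ insertT i (P ^ 0) (mulAll V (N + 1)) =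
      insertT i (P ^ 0) (mulAll V (N + 1)) ∘ₗ
        ∑ t with collapse (N := N) i t = j, opAt P p A t := by
  by_cases hj : j = i
  · subst hj
    rw [hP.opAt_comp_insertT_self j hA, filter_collapse_self,
      Finset.sum_image fun _ _ _ _ h => inner_injective j h]
    ext f
    simp
  · rw [hP.opAt_comp_insertT_of_ne hj, filter_collapse_of_ne hj, Finset.sum_singleton]

end IsParity

end Super

/-! ## The Koszul action of the symmetric group -/

section Koszul

variable {V : Type} [Ring V] [Algebra ℝ V]

theorem koszulSign_eq {N : ℕ} (σ : Equiv.Perm (Fin (N + 1))) (S : Finset (Fin (N + 1))) :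
    koszulSign σ S = ∏ i ∈ S, ∏ j ∈ S, if i < j ∧ σ j < σ i then (-1 : ℝ) else 1 := by
  rw [koszulSign, Finset.prod_filter, Finset.prod_product]

/-- A pair formed by a and another odd place j is an inversion exactly when the comparisons of j
with a before and after σ disagree. The ratio of the two signs is therefore the product of the two
counting signs; cross-multiplying avoids division. -/
theorem koszulSign_insert {N : ℕ} (σ : Equiv.Perm (Fin (N + 1))) {S : Finset (Fin (N + 1))}
    {a : Fin (N + 1)} (ha : a ∉ S) :
    koszulSign σ (insert a S) * (∏ j ∈ S, if j < a then (-1 : ℝ) else 1) =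
      koszulSign σ S * ∏ j ∈ S, if σ j < σ a then (-1 : ℝ) else 1 := by
  simp only [koszulSign_eq, Finset.prod_insert ha, Finset.prod_mul_distrib, lt_irrefl, false_and,
    if_false, one_mul]
  have : (∏ j ∈ S, if a < j ∧ σ j < σ a then (-1 : ℝ) else 1) *
      (∏ j ∈ S, if j < a ∧ σ a < σ j then (-1 : ℝ) else 1) *
      (∏ j ∈ S, if j < a then (-1 : ℝ) else 1) = ∏ j ∈ S, if σ j < σ a then (-1 : ℝ) else 1 := by
    rw [← Finset.prod_mul_distrib, ← Finset.prod_mul_distrib]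
    refine Finset.prod_congr rfl fun j hj => ?_
    have hja : j ≠ a := fun h => ha (h ▸ hj)
    have hs : σ j ≠ σ a := fun h => hja (σ.injective h)
    rcases hja.lt_or_gt with h | h <;> rcases hs.lt_or_gt with h' | h' <;>
      simp [h, h', h.not_gt, h'.not_gt]
  rw [← this]
  ring

theorem prod_ite_neg_one_mul_self {ι : Type} (S : Finset ι) (p : ι → Prop) [DecidablePred p] :
    (∏ j ∈ S, if p j then (-1 : ℝ) else 1) * (∏ j ∈ S, if p j then (-1 : ℝ) else 1) = 1 := by
  rw [← Finset.prod_mul_distrib]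
  refine Finset.prod_eq_one fun j _ => ?_
  split_ifs <;> simp

/-- The factors of `f` in the places in `S` are odd, the others are even. -/
def HasParity (P : V →ₗ[ℝ] V) {N : ℕ} (S : Finset (Fin N)) (f : Fin N → V) : Prop :=
  ∀ j, P (f j) = if j ∈ S then -f j else f j

/-- The parities after changing the `a`-th factor by an operator of parity `p`. -/
def flipAt {N : ℕ} (p : ℕ) (a : Fin N) (S : Finset (Fin N)) : Finset (Fin N) :=
  if Even p then S else if a ∈ S then S.erase a else insert a S

theorem mem_flipAt_of_ne {N : ℕ} (p : ℕ) {a j : Fin N} (h : j ≠ a) (S : Finset (Fin N)) :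
    j ∈ flipAt p a S ↔ j ∈ S := by
  unfold flipAt
  split_ifs <;> simp [h]

theorem mem_flipAt_self {N : ℕ} (p : ℕ) (a : Fin N) (S : Finset (Fin N)) :
    a ∈ flipAt p a S ↔ (a ∈ S ↔ Even p) := by
  unfold flipAt
  split_ifs <;> simp [*]

theorem koszulSign_flipAt {N : ℕ} (σ : Equiv.Perm (Fin (N + 1))) (S : Finset (Fin (N + 1)))
    (a : Fin (N + 1)) (p : ℕ) :
    (∏ j ∈ S, if j < a then (-1 : ℝ) ^ p else 1) * koszulSign σ (flipAt p a S) =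
      koszulSign σ S * ∏ j ∈ S, if σ j < σ a then (-1 : ℝ) ^ p else 1 := by
  unfold flipAt
  by_cases hp : Even p
  · simp [hp, hp.neg_one_pow]
  · rw [Nat.not_even_iff_odd] at hp
    rw [if_neg (Nat.not_even_iff_odd.2 hp), hp.neg_one_pow]
    split_ifs with ha
    · obtain ⟨T, haT, rfl⟩ : ∃ T, a ∉ T ∧ insert a T = S :=
        ⟨S.erase a, by simp, Finset.insert_erase ha⟩
      have h := koszulSign_insert σ haT
      have hu := prod_ite_neg_one_mul_self T fun j => j < a
      have hv := prod_ite_neg_one_mul_self T fun j => σ j < σ a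
      rw [Finset.erase_insert haT, Finset.prod_insert haT, Finset.prod_insert haT]
      simp only [lt_irrefl, if_false, one_mul]
      set u := ∏ j ∈ T, if j < a then (-1 : ℝ) else 1
      set v := ∏ j ∈ T, if σ j < σ a then (-1 : ℝ) else 1
      -- Multiply `h` by u v and use that u and v square to one.
      linear_combination (-u * v) * h + koszulSign σ (insert a T) * v * hu -
        u * koszulSign σ T * hv
    · rw [mul_comm, koszulSign_insert σ ha]

theorem HasParity.apply_pow {P : V →ₗ[ℝ] V} {N : ℕ} {S : Finset (Fin N)} {f : Fin N → V}
    (hf : HasParity P S f) (p : ℕ) (j : Fin N) :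
    (P ^ p) (f j) = (if j ∈ S then (-1 : ℝ) ^ p else 1) • f j := by
  induction p with
  | zero => simp
  | succ p ih =>
    rw [pow_succ', Module.End.mul_apply, ih, map_smul, hf j]
    split_ifs <;> simp [pow_succ]

theorem HasParity.opAt_tprod {P : V →ₗ[ℝ] V} {N : ℕ} {S : Finset (Fin N)} {f : Fin N → V}
    (hf : HasParity P S f) (p : ℕ) (A : V →ₗ[ℝ] V) (a : Fin N) :
    opAt P p A a (PiTensorProduct.tprod ℝ f) =
      (∏ j ∈ S, if j < a then (-1 : ℝ) ^ p else 1) •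
        PiTensorProduct.tprod ℝ (Function.update f a (A (f a))) := by
  have h : (∏ j ∈ S, if j < a then (-1 : ℝ) ^ p else 1) =
      ∏ j, if j ∈ S then if j < a then (-1 : ℝ) ^ p else 1 else 1 := by
    rw [Finset.prod_ite_mem, Finset.univ_inter]
  rw [NPGraph.opAt_tprod, h, ← MultilinearMap.map_smul_univ]
  congr 1
  funext j
  by_cases hj : j = a
  · subst hj; simp
  · by_cases hlt : j < a <;> simp [hj, hlt, hf.apply_pow]

theorem HasParity.update {P A : V →ₗ[ℝ] V} {p : ℕ}
    (hA : ∀ v, A (P v) = (-1 : ℝ) ^ p • P (A v)) {N : ℕ} {S : Finset (Fin N)} {f : Fin N → V}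
    (hf : HasParity P S f) (a : Fin N) :
    HasParity P (flipAt p a S) (Function.update f a (A (f a))) := by
  intro j
  by_cases hj : j = a
  · subst hj
    have h : P (A (f j)) = (-1 : ℝ) ^ p • A (P (f j)) := by rw [hA, neg_one_pow_smul_smul]
    rw [Function.update_self, h, hf j]
    rcases Nat.even_or_odd p with hp | hp
    · by_cases hj : j ∈ S <;> simp [mem_flipAt_self, hp, hj, hp.neg_one_pow]
    · by_cases hj : j ∈ S <;>
        simp [mem_flipAt_self, Nat.not_even_iff_odd.2 hp, hj, hp.neg_one_pow]
  · simp [hj, mem_flipAt_of_ne, hf j]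

theorem HasParity.perm {P : V →ₗ[ℝ] V} {N : ℕ} {S : Finset (Fin N)} {f : Fin N → V}
    (hf : HasParity P S f) (σ : Equiv.Perm (Fin N)) :
    HasParity P (S.map σ.toEmbedding) fun i => f (σ⁻¹ i) := by
  intro j
  have : j ∈ S.map σ.toEmbedding ↔ σ⁻¹ j ∈ S := by
    rw [Finset.mem_map_equiv]; rfl
  simp only [this]
  exact hf _

/-- Each factor is the sum of its odd half (v - P v) / 2 and its even half (v + P v) / 2, so
expanding a pure tensor leaves only tensors with factors of definite parity. -/
theorem IsParity.ext {P : V →ₗ[ℝ] V} (hP : IsParity P) {N : ℕ} {W : Type} [AddCommGroup W]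
    [Module ℝ W] {L L' : TensorPow V N →ₗ[ℝ] W}
    (h : ∀ S f, HasParity P S f → L (PiTensorProduct.tprod ℝ f) = L' (PiTensorProduct.tprod ℝ f)) :
    L = L' := by
  refine PiTensorProduct.ext (MultilinearMap.ext fun f => ?_)
  have hf : f = (fun j => (1 / 2 : ℝ) • (f j - P (f j))) + fun j => (1 / 2 : ℝ) • (f j + P (f j)) := by
    funext j
    simp only [Pi.add_apply]
    module
  rw [hf, MultilinearMap.map_add_univ, MultilinearMap.map_add_univ]
  refine Finset.sum_congr rfl fun S _ => h S _ fun j => ?_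
  by_cases hj : j ∈ S
  · simp only [Finset.piecewise, hj, if_true, map_smul, map_sub, hP.apply_apply]
    module
  · simp only [Finset.piecewise, hj, if_false, map_smul, map_add, hP.apply_apply]
    module

/-- The permutation of the factors of a tensor power with the Koszul sign. -/
def koszulMap (P : V →ₗ[ℝ] V) {N : ℕ} (σ : Equiv.Perm (Fin (N + 1))) :
    TensorPow V (N + 1) →ₗ[ℝ] TensorPow V (N + 1) :=
  ∑ S : Finset (Fin (N + 1)), koszulSign σ S • PiTensorProduct.lift
    (((PiTensorProduct.tprod ℝ).domDomCongr σ⁻¹).compLinearMap fun a =>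
      (1 / 2 : ℝ) • (if a ∈ S then LinearMap.id - P else LinearMap.id + P))

theorem endAct_eq (P : V →ₗ[ℝ] V) (N : ℕ) (σ : Equiv.Perm (Fin (N + 1)))
    (L : TensorPow V (N + 1) →ₗ[ℝ] V) :
    endAct P N σ (L.compMultilinearMap (PiTensorProduct.tprod ℝ)) =
      (L ∘ₗ koszulMap P σ).compMultilinearMap (PiTensorProduct.tprod ℝ) := by
  ext f
  simp [endAct, koszulMap]

/-- The maps (1 ± P) / 2 are the projections to the even and odd parts, so of all summands of
`koszulMap` only the one of the true set of odd places survives. -/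
theorem HasParity.koszulMap_tprod {P : V →ₗ[ℝ] V} {N : ℕ} {S : Finset (Fin (N + 1))}
    {f : Fin (N + 1) → V} (hf : HasParity P S f) (σ : Equiv.Perm (Fin (N + 1))) :
    koszulMap P σ (PiTensorProduct.tprod ℝ f) =
      koszulSign σ S • PiTensorProduct.tprod ℝ fun i => f (σ⁻¹ i) := by
  rw [koszulMap, LinearMap.sum_apply, Finset.sum_eq_single S]
  · rw [LinearMap.smul_apply, PiTensorProduct.lift.tprod, MultilinearMap.compLinearMap_apply,
      MultilinearMap.domDomCongr_apply]
    congr 3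
    funext i
    have := hf (σ⁻¹ i)
    split_ifs at this ⊢ <;>
      simp only [LinearMap.smul_apply, LinearMap.sub_apply, LinearMap.add_apply,
        LinearMap.id_apply, this] <;> module
  · intro T _ hT
    obtain ⟨j, hj⟩ : ∃ j, ¬(j ∈ T ↔ j ∈ S) := by
      by_contra! h
      exact hT (Finset.ext h)
    rw [LinearMap.smul_apply, PiTensorProduct.lift.tprod, MultilinearMap.compLinearMap_apply,
      MultilinearMap.domDomCongr_apply]
    -- After the permutation, place σ j holds the factor j, which the projection of the wrong parity
    -- annihilates.
    rw [MultilinearMap.map_coord_zero _ (σ j), smul_zero]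
    have := hf j
    rw [show σ⁻¹ (σ j) = j from σ.symm_apply_apply j]
    split_ifs at this ⊢ <;> simp_all
  · simp

/-- On factors of definite parity both sides are the same pure tensor with a sign.
`koszulSign_flipAt` says that the signs of passing the odd factors before a and before σ a account
for the change of the Koszul sign. No Leibniz rule is needed, so this applies to multiplications as
well as to derivations. -/
theorem IsParity.koszulMap_comp_opAt {P A : V →ₗ[ℝ] V} (hP : IsParity P) {p : ℕ}
    (hA : ∀ v, A (P v) = (-1 : ℝ) ^ p • P (A v)) {N : ℕ} (σ : Equiv.Perm (Fin (N + 1)))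
    (a : Fin (N + 1)) :
    koszulMap P σ ∘ₗ opAt P p A a = opAt P p A (σ a) ∘ₗ koszulMap P σ := by
  refine hP.ext fun S f hf => ?_
  rw [LinearMap.comp_apply, LinearMap.comp_apply, hf.opAt_tprod, map_smul,
    (hf.update hA a).koszulMap_tprod, hf.koszulMap_tprod, map_smul, (hf.perm σ).opAt_tprod,
    smul_smul, smul_smul, koszulSign_flipAt, Finset.prod_map]
  congr 2
  funext i
  by_cases hi : i = σ a
  · subst hi; simp
  · have : σ⁻¹ i ≠ a := fun h => hi (by simp [← h])
    rw [Function.update_of_ne hi]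
    exact Function.update_of_ne this _ _

/-- Moving v to the front across the earlier factors produces their signs, which the Koszul factors
`P ^ p` cancel. -/
theorem mulAll_opAt_mulLeft {P : V →ₗ[ℝ] V} {p : ℕ} {v : V}
    (hv : ∀ u, (P ^ p) u * v = v * u) {N : ℕ} (a : Fin N) (T : TensorPow V N) :
    mulAll V N (opAt P p (LinearMap.mulLeft ℝ v) a T) = v * mulAll V N T := by
  suffices h : mulAll V N ∘ₗ opAt P p (LinearMap.mulLeft ℝ v) a =
      LinearMap.mulLeft ℝ v ∘ₗ mulAll V N from LinearMap.congr_fun h T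
  refine PiTensorProduct.ext (MultilinearMap.ext fun f => ?_)
  simp only [LinearMap.compMultilinearMap_apply, LinearMap.comp_apply, opAt_tprod, mulAll_tprod,
    LinearMap.mulLeft_apply]
  induction N with
  | zero => exact a.elim0
  | succ N ih =>
    refine Fin.cases ?_ (fun a => ?_) a
    · simp [List.ofFn_succ, mul_assoc]
    · have := ih a 0 fun j => f j.succ
      simp only [List.ofFn_succ, List.prod_cons, Fin.succ_lt_succ_iff, Fin.succ_inj, this,
        Fin.succ_pos, if_true]
      rw [← mul_assoc, hv, mul_assoc]

/-- The exponent p is the parity of the a-th factor; left multiplication by that factor is then an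
operator of parity p. -/
theorem IsParity.exists_comm {P : V →ₗ[ℝ] V} (hP : IsParity P) {N : ℕ} {S : Finset (Fin N)}
    {f : Fin N → V} (hf : HasParity P S f) (a : Fin N) :
    ∃ p, (∀ u, (P ^ p) u * f a = f a * u) ∧
      ∀ u, LinearMap.mulLeft ℝ (f a) (P u) = (-1 : ℝ) ^ p • P (LinearMap.mulLeft ℝ (f a) u) := by
  have := hf a
  split_ifs at this
  · exact ⟨1, fun u => by simp [hP.comm_odd _ _ this], fun u => by simp [hP.map_mul, this]⟩
  · exact ⟨0, fun u => by simp [hP.comm_even _ _ this], fun u => by simp [hP.map_mul, this]⟩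

theorem IsParity.opAt_mulLeft_tprod {P : V →ₗ[ℝ] V} (hP : IsParity P) (p : ℕ) {N : ℕ}
    {f : Fin N → V} (a : Fin N) (h : ∀ j, j < a → f j = 1) :
    opAt P p (LinearMap.mulLeft ℝ (f a)) a (PiTensorProduct.tprod ℝ (Function.update f a 1)) =
      PiTensorProduct.tprod ℝ f := by
  rw [opAt_tprod]
  congr 1
  funext j
  split_ifs with h1 h2
  · simp [h1.ne, h j h1, hP.pow_one_apply]
  · subst h2; simp
  · simp [h2]

theorem koszulMap_tprod_one {P : V →ₗ[ℝ] V} (hP : IsParity P) {N : ℕ}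
    (σ : Equiv.Perm (Fin (N + 1))) :
    koszulMap P σ (PiTensorProduct.tprod ℝ fun _ => 1) = PiTensorProduct.tprod ℝ fun _ => 1 := by
  have h : HasParity P ∅ fun _ : Fin (N + 1) => (1 : V) := fun j => by simp [hP.map_one]
  rw [h.koszulMap_tprod]
  simp [koszulSign]

/-- The multiplication is graded commutative. -/
theorem IsParity.mulAll_comp_koszulMap {P : V →ₗ[ℝ] V} (hP : IsParity P) {N : ℕ}
    (σ : Equiv.Perm (Fin (N + 1))) :
    mulAll V (N + 1) ∘ₗ koszulMap P σ = mulAll V (N + 1) := by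
  -- Induction on the number m of last places where the factor may differ from 1. A tensor is built
  -- from 1 ⊗ ⋯ ⊗ 1 by left multiplications, adding the leftmost nontrivial factor last, and these
  -- operators pass through both the permutation and the product.
  have key (m : ℕ) : m ≤ N + 1 → ∀ S (f : Fin (N + 1) → V), HasParity P S f →
      (∀ j : Fin (N + 1), (j : ℕ) < N + 1 - m → f j = 1) →
      mulAll V (N + 1) (koszulMap P σ (PiTensorProduct.tprod ℝ f)) =
        mulAll V (N + 1) (PiTensorProduct.tprod ℝ f) := by
    induction m with
    | zero =>
      intro _ S f _ h1
      have : f = fun _ => 1 := funext fun j => h1 j (by omega)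
      rw [this, koszulMap_tprod_one hP]
    | succ m ih =>
      intro hm S f hf h1
      -- N - m = N + 1 - (m + 1) is the leftmost place whose factor may be nontrivial.
      set a : Fin (N + 1) := ⟨N - m, by omega⟩ with ha
      obtain ⟨p, hp, hp'⟩ := hP.exists_comm hf a
      have hlt (j : Fin (N + 1)) (hj : j < a) : f j = 1 := by
        refine h1 j ?_
        simp only [ha, Fin.lt_def] at hj
        omega
      rw [← hP.opAt_mulLeft_tprod p a hlt, ← LinearMap.comp_apply (koszulMap P σ),
        hP.koszulMap_comp_opAt hp', LinearMap.comp_apply, mulAll_opAt_mulLeft hp,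
        mulAll_opAt_mulLeft hp, ih (by omega) (S.erase a)]
      · intro j
        by_cases hj : j = a
        · simp [hj, hP.map_one]
        · simpa [hj] using hf j
      · intro j hj
        by_cases hja : j = a
        · simp [hja]
        · have : (j : ℕ) ≠ N - m := fun h => hja (Fin.ext h)
          simpa [hja] using h1 j (by omega)
  exact hP.ext fun S f hf => key (N + 1) le_rfl S f hf (by simp)

end Koszul

/-! ## Ordered products -/

section OrderedProducts

/-- Distributivity in a noncommutative ring: a choice of one summand per factor keeps the order of
the factors. It serves for both reconnections and reversals of edges. -/
theorem ofFn_prod_sum {R A : Type} [Semiring R] [DecidableEq A] {k : ℕ} (s : Fin k → Finset A)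
    (g : Fin k → A → R) :
    (List.ofFn fun e => ∑ a ∈ s e, g e a).prod =
      ∑ δ ∈ Fintype.piFinset s, (List.ofFn fun e => g e (δ e)).prod := by
  induction k with
  | zero => simp
  | succ k ih =>
    rw [List.ofFn_succ, List.prod_cons, ih, Finset.sum_mul_sum, ← Finset.sum_product']
    refine Finset.sum_bij' (fun x _ => Fin.cons x.1 x.2) (fun δ _ => (δ 0, Fin.tail δ)) ?_ ?_ ?_ ?_ ?_
    · intro x hx
      simp only [Finset.mem_product, Fintype.mem_piFinset] at hx ⊢
      exact Fin.cases (by simpa using hx.1) (by simpa using hx.2)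
    · intro δ hδ
      simp only [Finset.mem_product, Fintype.mem_piFinset, Fin.tail] at hδ ⊢
      exact ⟨hδ 0, fun e => hδ e.succ⟩
    · intro x _
      simp
    · intro δ _
      simp
    · intro x _
      simp [List.ofFn_succ]

theorem ofFn_prod_swap {R : Type} [Ring R] [Algebra ℝ R] {ε : ℝ} {k : ℕ} (h : Fin (k + 1) → R)
    (hh : ∀ a b, h a * h b = ε • (h b * h a)) (i : Fin k) :
    (List.ofFn (h ∘ Equiv.swap i.castSucc i.succ)).prod = ε • (List.ofFn h).prod := by
  induction k with
  | zero => exact i.elim0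
  | succ k ih =>
    refine Fin.cases ?_ (fun i => ?_) i
    · have h2 (j : Fin k) : Equiv.swap (Fin.castSucc (0 : Fin (k + 1))) (Fin.succ 0) j.succ.succ =
          j.succ.succ :=
        Equiv.swap_apply_of_ne_of_ne (by simp [Fin.ext_iff]) (by simp [Fin.ext_iff])
      have h0 : Equiv.swap (Fin.castSucc (0 : Fin (k + 1))) (Fin.succ 0) 0 = Fin.succ 0 :=
        Equiv.swap_apply_left _ _
      have h1 : Equiv.swap (Fin.castSucc (0 : Fin (k + 1))) (Fin.succ 0) (Fin.succ 0) = 0 :=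
        Equiv.swap_apply_right _ _
      simp only [List.ofFn_succ, List.prod_cons, Function.comp_apply, h0, h1, h2]
      rw [← mul_assoc, hh, smul_mul_assoc, mul_assoc]
    · have h0 : Equiv.swap (Fin.castSucc i.succ) i.succ.succ 0 = 0 :=
        Equiv.swap_apply_of_ne_of_ne (by simp [Fin.ext_iff]) (by simp [Fin.ext_iff])
      have h1 (j : Fin (k + 1)) : Equiv.swap (Fin.castSucc i.succ) i.succ.succ j.succ =
          (Equiv.swap i.castSucc i.succ j).succ := by
        rw [← Fin.succ_castSucc]
        exact (Fin.succ_injective _).swap_apply _ _ _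
      have := ih (fun j => h j.succ) (fun a b => hh _ _) i
      rw [List.ofFn_succ, List.prod_cons, List.ofFn_succ (f := h), List.prod_cons, ← mul_smul_comm,
        ← this]
      simp only [Function.comp_apply, h0, h1]
      rfl

theorem orderSign_mul (d : ℤ) {k : ℕ} (σ τ : Equiv.Perm (Fin k)) :
    orderSign d (σ * τ) = orderSign d σ * orderSign d τ := by
  simp [orderSign, mul_zpow]

theorem orderSign_swap (n : ℕ) {k : ℕ} (i : Fin k) :
    ((orderSign (n + 1) (Equiv.swap i.castSucc i.succ) : ℤ) : ℝ) = (-1) ^ n := by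
  -- With d = n + 1 the exponent d + 1 is n + 2, which has the parity of n.
  have h : ((n : ℤ) + 1 + 1) = ((n + 2 : ℕ) : ℤ) := by push_cast; ring
  rw [orderSign, Equiv.Perm.sign_swap (Fin.castSucc_lt_succ (i := i)).ne, h, zpow_natCast]
  simp [pow_add]

/-- The adjacent transpositions generate the symmetric group as a monoid, and each of them exchanges
two neighbouring factors at the cost of (-1)^n. -/
theorem ofFn_prod_perm {R : Type} [Ring R] [Algebra ℝ R] {n k : ℕ} (h : Fin k → R)
    (hh : ∀ a b, h a * h b = (-1 : ℝ) ^ n • (h b * h a)) (σ : Equiv.Perm (Fin k)) :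
    (List.ofFn (h ∘ σ)).prod = ((orderSign (n + 1) σ : ℤ) : ℝ) • (List.ofFn h).prod := by
  cases k with
  | zero =>
    rw [Subsingleton.elim σ 1]
    simp [orderSign]
  | succ k =>
    have hσ : σ ∈ Submonoid.closure (Set.range fun i : Fin k => Equiv.swap i.castSucc i.succ) := by
      rw [Equiv.Perm.mclosure_swap_castSucc_succ]
      trivial
    induction hσ using Submonoid.closure_induction generalizing h with
    | mem x hx =>
      obtain ⟨i, rfl⟩ := hx
      rw [orderSign_swap]
      exact ofFn_prod_swap h hh i
    | one => simp [orderSign]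
    | mul x y _ _ ihx ihy =>
      have := ihy (h ∘ x) fun a b => hh _ _
      rw [ihx h hh] at this
      rw [orderSign_mul, Equiv.Perm.coe_mul, ← Function.comp_assoc, this, smul_smul, mul_comm]
      push_cast
      rfl

/-- Moves a whole ordered product of edge operators through L. The cases of use are the parity, an
insertion of products, and a permutation of the factors. -/
theorem ofFn_prod_intertwine {V W : Type} [AddCommGroup V] [Module ℝ V] [AddCommGroup W]
    [Module ℝ W] (L : V →ₗ[ℝ] W) {k : ℕ} (g : Fin k → Module.End ℝ V) (h : Fin k → Module.End ℝ W)
    (c : ℝ) (H : ∀ e, h e ∘ₗ L = c • (L ∘ₗ g e)) :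
    (List.ofFn h).prod ∘ₗ L = c ^ k • (L ∘ₗ (List.ofFn g).prod) := by
  induction k with
  | zero => ext; simp
  | succ k ih =>
    have ih' := ih (fun e => g e.succ) (fun e => h e.succ) fun e => H _
    rw [List.ofFn_succ, List.prod_cons, List.ofFn_succ, List.prod_cons, Module.End.mul_eq_comp,
      Module.End.mul_eq_comp, LinearMap.comp_assoc, ih', LinearMap.comp_smul,
      ← LinearMap.comp_assoc, H, LinearMap.smul_comp, smul_smul, pow_succ, LinearMap.comp_assoc]

theorem ofFn_eq_map_range {A : Type} (F : ℕ → A) (n : ℕ) :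
    List.ofFn (fun j : Fin n => F j) = (List.range n).map F := by
  refine List.ext_getElem (by simp) fun i h1 h2 => by simp

/-- Generalised associativity: both products are those of the consecutive blocks before, inside and
after the insertion. -/
theorem prod_ofFn_insertFun {V : Type} [Ring V] [Algebra ℝ V] {M N : ℕ} (i : Fin (M + 1))
    (f : Fin (M + N + 1) → V) :
    (List.ofFn (insertFun i LinearMap.id (fun g : Fin (N + 1) → V => (List.ofFn g).prod) f)).prod =
      (List.ofFn f).prod := by
  -- Indexing by natural numbers allows the range of indices to be split into blocks; the default
  -- value 1 is never read.
  let F : ℕ → V := fun j => if h : j < M + N + 1 then f ⟨j, h⟩ else 1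
  let G : ℕ → V := fun j => if j < i then F j else
    if j = i then ((List.range (N + 1)).map fun l => F (i + l)).prod else F (j + N)
  have hF : f = fun j : Fin (M + N + 1) => F j := by
    funext j
    simp only [F, j.2, dif_pos]
  have hG : insertFun i LinearMap.id (fun g : Fin (N + 1) → V => (List.ofFn g).prod) f =
      fun j : Fin (M + 1) => G j := by
    funext j
    rw [hF]
    simp only [insertFun, G, Fin.lt_def, Fin.ext_iff]
    split_ifs with h1 h2
    · simp [outer, Fin.lt_def, h1]
    · rw [← ofFn_eq_map_range]
      rfl
    · simp [outer, Fin.lt_def, h1]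
  rw [hG, hF, ofFn_eq_map_range, ofFn_eq_map_range]
  obtain ⟨m, hm⟩ : ∃ m, M = i + m := ⟨M - i, by omega⟩
  have e1 : M + 1 = i + 1 + m := by omega
  have e2 : M + N + 1 = i + (N + 1) + m := by omega
  rw [e1, e2, List.range_add, List.range_add (n := (i : ℕ)) (m := 1), List.range_add (m := m),
    List.range_add (n := (i : ℕ)) (m := N + 1)]
  simp only [List.map_append, List.prod_append, List.map_map]
  congr 1
  · congr 1
    · congr 1
      refine List.map_congr_left fun j hj => ?_
      simp [G, List.mem_range.1 hj]
    · simp [G, Function.comp_def]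
  · congr 1
    refine List.map_congr_left fun j hj => ?_
    have h1 : ¬(i + 1 + j : ℕ) < i := by omega
    have h2 : ¬(i + 1 + j : ℕ) = i := by omega
    simp only [G, Function.comp_apply, h1, h2, if_false]
    congr 1
    omega

end OrderedProducts

/-! ## Representations of graphs by operators on tensor powers -/

section Representation

variable {V : Type} [Ring V] [Algebra ℝ V]

theorem insertOp_eq {M N : ℕ} (i : Fin (M + 1)) (Q : V →ₗ[ℝ] V)
    (L : TensorPow V (M + 1) →ₗ[ℝ] V) (Φ : TensorPow V (N + 1) →ₗ[ℝ] V) :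
    insertOp i Q (L.compMultilinearMap (PiTensorProduct.tprod ℝ))
        (Φ.compMultilinearMap (PiTensorProduct.tprod ℝ)) =
      (L ∘ₗ insertT i Q Φ).compMultilinearMap (PiTensorProduct.tprod ℝ) := by
  ext f
  rw [insertOp_apply, LinearMap.compMultilinearMap_apply, LinearMap.compMultilinearMap_apply,
    LinearMap.comp_apply, insertT_tprod]
  rfl

/-- The parity of a tensor power. -/
def parityT (P : V →ₗ[ℝ] V) (N : ℕ) : TensorPow V N →ₗ[ℝ] TensorPow V N :=
  PiTensorProduct.map fun _ => P

theorem opAt_comp_parityT {P A : V →ₗ[ℝ] V} {p : ℕ}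
    (hA : ∀ v, A (P v) = (-1 : ℝ) ^ p • P (A v)) {N : ℕ} (a : Fin N) :
    opAt P p A a ∘ₗ parityT P N = (-1 : ℝ) ^ p • (parityT P N ∘ₗ opAt P p A a) := by
  refine PiTensorProduct.ext (MultilinearMap.ext fun f => ?_)
  simp only [LinearMap.compMultilinearMap_apply, LinearMap.comp_apply, LinearMap.smul_apply,
    opAt_tprod, parityT, PiTensorProduct.map_tprod]
  refine tprod_eq_smul a (by simp [hA]) fun j hj => ?_
  simp only [hj, if_false]
  split_ifs
  · rw [← Module.End.mul_apply, ← Module.End.mul_apply, ← pow_succ, ← pow_succ']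
  · rfl

namespace IsParity

variable {P : V →ₗ[ℝ] V} (hP : IsParity P)

include hP

theorem mulAll_comp_parityT (N : ℕ) : P ∘ₗ mulAll V N = mulAll V N ∘ₗ parityT P N := by
  refine PiTensorProduct.ext (MultilinearMap.ext fun f => ?_)
  simpa [mulAll_tprod, parityT] using hP.pow_prod 1 f

theorem parityT_parityT {N : ℕ} : parityT P N ∘ₗ parityT P N = LinearMap.id := by
  refine PiTensorProduct.ext (MultilinearMap.ext fun f => ?_)
  simp [parityT, hP.apply_apply]

theorem pow_mod_two (m : ℕ) : P ^ (m % 2) = P ^ m := by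
  have h2 : P ^ 2 = 1 := by
    ext v
    simp [pow_two, hP.apply_apply]
  conv_rhs => rw [← Nat.mod_add_div m 2, pow_add, pow_mul, h2, one_pow, mul_one]

end IsParity

theorem mulAll_comp_insertT {M N : ℕ} (i : Fin (M + 1)) (P : V →ₗ[ℝ] V) :
    mulAll V (M + 1) ∘ₗ insertT i (P ^ 0) (mulAll V (N + 1)) = mulAll V (M + N + 1) := by
  refine PiTensorProduct.ext (MultilinearMap.ext fun f => ?_)
  simp only [LinearMap.compMultilinearMap_apply, LinearMap.comp_apply, insertT_tprod, mulAll_tprod]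
  exact prod_ofFn_insertFun i f

/-- A family of operators of parity `n` indexed by edges, compatible with the insertion of products
and with the permutations of the factors. -/
structure IsEdgeOperator (P : V →ₗ[ℝ] V) (n : ℕ)
    (Δ : ∀ N, Fin N → Fin N → Module.End ℝ (TensorPow V N)) : Prop where
  comm : ∀ N i j k l, Δ N i j * Δ N k l = (-1 : ℝ) ^ n • (Δ N k l * Δ N i j)
  parity : ∀ N i j, Δ N i j ∘ₗ parityT P N = (-1 : ℝ) ^ n • (parityT P N ∘ₗ Δ N i j)
  insert_inner : ∀ M N (i : Fin (M + 1)) (m : ℕ) (Φ : TensorPow V (N + 1) →ₗ[ℝ] V) l l',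
    insertT i (P ^ m) Φ ∘ₗ Δ (M + N + 1) (inner i l) (inner i l') =
      insertT i (P ^ (m + n)) (Φ ∘ₗ Δ (N + 1) l l')
  comp_insert : ∀ M N (i : Fin (M + 1)) j k,
    Δ (M + 1) j k ∘ₗ insertT i (P ^ 0) (mulAll V (N + 1)) =
      insertT i (P ^ 0) (mulAll V (N + 1)) ∘ₗ
        ∑ t ∈ (Finset.univ.filter fun t => collapse (N := N) i t = j) ×ˢ
          (Finset.univ.filter fun t => collapse (N := N) i t = k), Δ (M + N + 1) t.1 t.2
  koszul : ∀ N (σ : Equiv.Perm (Fin (N + 1))) i j,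
    koszulMap P σ ∘ₗ Δ (N + 1) i j = Δ (N + 1) (σ i) (σ j) ∘ₗ koszulMap P σ

/-- The ordered product of the operators of the edges. -/
def edgeProd {N k : ℕ} (Δ : Fin N → Fin N → Module.End ℝ (TensorPow V N))
    (γ : Fin k → Fin N × Fin N) : Module.End ℝ (TensorPow V N) :=
  (List.ofFn fun e => Δ (γ e).1 (γ e).2).prod

/-- The multilinear operation of a graph. -/
def graphOp {N k : ℕ} (Δ : Fin (N + 1) → Fin (N + 1) → Module.End ℝ (TensorPow V (N + 1)))
    (γ : Fin k → Fin (N + 1) × Fin (N + 1)) : MultilinearMap ℝ (fun _ : Fin (N + 1) => V) V :=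
  (mulAll V (N + 1) ∘ₗ edgeProd Δ γ).compMultilinearMap (PiTensorProduct.tprod ℝ)

namespace IsEdgeOperator

variable {P : V →ₗ[ℝ] V} {n : ℕ} {Δ : ∀ N, Fin N → Fin N → Module.End ℝ (TensorPow V N)}
  (hΔ : IsEdgeOperator P n Δ)

include hΔ

theorem graphOp_perm {N k : ℕ} (γ : Fin k → Fin (N + 1) × Fin (N + 1)) (σ : Equiv.Perm (Fin k)) :
    graphOp (Δ (N + 1)) (γ ∘ σ) = ((orderSign (n + 1) σ : ℤ) : ℝ) • graphOp (Δ (N + 1)) γ := by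
  have : edgeProd (Δ (N + 1)) (γ ∘ σ) =
      ((orderSign (n + 1) σ : ℤ) : ℝ) • edgeProd (Δ (N + 1)) γ :=
    ofFn_prod_perm (fun e => Δ (N + 1) (γ e).1 (γ e).2) (fun a b => hΔ.comm _ _ _ _ _) σ
  ext f
  simp [graphOp, this]

/-- Conjugation by the parity multiplies the operation of k edges by (-1)^(n k). The scalar is thus
1 if p and n k have the same parity and 0 otherwise. -/
theorem parityPart_graphOp (hP : IsParity P) {N k : ℕ} (γ : Fin k → Fin (N + 1) × Fin (N + 1))
    (p : ℕ) :
    parityPart P N p (graphOp (Δ (N + 1)) γ) =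
      ((1 / 2 : ℝ) * (1 + (-1) ^ p * (-1) ^ (n * k))) • graphOp (Δ (N + 1)) γ := by
  have h := ofFn_prod_intertwine (parityT P (N + 1)) (fun e => Δ (N + 1) (γ e).1 (γ e).2)
    (fun e => Δ (N + 1) (γ e).1 (γ e).2) ((-1 : ℝ) ^ n) fun e => hΔ.parity _ _ _
  have h' : P.compMultilinearMap ((graphOp (Δ (N + 1)) γ).compLinearMap fun _ => P) =
      (-1 : ℝ) ^ (n * k) • graphOp (Δ (N + 1)) γ := by
    ext f
    have e1 : PiTensorProduct.tprod ℝ (fun j => P (f j)) =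
        parityT P (N + 1) (PiTensorProduct.tprod ℝ f) := by
      simp [parityT]
    have e2 (T : TensorPow V (N + 1)) : P (mulAll V (N + 1) T) =
        mulAll V (N + 1) (parityT P (N + 1) T) :=
      LinearMap.congr_fun (hP.mulAll_comp_parityT (N + 1)) T
    have e3 (T : TensorPow V (N + 1)) : parityT P (N + 1) (parityT P (N + 1) T) = T :=
      LinearMap.congr_fun hP.parityT_parityT T
    have e4 (T : TensorPow V (N + 1)) : edgeProd (Δ (N + 1)) γ (parityT P (N + 1) T) =
        (-1 : ℝ) ^ (n * k) • parityT P (N + 1) (edgeProd (Δ (N + 1)) γ T) := by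
      rw [pow_mul]
      exact LinearMap.congr_fun h T
    simp only [graphOp, LinearMap.compMultilinearMap_apply, MultilinearMap.compLinearMap_apply,
      LinearMap.comp_apply, smul_apply, e1, e4, map_smul, e2, e3]
  rw [parityPart, LinearMap.coe_mk, AddHom.coe_mk, h']
  module

/-- Each edge operator of the inserted graph adds n to the exponent of `P` on the factors before the
insertion. Starting from exponent 0, this reproduces the Koszul sign of composing with an operation
of parity n k. -/
theorem insertT_edgeProd {M N k : ℕ} (i : Fin (M + 1)) (γ : Fin k → Fin (N + 1) × Fin (N + 1))
    (m : ℕ) (Φ : TensorPow V (N + 1) →ₗ[ℝ] V) :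
    insertT i (P ^ m) Φ ∘ₗ
        edgeProd (Δ (M + N + 1)) (fun e => Prod.map (inner i) (inner i) (γ e)) =
      insertT i (P ^ (m + n * k)) (Φ ∘ₗ edgeProd (Δ (N + 1)) γ) := by
  induction k generalizing m Φ with
  | zero => simp [edgeProd, Module.End.one_eq_id]
  | succ k ih =>
    simp only [edgeProd, List.ofFn_succ, List.prod_cons, Module.End.mul_eq_comp,
      ← LinearMap.comp_assoc] at ih ⊢
    rw [Prod.map_fst, Prod.map_snd, hΔ.insert_inner, ih (fun e => γ e.succ),
      show m + n + n * k = m + n * (k + 1) by ring]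

/-- Every edge operator, passing the inserted multiplication, becomes the sum over the reconnections
of its two ends; expanding the ordered product gives the sum over simultaneous reconnections δ. -/
theorem edgeProd_comp_insertT {M N k : ℕ} (i : Fin (M + 1))
    (γ : Fin k → Fin (M + 1) × Fin (M + 1)) :
    edgeProd (Δ (M + 1)) γ ∘ₗ insertT i (P ^ 0) (mulAll V (N + 1)) =
      insertT i (P ^ 0) (mulAll V (N + 1)) ∘ₗ
        ∑ δ : Fin k → Fin (M + N + 1) × Fin (M + N + 1) with
          ∀ e, Prod.map (collapse (N := N) i) (collapse (N := N) i) (δ e) = γ e,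
          edgeProd (Δ (M + N + 1)) δ := by
  have h := ofFn_prod_intertwine (insertT i (P ^ 0) (mulAll V (N + 1)))
    (fun e => ∑ t ∈ (Finset.univ.filter fun t => collapse (N := N) i t = (γ e).1) ×ˢ
          (Finset.univ.filter fun t => collapse (N := N) i t = (γ e).2), Δ (M + N + 1) t.1 t.2)
    (fun e => Δ (M + 1) (γ e).1 (γ e).2) 1 fun e => by
      rw [one_smul]; exact hΔ.comp_insert _ _ _ _ _
  rw [one_pow, one_smul, ofFn_prod_sum] at h
  rw [edgeProd, h]
  congr 1
  refine Finset.sum_congr ?_ fun _ _ => rfl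
  ext δ
  simp [Fintype.mem_piFinset, Prod.ext_iff]

/-- The operators of the inserted graph are pulled out to the right, those of the outer graph are
then moved through the inserted multiplication, and the two multiplications merge. The resulting
order of operators, outer edges first, is the edge order of the composite graph. -/
theorem endComp_graphOp (hP : IsParity P) {M N : ℕ} (i : Fin (M + 1)) (Γ : Multidigraph M)
    (Γ' : Multidigraph N) :
    endComp P M N i (graphOp (Δ (M + 1)) Γ.2) (graphOp (Δ (N + 1)) Γ'.2) =
      ∑ δ : Fin Γ.1 → Fin (M + N + 1) × Fin (M + N + 1) with
          ∀ e, Prod.map (collapse (N := N) i) (collapse (N := N) i) (δ e) = Γ.2 e,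
        graphOp (Δ (M + N + 1))
          (Fin.append δ fun e => Prod.map (inner i) (inner i) (Γ'.2 e)) := by
  -- Of the two parity components in `endComp`, only the one of the parity of n k is nonzero, k
  -- being the number of inserted edges.
  have h1 : endComp P M N i (graphOp (Δ (M + 1)) Γ.2) (graphOp (Δ (N + 1)) Γ'.2) =
      insertOp i (P ^ (n * Γ'.1)) (graphOp (Δ (M + 1)) Γ.2) (graphOp (Δ (N + 1)) Γ'.2) := by
    rw [endComp, LinearMap.sum_apply, LinearMap.sum_apply, Finset.sum_range_succ,
      Finset.sum_range_one]
    simp only [LinearMap.compl₂_apply, hΔ.parityPart_graphOp hP, map_smul, LinearMap.mk₂_apply]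
    rcases Nat.even_or_odd (n * Γ'.1) with h | h
    · rw [← hP.pow_mod_two (n * Γ'.1), Nat.even_iff.1 h, h.neg_one_pow]
      norm_num
    · rw [← hP.pow_mod_two (n * Γ'.1), Nat.odd_iff.1 h, h.neg_one_pow]
      norm_num
  have h2 : insertT i (P ^ (n * Γ'.1)) (mulAll V (N + 1) ∘ₗ edgeProd (Δ (N + 1)) Γ'.2) =
      insertT i (P ^ 0) (mulAll V (N + 1)) ∘ₗ
        edgeProd (Δ (M + N + 1)) (fun e => Prod.map (inner i) (inner i) (Γ'.2 e)) := by
    rw [hΔ.insertT_edgeProd, zero_add]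
  rw [h1, graphOp, graphOp, insertOp_eq, h2, ← LinearMap.comp_assoc,
    LinearMap.comp_assoc (insertT i (P ^ 0) (mulAll V (N + 1))), hΔ.edgeProd_comp_insertT, ← LinearMap.comp_assoc,
    mulAll_comp_insertT]
  ext f
  rw [sum_apply]
  simp only [graphOp, LinearMap.compMultilinearMap_apply, LinearMap.comp_apply,
    LinearMap.sum_apply, map_sum]
  refine Finset.sum_congr rfl fun δ _ => ?_
  congr 1
  rw [← LinearMap.comp_apply, ← Module.End.mul_eq_comp]
  congr 1
  simp only [edgeProd]
  rw [← List.prod_append, ← List.ofFn_fin_append]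
  congr 2
  funext e
  refine Fin.addCases (fun e => ?_) (fun e => ?_) e <;> simp

theorem endAct_graphOp (hP : IsParity P) {N : ℕ} (σ : Equiv.Perm (Fin (N + 1)))
    (Γ : Multidigraph N) :
    endAct P N σ (graphOp (Δ (N + 1)) Γ.2) = graphOp (Δ (N + 1)) (relabel σ Γ).2 := by
  have h := ofFn_prod_intertwine (koszulMap P σ)
    (fun e => Δ (N + 1) (σ⁻¹ (Γ.2 e).1) (σ⁻¹ (Γ.2 e).2))
    (fun e => Δ (N + 1) (Γ.2 e).1 (Γ.2 e).2) 1 fun e => by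
      rw [one_smul, hΔ.koszul]
      simp
  rw [one_pow, one_smul] at h
  rw [graphOp, graphOp, endAct_eq, LinearMap.comp_assoc, edgeProd, h, ← LinearMap.comp_assoc,
    hP.mulAll_comp_koszulMap]
  rfl

/-- The linear extension of `graphOp` to classes of directed graphs. -/
def rep (N : ℕ) : GraphSpace False (n + 1) N →ₗ[ℝ] MultilinearMap ℝ (fun _ : Fin (N + 1) => V) V :=
  (graphRel False (n + 1) N).liftQ
    (Finsupp.linearCombination ℝ fun Γ : Multidigraph N => graphOp (Δ (N + 1)) Γ.2) (by
      refine Submodule.span_le.2 ?_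
      rintro _ ⟨k, γ, σ, s, hs, rfl⟩
      -- For directed graphs the relations contain no reversals.
      have hs' : s = fun _ => false := funext (hs.resolve_left id)
      subst hs'
      rw [SetLike.mem_coe, LinearMap.mem_ker, map_sub, map_smul, Finsupp.linearCombination_single,
        Finsupp.linearCombination_single, one_smul, one_smul]
      have : flipEdges (fun _ => false) (γ ∘ σ) = γ ∘ σ := by
        funext e
        simp [flipEdges]
      rw [this, hΔ.graphOp_perm]
      simp [flipSign])

theorem rep_graphClass {N : ℕ} (Γ : Multidigraph N) :
    hΔ.rep N (graphClass False (n + 1) Γ) = graphOp (Δ (N + 1)) Γ.2 := by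
  change Finsupp.linearCombination ℝ _ (Finsupp.single Γ (1 : ℝ)) = _
  rw [Finsupp.linearCombination_single, one_smul]

end IsEdgeOperator

end Representation

/-! ### Morphisms out of graph operads, checked on classes of graphs. -/

/-- Linear maps agreeing on the classes of graphs agree. -/
theorem graphSpace_hom_ext {undirected : Prop} {d : ℤ} {N : ℕ} {W : Type} [AddCommGroup W]
    [Module ℝ W] {L L' : GraphSpace undirected d N →ₗ[ℝ] W}
    (h : ∀ Γ, L (graphClass undirected d Γ) = L' (graphClass undirected d Γ)) : L = L' :=
  Submodule.linearMap_qext _ (Finsupp.lhom_ext' fun Γ => LinearMap.ext_ring (h Γ))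

theorem graphComp_graphClass (undirected : Prop) (d : ℤ) {M N : ℕ} (i : Fin (M + 1))
    (Γ : Multidigraph M) (Γ' : Multidigraph N) :
    graphComp undirected d M N i (graphClass undirected d Γ) (graphClass undirected d Γ') =
      ∑ δ : Fin Γ.1 → Fin (M + N + 1) × Fin (M + N + 1) with
          ∀ e, Prod.map (collapse (N := N) i) (collapse (N := N) i) (δ e) = Γ.2 e,
        graphClass undirected d
          ⟨Γ.1 + Γ'.1, Fin.append δ fun e => Prod.map (inner i) (inner i) (Γ'.2 e)⟩ := by
  have := preComp_single undirected d i Γ Γ'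
  rw [insertGraph, map_sum] at this
  exact this

theorem graphAct_graphClass (undirected : Prop) (d : ℤ) {N : ℕ} (σ : Equiv.Perm (Fin (N + 1)))
    (Γ : Multidigraph N) :
    graphAct undirected d N σ (graphClass undirected d Γ) =
      graphClass undirected d (relabel σ Γ) := by
  change (graphRel undirected d N).mkQ (Finsupp.mapDomain (relabel σ) (Finsupp.single Γ 1)) = _
  rw [Finsupp.mapDomain_single]
  rfl

/-- A morphism from an operad of graphs, given by linear maps compatible with the structure on the
classes of graphs. -/
def OperadHom.ofGraphs {undirected : Prop} {d : ℤ} {Q : OperadData}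
    (L : ∀ N, GraphSpace undirected d N →ₗ[ℝ] Q.obj N)
    (homog : ∀ N (Γ : Multidigraph N),
      L N (graphClass undirected d Γ) ∈ Q.homog N ((Γ.1 : ℤ) * (1 - d)))
    (one : L 0 (graphClass undirected d ⟨0, Fin.elim0⟩) = Q.one)
    (comp : ∀ M N (i : Fin (M + 1)) (Γ : Multidigraph M) (Γ' : Multidigraph N),
      ∑ δ : Fin Γ.1 → Fin (M + N + 1) × Fin (M + N + 1) with
          ∀ e, Prod.map (collapse (N := N) i) (collapse (N := N) i) (δ e) = Γ.2 e,
        L (M + N) (graphClass undirected d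
          ⟨Γ.1 + Γ'.1, Fin.append δ fun e => Prod.map (inner i) (inner i) (Γ'.2 e)⟩) =
      Q.comp M N i (L M (graphClass undirected d Γ)) (L N (graphClass undirected d Γ')))
    (act : ∀ N (σ : Equiv.Perm (Fin (N + 1))) (Γ : Multidigraph N),
      L N (graphClass undirected d (relabel σ Γ)) = Q.act N σ (L N (graphClass undirected d Γ))) :
    OperadHom (GraphOperad undirected d) Q where
  toFun := L
  map_homog N a x hx := by
    have h : Submodule.span ℝ {x | ∃ Γ : Multidigraph N, (Γ.1 : ℤ) * (1 - d) = a ∧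
        x = graphClass undirected d Γ} ≤ (Q.homog N a).comap (L N) := by
      refine Submodule.span_le.2 ?_
      rintro _ ⟨Γ, rfl, rfl⟩
      exact homog N Γ
    exact h hx
  map_one := one
  map_comp M N i x y := by
    have h : (graphComp undirected d M N i).compr₂ (L (M + N)) =
        (Q.comp M N i).compl₁₂ (L M) (L N) := by
      refine graphSpace_hom_ext fun Γ => graphSpace_hom_ext fun Γ' => ?_
      rw [LinearMap.compr₂_apply, LinearMap.compl₁₂_apply, graphComp_graphClass, map_sum]
      exact comp M N i Γ Γ'
    exact LinearMap.congr_fun (LinearMap.congr_fun h x) y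
  map_act N σ x := by
    have h : L N ∘ₗ graphAct undirected d N σ = Q.act N σ ∘ₗ L N := by
      refine graphSpace_hom_ext fun Γ => ?_
      rw [LinearMap.comp_apply, LinearMap.comp_apply, graphAct_graphClass]
      exact act N σ Γ
    exact LinearMap.congr_fun h x

/-! ## The orientation morphism -/

section Orientation

variable (d : ℤ)

/-- The signed sum of the graphs obtained by reversing edges. -/
def orSum {N : ℕ} (Γ : Multidigraph N) : GraphSpace False d N :=
  ∑ s : Fin Γ.1 → Bool, (((flipSign d s : ℤˣ) : ℤ) : ℝ) •
    graphClass False d ⟨Γ.1, flipEdges s Γ.2⟩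

theorem flipEdges_comp {A : Type} {k : ℕ} (s : Fin k → Bool) (γ : Fin k → A × A)
    (σ : Equiv.Perm (Fin k)) : flipEdges (s ∘ σ) (γ ∘ σ) = flipEdges s γ ∘ σ := rfl

theorem flipEdges_xor {A : Type} {k : ℕ} (s t : Fin k → Bool) (γ : Fin k → A × A) :
    flipEdges (fun e => xor (t e) (s e)) (flipEdges s γ) = flipEdges t γ := by
  funext e
  simp only [flipEdges]
  by_cases hs : s e = true <;> by_cases ht : t e = true <;> simp [hs, ht]

theorem flipSign_xor {k : ℕ} (s t : Fin k → Bool) :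
    flipSign d (fun e => xor (t e) (s e)) = flipSign d t * flipSign d s := by
  rw [flipSign, flipSign, flipSign, ← Finset.prod_mul_distrib]
  refine Finset.prod_congr rfl fun e _ => ?_
  cases s e <;> cases t e <;> simp [← mul_zpow]

theorem flipSign_comp {k : ℕ} (s : Fin k → Bool) (σ : Equiv.Perm (Fin k)) :
    flipSign d (s ∘ σ) = flipSign d s :=
  Equiv.prod_comp σ fun e => if s e then ((-1 : ℤˣ)) ^ d else 1

theorem flipSign_mul_self {k : ℕ} (s : Fin k → Bool) :
    (((flipSign d s : ℤˣ) : ℤ) : ℝ) * (((flipSign d s : ℤˣ) : ℤ) : ℝ) = 1 := by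
  rw [← Int.cast_mul, ← Units.val_mul, Int.units_mul_self]
  simp

theorem graphClass_perm {undirected : Prop} {N k : ℕ} (γ : Fin k → Fin (N + 1) × Fin (N + 1))
    (σ : Equiv.Perm (Fin k)) :
    graphClass undirected d (⟨k, γ ∘ σ⟩ : Multidigraph N) =
      (((orderSign d σ : ℤˣ) : ℤ) : ℝ) • graphClass undirected d ⟨k, γ⟩ := by
  have h := graphClass_flip undirected d γ σ (fun _ => false) (Or.inr fun _ => rfl)
  have h1 : flipEdges (fun _ => false) (γ ∘ σ) = γ ∘ σ := by
    funext e
    simp [flipEdges]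
  rw [h1] at h
  simpa [flipSign] using h

/-- Reversing the set s and then the set u' gives the reversal of their symmetric difference, so the
sum is reindexed by `xor` and picks up only the sign of s. Permuting the edges merely reindexes the
reversals. -/
theorem orSum_flip {N k : ℕ} (γ : Fin k → Fin (N + 1) × Fin (N + 1)) (σ : Equiv.Perm (Fin k))
    (s : Fin k → Bool) :
    orSum d (⟨k, flipEdges s (γ ∘ σ)⟩ : Multidigraph N) =
      (((orderSign d σ * flipSign d s : ℤˣ) : ℤ) : ℝ) • orSum d ⟨k, γ⟩ := by
  have hb : Function.Bijective fun (u : Fin k → Bool) e => xor (u (σ e)) (s e) := by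
    rw [← Finite.injective_iff_bijective]
    intro u v h
    funext e
    simpa using congrFun h (σ⁻¹ e)
  rw [orSum, ← hb.sum_comp, orSum, Finset.smul_sum]
  refine Finset.sum_congr rfl fun u _ => ?_
  have h1 := flipEdges_xor s (u ∘ σ) (γ ∘ σ)
  have h2 := flipSign_xor d s (u ∘ σ)
  simp only [Function.comp_apply] at h1 h2
  simp only [h1, h2, flipEdges_comp, flipSign_comp, graphClass_perm, smul_smul]
  congr 1
  push_cast
  ring

/-- The orientation map. -/
def orMap (N : ℕ) : GraphSpace True d N →ₗ[ℝ] GraphSpace False d N :=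
  (graphRel True d N).liftQ (Finsupp.linearCombination ℝ (orSum d)) (by
    refine Submodule.span_le.2 ?_
    rintro _ ⟨k, γ, σ, s, -, rfl⟩
    rw [SetLike.mem_coe, LinearMap.mem_ker, map_sub, map_smul, Finsupp.linearCombination_single,
      Finsupp.linearCombination_single, one_smul, one_smul, orSum_flip, sub_self])

theorem orMap_graphClass {N : ℕ} (Γ : Multidigraph N) :
    orMap d N (graphClass True d Γ) = orSum d Γ := by
  change Finsupp.linearCombination ℝ _ (Finsupp.single Γ (1 : ℝ)) = _
  rw [Finsupp.linearCombination_single, one_smul]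

/-- Forgetting the directions of the edges, with the factor `1 / 2` for every edge. -/
def halfForget (N : ℕ) : GraphSpace False d N →ₗ[ℝ] GraphSpace True d N :=
  (graphRel False d N).liftQ
    (Finsupp.linearCombination ℝ fun Γ => (1 / 2 : ℝ) ^ Γ.1 • graphClass True d Γ) (by
    refine Submodule.span_le.2 ?_
    rintro _ ⟨k, γ, σ, s, -, rfl⟩
    rw [SetLike.mem_coe, LinearMap.mem_ker, map_sub, map_smul, Finsupp.linearCombination_single,
      Finsupp.linearCombination_single, one_smul, one_smul,
      graphClass_flip True d γ σ s (Or.inl trivial), smul_comm, sub_self])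

theorem halfForget_graphClass {N : ℕ} (Γ : Multidigraph N) :
    halfForget d N (graphClass False d Γ) = (1 / 2 : ℝ) ^ Γ.1 • graphClass True d Γ := by
  change Finsupp.linearCombination ℝ _ (Finsupp.single Γ (1 : ℝ)) = _
  rw [Finsupp.linearCombination_single, one_smul]

/-- Under `halfForget`, each of the 2^k summands contributes the original class with weight 2^(-k):
the sign in the sum and the sign of undoing the reversal are equal and cancel. -/
theorem orMap_injective (N : ℕ) : Function.Injective (orMap d N) := by
  have h : halfForget d N ∘ₗ orMap d N = LinearMap.id := by
    refine graphSpace_hom_ext fun Γ => ?_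
    obtain ⟨k, γ⟩ := Γ
    rw [LinearMap.comp_apply, orMap_graphClass, orSum, map_sum]
    have h1 (s : Fin k → Bool) : halfForget d N ((((flipSign d s : ℤˣ) : ℤ) : ℝ) •
        graphClass False d ⟨k, flipEdges s γ⟩) = (1 / 2 : ℝ) ^ k • graphClass True d ⟨k, γ⟩ := by
      have h := graphClass_flip True d γ 1 s (Or.inl trivial)
      rw [show γ ∘ ⇑(1 : Equiv.Perm (Fin k)) = γ from rfl] at h
      rw [map_smul, halfForget_graphClass, h, smul_smul, smul_smul]
      congr 1
      have := flipSign_mul_self d s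
      simp only [orderSign, Equiv.Perm.sign_one, one_zpow, one_mul]
      linear_combination (1 / 2 : ℝ) ^ k * this
    simp only [h1]
    rw [Finset.sum_const, Finset.card_univ, Fintype.card_pi, ← Nat.cast_smul_eq_nsmul ℝ, smul_smul]
    simp
  intro x y hxy
  have := congrArg (halfForget d N) hxy
  rwa [← LinearMap.comp_apply, ← LinearMap.comp_apply, h] at this

theorem flipEdges_append {A : Type} {j k : ℕ} (s : Fin j → Bool) (t : Fin k → Bool)
    (γ : Fin j → A × A) (γ' : Fin k → A × A) :
    flipEdges (Fin.append s t) (Fin.append γ γ') =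
      Fin.append (flipEdges s γ) (flipEdges t γ') := by
  funext e
  refine Fin.addCases (fun e => ?_) (fun e => ?_) e <;> simp [flipEdges]

theorem flipSign_append {j k : ℕ} (s : Fin j → Bool) (t : Fin k → Bool) :
    flipSign d (Fin.append s t) = flipSign d s * flipSign d t := by
  simp [flipSign, Fin.prod_univ_add]

theorem orSum_append {N j k : ℕ} (γ : Fin j → Fin (N + 1) × Fin (N + 1))
    (γ' : Fin k → Fin (N + 1) × Fin (N + 1)) :
    orSum d (⟨j + k, Fin.append γ γ'⟩ : Multidigraph N) =
      ∑ s : Fin j → Bool, ∑ t : Fin k → Bool,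
        ((((flipSign d s : ℤˣ) : ℤ) : ℝ) * (((flipSign d t : ℤˣ) : ℤ) : ℝ)) •
          graphClass False d ⟨j + k, Fin.append (flipEdges s γ) (flipEdges t γ')⟩ := by
  rw [orSum, ← (Fin.appendEquiv j k).sum_comp, Fintype.sum_prod_type]
  refine Finset.sum_congr rfl fun s _ => Finset.sum_congr rfl fun t _ => ?_
  have h : Fin.appendEquiv (α := Bool) j k (s, t) = Fin.append s t := rfl
  rw [h, flipEdges_append, flipSign_append]
  push_cast
  rfl

theorem flipEdges_map {A B : Type} {k : ℕ} (s : Fin k → Bool) (γ : Fin k → A × A) (g : A → B)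
    (e : Fin k) :
    Prod.map g g (flipEdges s γ e) = flipEdges s (fun e => Prod.map g g (γ e)) e :=
  congrFun (flipEdges_comp_map s γ g) e

/-- Reversal only exchanges the two ends of an edge, so it gives a bijection between the
reconnections of a graph and those of its reversal. -/
theorem sum_flip_collapse {W : Type} [AddCommMonoid W] {M N k : ℕ} (i : Fin (M + 1))
    (γ : Fin k → Fin (M + 1) × Fin (M + 1)) (s : Fin k → Bool)
    (F : (Fin k → Fin (M + N + 1) × Fin (M + N + 1)) → W) :
    ∑ δ : Fin k → Fin (M + N + 1) × Fin (M + N + 1) with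
        ∀ e, Prod.map (collapse (N := N) i) (collapse (N := N) i) (δ e) = flipEdges s γ e, F δ =
      ∑ δ : Fin k → Fin (M + N + 1) × Fin (M + N + 1) with
        ∀ e, Prod.map (collapse (N := N) i) (collapse (N := N) i) (δ e) = γ e,
        F (flipEdges s δ) := by
  symm
  refine Finset.sum_nbij' (flipEdges s) (flipEdges s) ?_ ?_
    (fun δ _ => flipEdges_flipEdges s δ) (fun δ _ => flipEdges_flipEdges s δ) fun _ _ => rfl
  · intro δ hδ
    simp only [Finset.mem_filter, Finset.mem_univ, true_and] at hδ ⊢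
    intro e
    rw [flipEdges_map, funext hδ]
  · intro δ hδ
    simp only [Finset.mem_filter, Finset.mem_univ, true_and] at hδ ⊢
    intro e
    rw [flipEdges_map, funext hδ, flipEdges_flipEdges]

theorem orMap_homog {N : ℕ} (Γ : Multidigraph N) :
    orMap d N (graphClass True d Γ) ∈ Submodule.span ℝ {x | ∃ Γ' : Multidigraph N,
      (Γ'.1 : ℤ) * (1 - d) = Γ.1 * (1 - d) ∧ x = graphClass False d Γ'} := by
  rw [orMap_graphClass]
  exact Submodule.sum_mem _ fun s _ =>
    Submodule.smul_mem _ _ (Submodule.subset_span ⟨⟨Γ.1, flipEdges s Γ.2⟩, rfl, rfl⟩)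

theorem orMap_one : orMap d 0 (graphClass True d ⟨0, Fin.elim0⟩) =
    graphClass False d ⟨0, Fin.elim0⟩ := by
  rw [orMap_graphClass, orSum, Fintype.sum_unique]
  have h (s : Fin 0 → Bool) : flipEdges s (Fin.elim0 : Fin 0 → Fin (0 + 1) × Fin (0 + 1)) =
      Fin.elim0 := funext fun e => e.elim0
  rw [h]
  simp [flipSign]

/-- Reversals of the composite graph are pairs of reversals of the two graphs, with multiplicative
signs. For each fixed pair the reconnection sums agree. -/
theorem orMap_comp {M N : ℕ} (i : Fin (M + 1)) (Γ : Multidigraph M) (Γ' : Multidigraph N) :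
    ∑ δ : Fin Γ.1 → Fin (M + N + 1) × Fin (M + N + 1) with
        ∀ e, Prod.map (collapse (N := N) i) (collapse (N := N) i) (δ e) = Γ.2 e,
      orMap d (M + N) (graphClass True d
        ⟨Γ.1 + Γ'.1, Fin.append δ fun e => Prod.map (inner i) (inner i) (Γ'.2 e)⟩) =
      graphComp False d M N i (orMap d M (graphClass True d Γ))
        (orMap d N (graphClass True d Γ')) := by
  simp only [orMap_graphClass, orSum_append]
  rw [orSum, map_sum, LinearMap.sum_apply, Finset.sum_comm]
  refine Finset.sum_congr rfl fun s _ => ?_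
  rw [Finset.sum_comm, orSum, map_sum]
  refine Finset.sum_congr rfl fun t _ => ?_
  rw [map_smul, map_smul, LinearMap.smul_apply, graphComp_graphClass,
    sum_flip_collapse i Γ.2 s, smul_smul, Finset.smul_sum]
  refine Finset.sum_congr rfl fun δ _ => ?_
  rw [mul_comm]
  congr 4
  funext e
  exact (flipEdges_map t Γ'.2 (inner i) e).symm

theorem orMap_act {N : ℕ} (σ : Equiv.Perm (Fin (N + 1))) (Γ : Multidigraph N) :
    orMap d N (graphClass True d (relabel σ Γ)) =
      graphAct False d N σ (orMap d N (graphClass True d Γ)) := by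
  rw [orMap_graphClass, orMap_graphClass, orSum, orSum, map_sum]
  refine Finset.sum_congr rfl fun s _ => ?_
  rw [map_smul, graphAct_graphClass]
  congr 3
  funext e
  exact (flipEdges_map s Γ.2 ⇑σ⁻¹ e).symm

/-- The orientation morphism. -/
def orientation : OperadHom (Gra d) (dGra d) :=
  OperadHom.ofGraphs (orMap d) (fun _ Γ => orMap_homog d Γ) (orMap_one d)
    (fun _ _ i Γ Γ' => orMap_comp d i Γ Γ') (fun _ σ Γ => orMap_act d σ Γ)

theorem orientation_graphClass {N : ℕ} (Γ : Multidigraph N) :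
    (orientation d).toFun N (graphClass True d Γ) = orSum d Γ :=
  orMap_graphClass d Γ

theorem ofFn_prod_smul {R : Type} [Ring R] [Algebra ℝ R] {k : ℕ} (c : Fin k → ℝ) (h : Fin k → R) :
    (List.ofFn fun e => c e • h e).prod = (∏ e, c e) • (List.ofFn h).prod := by
  induction k with
  | zero => simp
  | succ k ih =>
    rw [List.ofFn_succ, List.prod_cons, ih, List.ofFn_succ, List.prod_cons, Fin.prod_univ_succ,
      smul_mul_smul_comm]

/-- Expanding the ordered product of binomials chooses a direction for each edge, that is, a set of
edges to be reversed, with the factor (-1)^d for every reversal. -/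
theorem sum_flip_edgeProd {V : Type} [Ring V] [Algebra ℝ V] {N k : ℕ}
    (Δ : Fin N → Fin N → Module.End ℝ (TensorPow V N)) (γ : Fin k → Fin N × Fin N) :
    ∑ s : Fin k → Bool, (((flipSign d s : ℤˣ) : ℤ) : ℝ) • edgeProd Δ (flipEdges s γ) =
      edgeProd (fun i j => Δ i j + ((((-1 : ℤˣ) ^ d : ℤˣ) : ℤ) : ℝ) • Δ j i) γ := by
  set c : Bool → ℝ := fun b => if b then ((((-1 : ℤˣ) ^ d : ℤˣ) : ℤ) : ℝ) else 1 with hc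
  have h (e : Fin k) : Δ (γ e).1 (γ e).2 + ((((-1 : ℤˣ) ^ d : ℤˣ) : ℤ) : ℝ) • Δ (γ e).2 (γ e).1 =
      ∑ b : Bool, c b •
        Δ (if b then (γ e).swap else γ e).1 (if b then (γ e).swap else γ e).2 := by
    simp [add_comm, hc]
  rw [edgeProd]
  simp only [h, ofFn_prod_sum]
  refine Finset.sum_congr (by ext; simp [Fintype.mem_piFinset]) fun s _ => ?_
  refine Eq.trans ?_ (ofFn_prod_smul (fun e => c (s e)) _).symm
  have hs : (((flipSign d s : ℤˣ) : ℤ) : ℝ) = ∏ e, c (s e) := by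
    rw [flipSign]
    push_cast
    refine Finset.prod_congr rfl fun e _ => ?_
    simp only [hc]
    split_ifs <;> simp
  rw [hs]
  rfl

end Orientation

/-! ## Edge operators from graded commuting derivations -/

/-- A graded commutative algebra with graded commuting derivations indexed by `C`. -/
structure SuperCalculus (V : Type) [Ring V] [Algebra ℝ V] (C : Type) where
  P : V →ₗ[ℝ] V
  deg : C → ℕ
  del : C → V →ₗ[ℝ] V
  isParity : IsParity P
  der : ∀ c, IsSuperDerivation P (deg c) (del c)
  comm : ∀ c c' v, del c (del c' v) = (-1 : ℝ) ^ (deg c * deg c') • del c' (del c v)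

namespace SuperCalculus

variable {V : Type} [Ring V] [Algebra ℝ V] {C : Type} (X : SuperCalculus V C)

/-- The derivation indexed by `c` acting on the `i`-th factor. -/
def derivAt (c : C) {N : ℕ} (i : Fin N) : Module.End ℝ (TensorPow V N) :=
  opAt X.P (X.deg c) (X.del c) i

theorem derivAt_comm (c c' : C) {N : ℕ} (i j : Fin N) :
    X.derivAt c i * X.derivAt c' j =
      (-1 : ℝ) ^ (X.deg c * X.deg c') • (X.derivAt c' j * X.derivAt c i) :=
  opAt_comm (X.der c).anticomm (X.der c').anticomm (X.comm c c') i j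

variable {Q : Type} [Fintype Q] (w : Q → ℝ) (s t : Q → C)

/-- The operator of an edge. -/
def edge (N : ℕ) (i j : Fin N) : Module.End ℝ (TensorPow V N) :=
  ∑ q, w q • (X.derivAt (s q) i * X.derivAt (t q) j)

/-- The four exponents add up to (a + b)(c + d) = n * n, which has the parity of n. -/
theorem neg_one_pow_add_mul_add (n a b c d : ℕ) (h : a + b = n) (h' : c + d = n) :
    (-1 : ℝ) ^ (a * c) * (-1) ^ (a * d) * (-1) ^ (b * c) * (-1) ^ (b * d) = (-1) ^ n := by
  rw [← pow_add, ← pow_add, ← pow_add,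
    show a * c + a * d + b * c + b * d = (a + b) * (c + d) by ring, h, h']
  rcases Nat.even_or_odd n with hn | hn
  · rw [hn.neg_one_pow, (hn.mul_left n).neg_one_pow]
  · rw [hn.neg_one_pow, (hn.mul hn).neg_one_pow]

theorem mul_mul_comm_of_anticomm {R : Type} [Ring R] [Algebra ℝ R] {a b c d : R}
    {x y z u : ℝ} (h1 : a * c = x • (c * a)) (h2 : a * d = y • (d * a)) (h3 : b * c = z • (c * b))
    (h4 : b * d = u • (d * b)) : a * b * (c * d) = (x * y * z * u) • (c * d * (a * b)) := by
  calc a * b * (c * d) = a * (b * c) * d := by noncomm_ring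
    _ = z • (a * c * (b * d)) := by rw [h3]; simp [mul_assoc]
    _ = (z * (x * u)) • (c * (a * d) * b) := by
      rw [h1, h4]
      simp only [mul_smul_comm, smul_mul_assoc, smul_smul, mul_assoc]
      congr 1
      ring
    _ = (x * y * z * u) • (c * d * (a * b)) := by
      rw [h2]
      simp only [mul_smul_comm, smul_mul_assoc, smul_smul, mul_assoc]
      congr 1
      ring

theorem insertT_comp_derivAt_inner {M N : ℕ} (i : Fin (M + 1)) (m : ℕ)
    (Φ : TensorPow V (N + 1) →ₗ[ℝ] V) (c : C) (l : Fin (N + 1)) :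
    insertT i (X.P ^ m) Φ ∘ₗ X.derivAt c (inner i l) =
      insertT i (X.P ^ (m + X.deg c)) (Φ ∘ₗ X.derivAt c l) :=
  insertT_comp_opAt_inner i X.P m Φ _ _ l

theorem derivAt_comp_insertT {M N : ℕ} (i j : Fin (M + 1)) (c : C) :
    X.derivAt c j ∘ₗ insertT i (X.P ^ 0) (mulAll V (N + 1)) =
      insertT i (X.P ^ 0) (mulAll V (N + 1)) ∘ₗ
        ∑ a with collapse (N := N) i a = j, X.derivAt c a :=
  X.isParity.opAt_comp_insertT i j (X.der c)

theorem isEdgeOperator {n : ℕ} (h : ∀ q, X.deg (s q) + X.deg (t q) = n) :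
    IsEdgeOperator X.P n (X.edge w s t) where
  comm N i j k l := by
    simp only [edge, Finset.sum_mul_sum, Finset.smul_sum]
    rw [Finset.sum_comm]
    refine Finset.sum_congr rfl fun q _ => Finset.sum_congr rfl fun r _ => ?_
    rw [smul_mul_smul_comm, smul_mul_smul_comm, mul_mul_comm_of_anticomm (X.derivAt_comm _ _ _ _)
      (X.derivAt_comm _ _ _ _) (X.derivAt_comm _ _ _ _) (X.derivAt_comm _ _ _ _),
      neg_one_pow_add_mul_add n _ _ _ _ (h r) (h q), smul_smul, smul_smul]
    congr 1
    ring
  parity N i j := by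
    have hd (c : C) (i : Fin N) : X.derivAt c i * parityT X.P N =
        (-1 : ℝ) ^ X.deg c • (parityT X.P N * X.derivAt c i) :=
      opAt_comp_parityT (X.der c).anticomm i
    change edge X w s t N i j * parityT X.P N = (-1 : ℝ) ^ n • (parityT X.P N * edge X w s t N i j)
    rw [edge, Finset.sum_mul, Finset.mul_sum, Finset.smul_sum]
    refine Finset.sum_congr rfl fun q _ => ?_
    rw [smul_mul_assoc, mul_assoc, hd, mul_smul_comm, ← mul_assoc, hd, smul_mul_assoc,
      mul_smul_comm, smul_smul, smul_smul, smul_smul, ← h q, pow_add, mul_assoc]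
    congr 1
    ring
  insert_inner M N i m Φ l l' := by
    have h1 : Φ ∘ₗ X.edge w s t (N + 1) l l' =
        ∑ q, w q • (Φ ∘ₗ X.derivAt (s q) l ∘ₗ X.derivAt (t q) l') := by
      ext; simp [edge]
    have h2 : insertT i (X.P ^ m) Φ ∘ₗ X.edge w s t (M + N + 1) (inner i l) (inner i l') =
        ∑ q, w q • ((insertT i (X.P ^ m) Φ ∘ₗ X.derivAt (s q) (inner i l)) ∘ₗ
          X.derivAt (t q) (inner i l')) := by
      ext; simp [edge]
    rw [h1, h2, map_sum]
    refine Finset.sum_congr rfl fun q _ => ?_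
    rw [map_smul, X.insertT_comp_derivAt_inner, X.insertT_comp_derivAt_inner, ← h q,
      LinearMap.comp_assoc, ← add_assoc m]
  comp_insert M N i j k := by
    have h1 : X.edge w s t (M + 1) j k ∘ₗ insertT i (X.P ^ 0) (mulAll V (N + 1)) =
        ∑ q, w q • (X.derivAt (s q) j ∘ₗ X.derivAt (t q) k ∘ₗ
          insertT i (X.P ^ 0) (mulAll V (N + 1))) := by
      ext; simp [edge]
    rw [h1]
    -- The derivation at the target acts first, so it is moved through the insertion first. The two
    -- ends are reconnected independently, also for a loop.
    simp only [X.derivAt_comp_insertT i k]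
    simp only [← LinearMap.comp_assoc, X.derivAt_comp_insertT i j]
    simp only [LinearMap.comp_assoc, ← Module.End.mul_eq_comp, Finset.sum_mul_sum,
      ← Finset.sum_product', ← LinearMap.comp_smul]
    refine LinearMap.ext fun T => ?_
    rw [LinearMap.sum_apply]
    simp only [LinearMap.comp_apply]
    rw [← map_sum, ← LinearMap.sum_apply]
    simp only [edge, Finset.smul_sum]
    rw [Finset.sum_comm]
  koszul N σ i j := by
    have h1 : koszulMap X.P σ ∘ₗ X.edge w s t (N + 1) i j =
        ∑ q, w q • ((koszulMap X.P σ ∘ₗ X.derivAt (s q) i) ∘ₗ X.derivAt (t q) j) := by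
      refine LinearMap.ext fun T => ?_
      simp [edge]
    have h2 : X.edge w s t (N + 1) (σ i) (σ j) ∘ₗ koszulMap X.P σ =
        ∑ q, w q • (X.derivAt (s q) (σ i) ∘ₗ X.derivAt (t q) (σ j) ∘ₗ koszulMap X.P σ) := by
      refine LinearMap.ext fun T => ?_
      simp [edge]
    have hd (c : C) (i : Fin (N + 1)) :
        koszulMap X.P σ ∘ₗ X.derivAt c i = X.derivAt c (σ i) ∘ₗ koszulMap X.P σ :=
      X.isParity.koszulMap_comp_opAt (X.der c).anticomm σ i
    rw [h1, h2]
    refine Finset.sum_congr rfl fun q _ => ?_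
    rw [hd, LinearMap.comp_assoc, hd]

/-! ### Degrees of the operations of graphs. -/

/-- A grading compatible with the multiplication and the derivations. -/
structure IsGrading (G : ℤ → Submodule ℝ V) : Prop where
  one_mem : 1 ∈ G 0
  mul_mem : ∀ {a b : ℤ} {u v : V}, u ∈ G a → v ∈ G b → u * v ∈ G (a + b)
  P_mem : ∀ {a : ℤ} {v : V}, v ∈ G a → X.P v ∈ G a
  del_mem : ∀ {a : ℤ} {v : V} (c : C), v ∈ G a → X.del c v ∈ G (a - X.deg c)

/-- The tensors of degree `a`. -/
def tensorDegree (G : ℤ → Submodule ℝ V) (N : ℕ) (a : ℤ) : Submodule ℝ (TensorPow V N) :=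
  Submodule.span ℝ {T | ∃ (b : Fin N → ℤ) (f : Fin N → V), (∀ i, f i ∈ G (b i)) ∧ ∑ i, b i = a ∧
    T = PiTensorProduct.tprod ℝ f}

variable {X}

namespace IsGrading

variable {G : ℤ → Submodule ℝ V} (hG : X.IsGrading G)

include hG

theorem mulAll_mem {N : ℕ} {a : ℤ} {T : TensorPow V N} (hT : T ∈ tensorDegree G N a) :
    mulAll V N T ∈ G a := by
  suffices h : tensorDegree G N a ≤ (G a).comap (mulAll V N) from h hT
  clear hT T
  refine Submodule.span_le.2 ?_
  rintro _ ⟨b, f, hf, rfl, rfl⟩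
  change mulAll V N _ ∈ G _
  rw [mulAll_tprod]
  induction N with
  | zero => simpa using hG.one_mem
  | succ N ih =>
    rw [List.ofFn_succ, List.prod_cons, Fin.sum_univ_succ]
    exact hG.mul_mem (hf 0) (ih _ _ fun i => hf i.succ)

theorem pow_P_mem (p : ℕ) {a : ℤ} {v : V} (hv : v ∈ G a) : (X.P ^ p) v ∈ G a := by
  induction p with
  | zero => exact hv
  | succ p ih => rw [pow_succ', Module.End.mul_apply]; exact hG.P_mem ih

theorem derivAt_mem (c : C) {N : ℕ} (i : Fin N) {a : ℤ} {T : TensorPow V N}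
    (hT : T ∈ tensorDegree G N a) : X.derivAt c i T ∈ tensorDegree G N (a - X.deg c) := by
  suffices h : tensorDegree G N a ≤ (tensorDegree G N (a - X.deg c)).comap (X.derivAt c i) from h hT
  refine Submodule.span_le.2 ?_
  rintro _ ⟨b, f, hf, rfl, rfl⟩
  change X.derivAt c i _ ∈ tensorDegree G N _
  rw [derivAt, opAt_tprod]
  refine Submodule.subset_span ⟨fun j => b j - if j = i then (X.deg c : ℤ) else 0, _, ?_, ?_, rfl⟩
  · intro j
    rcases lt_trichotomy j i with h | rfl | h
    · simpa [h, h.ne] using hG.pow_P_mem _ (hf j)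
    · simpa using hG.del_mem c (hf j)
    · simpa [h.not_gt, h.ne'] using hf j
  · simp

theorem edge_mem {n : ℕ} (h : ∀ q, X.deg (s q) + X.deg (t q) = n) {N : ℕ} (i j : Fin N) {a : ℤ}
    {T : TensorPow V N} (hT : T ∈ tensorDegree G N a) :
    X.edge w s t N i j T ∈ tensorDegree G N (a - n) := by
  rw [edge, LinearMap.sum_apply]
  refine Submodule.sum_mem _ fun q _ => Submodule.smul_mem _ _ ?_
  have := hG.derivAt_mem (s q) i (hG.derivAt_mem (t q) j hT)
  rwa [sub_sub, show (X.deg (t q) : ℤ) + X.deg (s q) = n by rw [← h q]; push_cast; ring] at this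

theorem edgeProd_mem {n : ℕ} (h : ∀ q, X.deg (s q) + X.deg (t q) = n) {N k : ℕ}
    (γ : Fin k → Fin N × Fin N) {a : ℤ} {T : TensorPow V N} (hT : T ∈ tensorDegree G N a) :
    edgeProd (X.edge w s t N) γ T ∈ tensorDegree G N (a - k * n) := by
  induction k with
  | zero => simpa [edgeProd] using hT
  | succ k ih =>
    have := hG.edge_mem w s t h (γ 0).1 (γ 0).2 (ih fun e => γ e.succ)
    rw [edgeProd, List.ofFn_succ, List.prod_cons, Module.End.mul_apply]
    rw [show a - ((k + 1 : ℕ) : ℤ) * n = a - k * n - n by push_cast; ring]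
    exact this

/-- Each edge lowers the degree by n, and k (1 - d) = -k n for d = n + 1. -/
theorem graphOp_mem {n : ℕ} (h : ∀ q, X.deg (s q) + X.deg (t q) = n) {N : ℕ} (Γ : Multidigraph N)
    (b : Fin (N + 1) → ℤ) (f : Fin (N + 1) → V) (hf : ∀ i, f i ∈ G (b i)) :
    graphOp (X.edge w s t (N + 1)) Γ.2 f ∈ G ((Γ.1 : ℤ) * (1 - (n + 1)) + ∑ i, b i) := by
  have := hG.mulAll_mem (hG.edgeProd_mem w s t h Γ.2
    (Submodule.subset_span ⟨b, f, hf, rfl, rfl⟩ :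
      PiTensorProduct.tprod ℝ f ∈ tensorDegree G (N + 1) (∑ i, b i)))
  rw [show (Γ.1 : ℤ) * (1 - (n + 1)) + ∑ i, b i = ∑ i, b i - Γ.1 * n by ring]
  exact this

/-- The representation of directed graphs on a graded commutative algebra with graded commuting
derivations. -/
def representation {n : ℕ} (h : ∀ q, X.deg (s q) + X.deg (t q) = n) :
    OperadHom (dGra (n + 1)) (EndOperad G X.P) :=
  OperadHom.ofGraphs (Q := EndOperad G X.P) (fun N => (X.isEdgeOperator w s t h).rep N)
    (fun N Γ b f hf => by
      have := hG.graphOp_mem w s t h Γ b f hf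
      rw [← (X.isEdgeOperator w s t h).rep_graphClass] at this
      exact this)
    (by
      refine ((X.isEdgeOperator w s t h).rep_graphClass _).trans ?_
      refine MultilinearMap.ext fun f => ?_
      change mulAll V 1 (PiTensorProduct.tprod ℝ f) = f 0
      simp [mulAll_tprod])
    (fun M N i Γ Γ' => by
      have hc := (X.isEdgeOperator w s t h).endComp_graphOp X.isParity i Γ Γ'
      simp only [← (X.isEdgeOperator w s t h).rep_graphClass] at hc
      refine Eq.trans ?_ hc.symm
      refine Finset.sum_congr rfl fun δ _ => ?_
      exact ((X.isEdgeOperator w s t h).rep_graphClass _))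
    (fun N σ Γ => by
      have hc := (X.isEdgeOperator w s t h).endAct_graphOp X.isParity σ Γ
      rw [← (X.isEdgeOperator w s t h).rep_graphClass] at hc
      exact ((X.isEdgeOperator w s t h).rep_graphClass _).trans hc.symm)

end IsGrading

/-- The operator of a reversed edge. -/
theorem edge_symm (N : ℕ) (i j : Fin N) :
    X.edge w s t N j i = ∑ q, (w q * (-1) ^ (X.deg (s q) * X.deg (t q))) •
      (X.derivAt (t q) i * X.derivAt (s q) j) := by
  rw [edge]
  refine Finset.sum_congr rfl fun q _ => ?_
  rw [derivAt_comm, smul_smul]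

end SuperCalculus

/-! ## Calculus of polynomials in graded commutative variables -/

/-! ### The exterior algebra: graded commutativity and contractions. -/

section Exterior

variable {W : Type} [AddCommGroup W] [Module ℝ W]

open CliffordAlgebra in
theorem exterior_ι_mul (m : W) (y : ExteriorAlgebra ℝ W) :
    ExteriorAlgebra.ι ℝ m * y =
      involute (Q := (0 : QuadraticForm ℝ W)) y * ExteriorAlgebra.ι ℝ m := by
  induction y using CliffordAlgebra.left_induction with
  | algebraMap r => rw [AlgHom.commutes, Algebra.commutes]
  | add x y hx hy => rw [mul_add, hx, hy, map_add, add_mul]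
  | ι_mul y m' hy =>
    have h : ExteriorAlgebra.ι ℝ m * ExteriorAlgebra.ι ℝ m' =
        -(ExteriorAlgebra.ι ℝ m' * ExteriorAlgebra.ι ℝ m) :=
      eq_neg_of_add_eq_zero_left (ExteriorAlgebra.ι_add_mul_swap m m')
    change ExteriorAlgebra.ι ℝ m * (ExteriorAlgebra.ι ℝ m' * y) = _
    rw [← mul_assoc, h, neg_mul, mul_assoc, hy, map_mul, involute_ι, neg_mul, neg_mul, mul_assoc]

-- The two claims concern twice the even and twice the odd part of x. They are proved together
-- because multiplication by a generator exchanges the two parts.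
open CliffordAlgebra in
theorem exterior_graded_comm (x : ExteriorAlgebra ℝ W) :
    (∀ y, (x + involute (Q := (0 : QuadraticForm ℝ W)) x) * y =
      y * (x + involute (Q := (0 : QuadraticForm ℝ W)) x)) ∧
    ∀ y, (x - involute (Q := (0 : QuadraticForm ℝ W)) x) * y =
      involute (Q := (0 : QuadraticForm ℝ W)) y *
        (x - involute (Q := (0 : QuadraticForm ℝ W)) x) := by
  induction x using CliffordAlgebra.left_induction with
  | algebraMap r =>
    constructor <;> intro y
    · rw [AlgHom.commutes, ← map_add, Algebra.commutes]
    · rw [AlgHom.commutes, sub_self, zero_mul, mul_zero]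
  | add x x' hx hx' =>
    constructor <;> intro y
    · rw [map_add, add_add_add_comm, add_mul, mul_add, hx.1, hx'.1]
    · rw [map_add, add_sub_add_comm, add_mul, mul_add, hx.2, hx'.2]
  | ι_mul x m hx =>
    have e1 : CliffordAlgebra.ι (0 : QuadraticForm ℝ W) m * x +
        involute (CliffordAlgebra.ι (0 : QuadraticForm ℝ W) m * x) =
          ExteriorAlgebra.ι ℝ m * (x - involute (Q := (0 : QuadraticForm ℝ W)) x) := by
      rw [map_mul, involute_ι, mul_sub, neg_mul, sub_eq_add_neg]
    have e2 : CliffordAlgebra.ι (0 : QuadraticForm ℝ W) m * x -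
        involute (CliffordAlgebra.ι (0 : QuadraticForm ℝ W) m * x) =
          ExteriorAlgebra.ι ℝ m * (x + involute (Q := (0 : QuadraticForm ℝ W)) x) := by
      rw [map_mul, involute_ι, mul_add, neg_mul, sub_neg_eq_add]
    constructor <;> intro y
    · rw [e1, mul_assoc, hx.2, ← mul_assoc, exterior_ι_mul, involute_involute, mul_assoc]
    · rw [e2, mul_assoc, hx.1, ← mul_assoc, exterior_ι_mul, mul_assoc]

open CliffordAlgebra in
theorem contractLeft_involute (d : Module.Dual ℝ W) (x : CliffordAlgebra (0 : QuadraticForm ℝ W)) :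
    contractLeft d (involute x) = -involute (contractLeft d x) := by
  induction x using CliffordAlgebra.left_induction with
  | algebraMap r => simp
  | add x y hx hy => rw [map_add, map_add, map_add, map_add, hx, hy, neg_add]
  | ι_mul x m hx =>
    rw [map_mul, involute_ι, neg_mul, map_neg, contractLeft_ι_mul, contractLeft_ι_mul, hx, map_sub,
      map_smul, map_mul, involute_ι]
    noncomm_ring

open CliffordAlgebra in
theorem contractLeft_mul (d : Module.Dual ℝ W) (x y : CliffordAlgebra (0 : QuadraticForm ℝ W)) :
    contractLeft d (x * y) = contractLeft d x * y + involute x * contractLeft d y := by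
  induction x using CliffordAlgebra.left_induction with
  | algebraMap r => simp [contractLeft_algebraMap_mul]
  | add x x' hx hx' => simp only [add_mul, map_add, hx, hx']; abel
  | ι_mul x m hx =>
    rw [mul_assoc, contractLeft_ι_mul, hx, contractLeft_ι_mul, map_mul, involute_ι]
    simp only [mul_add, sub_mul, smul_mul_assoc, mul_assoc, neg_mul]
    abel

end Exterior

/-! ### Partial derivatives of smooth functions and of polynomials. -/

section SmoothCalculus

variable {ι : Type} {U : TopologicalSpace.Opens (ι → ℝ)}

/-- Since U is open, the extension by zero does not affect germs at points of U, hence not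
derivatives there. -/
theorem Smooth.extend_eventuallyEq {F : U → ℝ} {G : (ι → ℝ) → ℝ} (h : ∀ y : U, F y = G y) (y : U) :
    Function.extend Subtype.val F (0 : (ι → ℝ) → ℝ) =ᶠ[nhds (y : ι → ℝ)] G := by
  filter_upwards [U.isOpen.mem_nhds y.2] with z hz
  rw [extend_apply F hz]
  exact h ⟨z, hz⟩

variable [Fintype ι]

theorem Smooth.pderiv_mul (c : ι) (f g : Smooth U) :
    Smooth.pderiv c (f * g) = Smooth.pderiv c f * g + f * Smooth.pderiv c g := by
  classical
  refine Subtype.ext (funext fun y => ?_)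
  have h : Function.extend Subtype.val (f * g).1 (0 : (ι → ℝ) → ℝ) =ᶠ[nhds (y : ι → ℝ)]
      Function.extend Subtype.val f.1 0 * Function.extend Subtype.val g.1 0 :=
    Smooth.extend_eventuallyEq (fun z => by
      rw [Pi.mul_apply, extend_apply _ z.2, extend_apply _ z.2]; rfl) y
  change fderiv ℝ _ _ _ = fderiv ℝ _ _ _ * g.1 y + f.1 y * fderiv ℝ _ _ _
  rw [h.fderiv_eq, fderiv_mul (differentiableAt_extend f y) (differentiableAt_extend g y)]
  simp only [add_apply, smul_apply, smul_eq_mul, extend_apply _ y.2]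
  ring

theorem Smooth.pderiv_comm (c c' : ι) (f : Smooth U) :
    Smooth.pderiv c (Smooth.pderiv c' f) = Smooth.pderiv c' (Smooth.pderiv c f) := by
  classical
  refine Subtype.ext (funext fun y => ?_)
  have hf : ContDiffAt ℝ ∞ (Function.extend Subtype.val f.1 (0 : (ι → ℝ) → ℝ)) (y : ι → ℝ) :=
    (f.2 : ContDiffOn ℝ ∞ _ _).contDiffAt (U.isOpen.mem_nhds y.2)
  have hd : DifferentiableAt ℝ (fderiv ℝ (Function.extend Subtype.val f.1 (0 : (ι → ℝ) → ℝ)))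
      (y : ι → ℝ) := (hf.fderiv_right (m := ∞) (by simp)).differentiableAt (by simp)
  have key (a b : ι) : (Smooth.pderiv a (Smooth.pderiv b f)).1 y =
      fderiv ℝ (fderiv ℝ (Function.extend Subtype.val f.1 (0 : (ι → ℝ) → ℝ))) y (Pi.single a 1)
        (Pi.single b 1) := by
    have h : Function.extend Subtype.val (Smooth.pderiv b f).1 (0 : (ι → ℝ) → ℝ)
        =ᶠ[nhds (y : ι → ℝ)] fun z =>
          fderiv ℝ (Function.extend Subtype.val f.1 (0 : (ι → ℝ) → ℝ)) z (Pi.single b 1) :=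
      Smooth.extend_eventuallyEq (fun z => by
        change fderiv ℝ _ _ _ = _
        congr!) y
    have e : (Smooth.pderiv a (Smooth.pderiv b f)).1 y = fderiv ℝ
        (Function.extend Subtype.val (Smooth.pderiv b f).1 (0 : (ι → ℝ) → ℝ)) y
          (Pi.single a 1) := by
      change fderiv ℝ _ _ _ = _
      congr!
    rw [e, h.fderiv_eq, fderiv_clm_apply hd (differentiableAt_const _)]
    simp
  have hs : IsSymmSndFDerivAt ℝ (Function.extend Subtype.val f.1 (0 : (ι → ℝ) → ℝ)) (y : ι → ℝ) :=
    hf.isSymmSndFDerivAt (by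
      rw [minSmoothness_of_isRCLikeNormedField]
      exact ENat.LEInfty.out)
  rw [key, key, hs.eq]

/-- The commutator of two derivations is a derivation, and this one vanishes on the variables. -/
theorem mvPolynomial_pderiv_comm {E : Type} (c c' : E) (f : MvPolynomial E ℝ) :
    MvPolynomial.pderiv c (MvPolynomial.pderiv c' f) =
      MvPolynomial.pderiv c' (MvPolynomial.pderiv c f) := by
  classical
  have h : ⁅MvPolynomial.pderiv (R := ℝ) c, MvPolynomial.pderiv c'⁆ = 0 :=
    MvPolynomial.derivation_ext fun i => by
      rw [Derivation.commutator_apply, MvPolynomial.pderiv_X, MvPolynomial.pderiv_X]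
      simp only [Pi.single_apply]
      split_ifs <;> simp
  have := congrArg (fun D => D f) h
  simpa [Derivation.commutator_apply, sub_eq_zero] using this

end SmoothCalculus

/-! ### Derivations and commutation on tensor products. -/

section TensorDerivations

variable {A B : Type} [Ring A] [Algebra ℝ A] [Ring B] [Algebra ℝ B]

theorem map_id_leibniz (d Q : B →ₗ[ℝ] B) (h : ∀ u v, d (u * v) = d u * v + Q u * d v)
    (u v : A ⊗[ℝ] B) :
    TensorProduct.map (LinearMap.id : A →ₗ[ℝ] A) d (u * v) =
      TensorProduct.map (LinearMap.id : A →ₗ[ℝ] A) d u * v +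
        TensorProduct.map (LinearMap.id : A →ₗ[ℝ] A) Q u *
          TensorProduct.map (LinearMap.id : A →ₗ[ℝ] A) d v := by
  induction u using TensorProduct.induction_on with
  | zero => simp
  | add u u' hu hu' => simp only [add_mul, map_add, hu, hu']; abel
  | tmul a b =>
    induction v using TensorProduct.induction_on with
    | zero => simp
    | add v v' hv hv' => simp only [mul_add, map_add, hv, hv']; abel
    | tmul a' b' => simp [h, TensorProduct.tmul_add]

theorem map_leibniz_id (d : A →ₗ[ℝ] A) (h : ∀ u v, d (u * v) = d u * v + u * d v)
    (u v : A ⊗[ℝ] B) :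
    TensorProduct.map d (LinearMap.id : B →ₗ[ℝ] B) (u * v) =
      TensorProduct.map d (LinearMap.id : B →ₗ[ℝ] B) u * v +
        u * TensorProduct.map d (LinearMap.id : B →ₗ[ℝ] B) v := by
  induction u using TensorProduct.induction_on with
  | zero => simp
  | add u u' hu hu' => simp only [add_mul, map_add, hu, hu']; abel
  | tmul a b =>
    induction v using TensorProduct.induction_on with
    | zero => simp
    | add v v' hv hv' => simp only [mul_add, map_add, hv, hv']; abel
    | tmul a' b' => simp [h, TensorProduct.add_tmul]

variable {A' B' : Type} [AddCommGroup A'] [Module ℝ A'] [AddCommGroup B'] [Module ℝ B']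

theorem map_comm_map {d e : A' →ₗ[ℝ] A'} {d' e' : B' →ₗ[ℝ] B'} {x y : ℝ}
    (h : ∀ a, d (e a) = x • e (d a)) (h' : ∀ b, d' (e' b) = y • e' (d' b)) (u : A' ⊗[ℝ] B') :
    TensorProduct.map d d' (TensorProduct.map e e' u) =
      (x * y) • TensorProduct.map e e' (TensorProduct.map d d' u) := by
  induction u using TensorProduct.induction_on with
  | zero => simp
  | add u v hu hv => rw [map_add, map_add, hu, hv, map_add, map_add, smul_add]
  | tmul a b => rw [TensorProduct.map_tmul, TensorProduct.map_tmul, h, h', TensorProduct.smul_tmul_smul]; rfl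

end TensorDerivations

/-- The first factor is commutative and entirely even, so graded commutativity reduces to that of
the exterior algebra. As there, it is proved for u + P u and u - P u first. -/
theorem isParity_map_involute {A W : Type} [CommRing A] [Algebra ℝ A] [AddCommGroup W]
    [Module ℝ W] :
    IsParity (V := A ⊗[ℝ] ExteriorAlgebra ℝ W) (TensorProduct.map LinearMap.id
      (CliffordAlgebra.involute (Q := (0 : QuadraticForm ℝ W))).toLinearMap) := by
  let Pa : A ⊗[ℝ] ExteriorAlgebra ℝ W →ₐ[ℝ] A ⊗[ℝ] ExteriorAlgebra ℝ W :=
    Algebra.TensorProduct.map (AlgHom.id ℝ _)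
      (CliffordAlgebra.involute (Q := (0 : QuadraticForm ℝ W)))
  have hadd (u v : A ⊗[ℝ] ExteriorAlgebra ℝ W) : (u + Pa u) * v = v * (u + Pa u) := by
    induction u using TensorProduct.induction_on with
    | zero => simp
    | add u u' hu hu' => rw [map_add, add_add_add_comm, add_mul, mul_add, hu, hu']
    | tmul a b =>
      induction v using TensorProduct.induction_on with
      | zero => simp
      | add v v' hv hv' => rw [mul_add, add_mul _ _ (_ + _), hv, hv']
      | tmul a' b' =>
        simp only [Pa, Algebra.TensorProduct.map_tmul, AlgHom.id_apply, ← TensorProduct.tmul_add,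
          Algebra.TensorProduct.tmul_mul_tmul]
        rw [(exterior_graded_comm b).1, mul_comm a]
  have hsub (u v : A ⊗[ℝ] ExteriorAlgebra ℝ W) : (u - Pa u) * v = Pa v * (u - Pa u) := by
    induction u using TensorProduct.induction_on with
    | zero => simp
    | add u u' hu hu' => rw [map_add, add_sub_add_comm, add_mul, mul_add, hu, hu']
    | tmul a b =>
      induction v using TensorProduct.induction_on with
      | zero => simp
      | add v v' hv hv' => rw [mul_add, map_add, add_mul, hv, hv']
      | tmul a' b' =>
        simp only [Pa, Algebra.TensorProduct.map_tmul, AlgHom.id_apply, ← TensorProduct.tmul_sub,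
          Algebra.TensorProduct.tmul_mul_tmul]
        rw [(exterior_graded_comm b).2, mul_comm a]
  refine ⟨fun v => ?_, map_one Pa, map_mul Pa, fun u v hu => ?_, fun u v hu => ?_⟩
  · change Pa (Pa v) = v
    have : Pa.comp Pa = AlgHom.id ℝ _ := by
      rw [← Algebra.TensorProduct.map_comp, CliffordAlgebra.involute_comp_involute]
      exact Algebra.TensorProduct.map_id
    exact congrArg (fun φ => φ v) this
  -- For an even u, u + P u is 2 u, and the factor 2 cancels.
  · have h := hadd u v
    rw [show Pa u = u from hu, ← two_smul ℝ, smul_mul_assoc, mul_smul_comm] at h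
    exact smul_right_injective _ (two_ne_zero (α := ℝ)) h
  · have h := hsub u v
    rw [show Pa u = -u from hu, sub_neg_eq_add, ← two_smul ℝ, smul_mul_assoc, mul_smul_comm] at h
    exact smul_right_injective _ (two_ne_zero (α := ℝ)) h

/-! ### Partial derivatives as graded commuting derivations. -/

namespace GradedFun

variable {ι : Type} [Fintype ι] {U : TopologicalSpace.Opens (ι → ℝ)} {E O : Type}

theorem isParity : IsParity (parity : GradedFun U E O →ₗ[ℝ] GradedFun U E O) :=
  isParity_map_involute (A := Smooth U ⊗[ℝ] MvPolynomial E ℝ) (W := O →₀ ℝ)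

theorem parity_pow_of_even {p : ℕ} (hp : Even p) :
    (parity : GradedFun U E O →ₗ[ℝ] GradedFun U E O) ^ p = LinearMap.id := by
  rw [← isParity.pow_mod_two, Nat.even_iff.1 hp]
  rfl

theorem parity_pow_of_odd {p : ℕ} (hp : Odd p) :
    (parity : GradedFun U E O →ₗ[ℝ] GradedFun U E O) ^ p = parity := by
  rw [← isParity.pow_mod_two, Nat.odd_iff.1 hp, pow_one]

theorem basePartial_isSuperDerivation (c : ι) {p : ℕ} (hp : Even p) :
    IsSuperDerivation (V := GradedFun U E O) parity p (basePartial c) where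
  anticomm v := by
    rw [hp.neg_one_pow]
    exact (map_comm_map (x := 1) (y := 1) (fun _ => by simp) (fun _ => by simp) v).trans
      (by rw [one_mul]; rfl)
  leibniz u v := by
    rw [parity_pow_of_even hp]
    exact map_leibniz_id _ (map_leibniz_id _ (Smooth.pderiv_mul c)) u v

theorem evenPartial_isSuperDerivation (c : E) {p : ℕ} (hp : Even p) :
    IsSuperDerivation (V := GradedFun U E O) parity p (evenPartial c) where
  anticomm v := by
    rw [hp.neg_one_pow]
    exact (map_comm_map (x := 1) (y := 1) (fun _ => by simp) (fun _ => by simp) v).trans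
      (by rw [one_mul]; rfl)
  leibniz u v := by
    rw [parity_pow_of_even hp]
    refine map_leibniz_id _ (fun x y => ?_) u v
    have h := map_id_leibniz (A := Smooth U) (MvPolynomial.pderiv (R := ℝ) c).toLinearMap
      LinearMap.id (fun f g => by
        simp only [Derivation.coeFn_coe, Derivation.leibniz, smul_eq_mul, LinearMap.id_apply]
        ring) x y
    rwa [TensorProduct.map_id] at h

theorem oddPartial_isSuperDerivation (c : O) {p : ℕ} (hp : Odd p) :
    IsSuperDerivation (V := GradedFun U E O) parity p (oddPartial c) where
  anticomm v := by
    rw [hp.neg_one_pow]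
    exact (map_comm_map (x := 1) (y := -1) (fun _ => by simp)
      (fun x => by
        rw [neg_one_smul]
        exact contractLeft_involute _ x) v).trans (by rw [one_mul]; rfl)
  leibniz u v := by
    rw [parity_pow_of_odd hp]
    exact map_id_leibniz _ _ (contractLeft_mul _) u v

theorem basePartial_comm_basePartial (c c' : ι) (v : GradedFun U E O) :
    basePartial c (basePartial c' v) = basePartial c' (basePartial c v) :=
  (map_comm_map (x := 1) (y := 1)
    (fun a => by
      rw [one_smul]
      refine (map_comm_map (x := 1) (y := 1) (fun f => ?_) (fun _ => by simp) a).trans (by simp)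
      rw [one_smul, Smooth.pderiv_comm])
    (fun _ => by simp) v).trans (by rw [one_mul, one_smul]; rfl)

theorem basePartial_comm_evenPartial (c : ι) (c' : E) (v : GradedFun U E O) :
    basePartial c (evenPartial c' v) = evenPartial c' (basePartial c v) :=
  (map_comm_map (x := 1) (y := 1)
    (fun a => by
      rw [one_smul]
      exact (map_comm_map (x := 1) (y := 1) (fun f => by simp) (fun _ => by simp) a).trans (by simp))
    (fun _ => by simp) v).trans (by rw [one_mul, one_smul]; rfl)

theorem evenPartial_comm_evenPartial (c c' : E) (v : GradedFun U E O) :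
    evenPartial c (evenPartial c' v) = evenPartial c' (evenPartial c v) :=
  (map_comm_map (x := 1) (y := 1)
    (fun a => by
      rw [one_smul]
      refine (map_comm_map (x := 1) (y := 1) (fun f => by simp) (fun f => ?_) a).trans (by simp)
      rw [one_smul]
      exact mvPolynomial_pderiv_comm c c' f)
    (fun _ => by simp) v).trans (by rw [one_mul, one_smul]; rfl)

theorem basePartial_comm_oddPartial (c : ι) (c' : O) (v : GradedFun U E O) :
    basePartial c (oddPartial c' v) = oddPartial c' (basePartial c v) :=
  (map_comm_map (x := 1) (y := 1) (fun _ => by simp) (fun _ => by simp) v).trans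
    (by rw [one_mul, one_smul]; rfl)

theorem evenPartial_comm_oddPartial (c : E) (c' : O) (v : GradedFun U E O) :
    evenPartial c (oddPartial c' v) = oddPartial c' (evenPartial c v) :=
  (map_comm_map (x := 1) (y := 1) (fun _ => by simp) (fun _ => by simp) v).trans
    (by rw [one_mul, one_smul]; rfl)

theorem oddPartial_comm_oddPartial (c c' : O) (v : GradedFun U E O) :
    oddPartial c (oddPartial c' v) = -oddPartial c' (oddPartial c v) :=
  (map_comm_map (x := 1) (y := -1) (fun _ => by simp)
    (fun x => by
      rw [neg_one_smul]
      exact CliffordAlgebra.contractLeft_comm _ _ x) v).trans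
    ((congrArg (· • _) (one_mul (-1 : ℝ))).trans (neg_one_smul ℝ (oddPartial c' (oddPartial c v))))

end GradedFun

theorem IsEdgeOperator.rep_orSum {V : Type} [Ring V] [Algebra ℝ V] {P : V →ₗ[ℝ] V} {n : ℕ}
    {Δ : ∀ N, Fin N → Fin N → Module.End ℝ (TensorPow V N)} (hΔ : IsEdgeOperator P n Δ) {N : ℕ}
    (Γ : Multidigraph N) :
    hΔ.rep N (orSum (n + 1) Γ) = graphOp (fun i j => Δ (N + 1) i j +
      ((((-1 : ℤˣ) ^ ((n : ℤ) + 1) : ℤˣ) : ℤ) : ℝ) • Δ (N + 1) j i) Γ.2 := by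
  rw [orSum, map_sum, graphOp, ← sum_flip_edgeProd]
  simp only [map_smul, hΔ.rep_graphClass, graphOp]
  ext f
  simp

/-! ## The graded algebra of functions on an NP-manifold -/

namespace GradedFun

variable {ι : Type} {U : TopologicalSpace.Opens (ι → ℝ)} {E O : Type}

theorem monomial_mul [Fintype ι] (f f' : Smooth U) (s s' : Multiset E) (t t' : List O) :
    (monomial f s t * monomial f' s' t' : GradedFun U E O) =
      monomial (f * f') (s + s') (t ++ t') := by
  have h : (monomial f s t * monomial f' s' t' : GradedFun U E O) =
      ((f * f') ⊗ₜ[ℝ] ((s.map (MvPolynomial.X (R := ℝ))).prod *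
        (s'.map (MvPolynomial.X (R := ℝ))).prod)) ⊗ₜ[ℝ]
      ((t.map fun c => ExteriorAlgebra.ι ℝ (Finsupp.single c (1 : ℝ))).prod *
        (t'.map fun c => ExteriorAlgebra.ι ℝ (Finsupp.single c (1 : ℝ))).prod) :=
    (Algebra.TensorProduct.tmul_mul_tmul _ _ _ _).trans
      (congrArg (· ⊗ₜ[ℝ] _) (Algebra.TensorProduct.tmul_mul_tmul _ _ _ _))
  rw [h, monomial, Multiset.map_add, Multiset.prod_add, List.map_append, List.prod_append]

theorem one_eq_monomial [Fintype ι] : (1 : GradedFun U E O) = monomial 1 0 [] := rfl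

theorem parity_monomial [Fintype ι] (f : Smooth U) (s : Multiset E) (t : List O) :
    (parity (monomial f s t) : GradedFun U E O) = (-1 : ℝ) ^ t.length • monomial f s t := by
  have h := CliffordAlgebra.involute_prod_map_ι (Q := (0 : QuadraticForm ℝ (O →₀ ℝ)))
    (t.map fun c => Finsupp.single c (1 : ℝ))
  rw [List.map_map, List.length_map] at h
  change (f ⊗ₜ[ℝ] (s.map (MvPolynomial.X (R := ℝ))).prod) ⊗ₜ[ℝ] CliffordAlgebra.involute
    (t.map (CliffordAlgebra.ι (0 : QuadraticForm ℝ (O →₀ ℝ)) ∘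
      fun c => Finsupp.single c (1 : ℝ))).prod = _
  rw [h, TensorProduct.tmul_smul]
  rfl

end GradedFun

namespace Darboux

variable {n : ℕ} (D : Darboux n) (U : TopologicalSpace.Opens (D.BaseCoord → ℝ))

theorem monomial_mem_homog (f : Smooth U) (s : Multiset D.EvenCoord) (t : List D.OddCoord) :
    GradedFun.monomial f s t ∈
      D.homog U ((s.map fun c => c.1.deg).sum + (t.map fun c => c.1.deg).sum : ℕ) :=
  Submodule.subset_span ⟨f, s, t, rfl, rfl⟩

theorem mul_mem_homog {a b : ℤ} {u v : D.Fun U} (hu : u ∈ D.homog U a) (hv : v ∈ D.homog U b) :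
    u * v ∈ D.homog U (a + b) := by
  induction hu, hv using Submodule.span_induction₂ with
  | mem_mem x y hx hy =>
    obtain ⟨f, s, t, rfl, rfl⟩ := hx
    obtain ⟨f', s', t', rfl, rfl⟩ := hy
    rw [GradedFun.monomial_mul]
    refine Submodule.subset_span ⟨_, _, _, ?_, rfl⟩
    simp only [Multiset.map_add, Multiset.sum_add, List.map_append, List.sum_append]
    push_cast
    ring
  | zero_left y hy => rw [zero_mul]; exact zero_mem _
  | zero_right x hx => rw [mul_zero]; exact zero_mem _
  | add_left x y z _ _ _ h1 h2 => rw [add_mul]; exact add_mem h1 h2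
  | add_right x y z _ _ _ h1 h2 => rw [mul_add]; exact add_mem h1 h2
  | smul_left r x y _ _ h => rw [smul_mul_assoc]; exact Submodule.smul_mem _ r h
  | smul_right r x y _ _ h => rw [mul_smul_comm]; exact Submodule.smul_mem _ r h

theorem parity_mem_homog {a : ℤ} {v : D.Fun U} (hv : v ∈ D.homog U a) :
    GradedFun.parity v ∈ D.homog U a := by
  suffices h : D.homog U a ≤ (D.homog U a).comap GradedFun.parity from h hv
  refine Submodule.span_le.2 ?_
  rintro _ ⟨f, s, t, rfl, rfl⟩
  change GradedFun.parity _ ∈ D.homog U _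
  rw [GradedFun.parity_monomial]
  exact Submodule.smul_mem _ _ (D.monomial_mem_homog U f s t)

theorem parity_pow_mem_homog (p : ℕ) {a : ℤ} {v : D.Fun U} (hv : v ∈ D.homog U a) :
    (GradedFun.parity ^ p) v ∈ D.homog U a := by
  induction p with
  | zero => exact hv
  | succ p ih => rw [pow_succ', Module.End.mul_apply]; exact D.parity_mem_homog U ih

/-- By the Leibniz rule it suffices to check the degree on functions of the base and on single
variables: every monomial is a product of these. -/
theorem derivation_mem_homog {p q : ℕ} {A : D.Fun U →ₗ[ℝ] D.Fun U}
    (hA : IsSuperDerivation GradedFun.parity q A)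
    (hb : ∀ f, A (GradedFun.monomial f 0 []) ∈ D.homog U (0 - p))
    (he : ∀ c, A (GradedFun.monomial 1 {c} []) ∈ D.homog U (c.1.deg - p))
    (ho : ∀ c, A (GradedFun.monomial 1 0 [c]) ∈ D.homog U (c.1.deg - p))
    {a : ℤ} {v : D.Fun U} (hv : v ∈ D.homog U a) : A v ∈ D.homog U (a - p) := by
  have hmul {a b : ℤ} {u v : D.Fun U} (hu : u ∈ D.homog U a) (hv : v ∈ D.homog U b)
      (hAu : A u ∈ D.homog U (a - p)) (hAv : A v ∈ D.homog U (b - p)) :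
      A (u * v) ∈ D.homog U (a + b - p) := by
    rw [hA.leibniz]
    refine add_mem ?_ ?_
    · rw [show a + b - p = a - p + b by ring]
      exact D.mul_mem_homog U hAu hv
    · rw [add_sub_assoc]
      exact D.mul_mem_homog U (D.parity_pow_mem_homog U q hu) hAv
  suffices h : D.homog U a ≤ (D.homog U (a - p)).comap A from h hv
  clear hv v
  refine Submodule.span_le.2 ?_
  rintro _ ⟨f, s, t, rfl, rfl⟩
  change A _ ∈ D.homog U _
  induction s using Multiset.induction_on with
  | empty =>
    induction t with
    | nil => simpa using hb f
    | cons c t ih =>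
      have h := hmul (D.monomial_mem_homog U 1 0 [c]) (D.monomial_mem_homog U f 0 t)
        (by simpa using ho c) ih
      rw [GradedFun.monomial_mul, one_mul, zero_add, ← Nat.cast_add] at h
      simpa [add_comm, add_assoc] using h
  | cons c s ih =>
    have h := hmul (D.monomial_mem_homog U 1 {c} []) (D.monomial_mem_homog U f s t)
      (by simpa using he c) ih
    rw [GradedFun.monomial_mul, one_mul, List.nil_append, Multiset.singleton_add,
      ← Nat.cast_add] at h
    simpa [add_comm, add_assoc, add_left_comm] using h

/-! ### The degrees of the coordinate derivations. -/

theorem one_mem_homog : (1 : D.Fun U) ∈ D.homog U 0 := by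
  simpa [GradedFun.one_eq_monomial] using D.monomial_mem_homog U 1 0 []

theorem basePartial_mem_homog (c : D.BaseCoord) {a : ℤ} {v : D.Fun U} (hv : v ∈ D.homog U a) :
    GradedFun.basePartial c v ∈ D.homog U (a - (0 : ℕ)) := by
  -- The Leibniz rule for 1 * 1 forces the derivative of 1 to vanish.
  have h1 : Smooth.pderiv (U := U) c 1 = 0 := by
    simpa using Smooth.pderiv_mul (U := U) c 1 1
  have hgen (s : Multiset D.EvenCoord) (t : List D.OddCoord) :
      (GradedFun.basePartial c (GradedFun.monomial 1 s t) : D.Fun U) = 0 := by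
    change (Smooth.pderiv (U := U) c 1 ⊗ₜ[ℝ] _) ⊗ₜ[ℝ] _ = (0 : _ ⊗[ℝ] _)
    rw [h1, TensorProduct.zero_tmul, TensorProduct.zero_tmul]
  refine D.derivation_mem_homog U (GradedFun.basePartial_isSuperDerivation c Even.zero)
    (fun f => ?_) (fun c' => ?_) (fun c' => ?_) hv
  · have h : (GradedFun.basePartial c (GradedFun.monomial f 0 []) : D.Fun U) =
        GradedFun.monomial (Smooth.pderiv c f) 0 [] := rfl
    rw [h]
    simpa using D.monomial_mem_homog U (Smooth.pderiv c f) 0 []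
  · rw [hgen]; exact zero_mem _
  · rw [hgen]; exact zero_mem _

theorem evenPartial_mem_homog (c : D.EvenCoord) {a : ℤ} {v : D.Fun U} (hv : v ∈ D.homog U a) :
    GradedFun.evenPartial c v ∈ D.homog U (a - c.1.deg) := by
  classical
  have h1 (f : Smooth U) (t : List D.OddCoord) :
      (GradedFun.evenPartial c (GradedFun.monomial f 0 t) : D.Fun U) = 0 := by
    change (f ⊗ₜ[ℝ] MvPolynomial.pderiv c (1 : MvPolynomial D.EvenCoord ℝ)) ⊗ₜ[ℝ] _ =
      (0 : _ ⊗[ℝ] _)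
    rw [MvPolynomial.pderiv_one, TensorProduct.tmul_zero, TensorProduct.zero_tmul]
  refine D.derivation_mem_homog U (GradedFun.evenPartial_isSuperDerivation c c.2.2)
    (fun f => ?_) (fun c' => ?_) (fun c' => ?_) hv
  · rw [h1]; exact zero_mem _
  · by_cases h : c' = c
    · subst h
      have : (GradedFun.evenPartial c' (GradedFun.monomial 1 {c'} []) : D.Fun U) = 1 := by
        change (1 ⊗ₜ[ℝ] MvPolynomial.pderiv c' ((Multiset.map MvPolynomial.X {c'}).prod :
          MvPolynomial D.EvenCoord ℝ)) ⊗ₜ[ℝ] _ = (1 : _ ⊗[ℝ] _)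
        rw [Multiset.map_singleton, Multiset.prod_singleton, MvPolynomial.pderiv_X_self]
        rfl
      rw [this, sub_self]
      exact D.one_mem_homog U
    · have : (GradedFun.evenPartial c (GradedFun.monomial 1 {c'} []) : D.Fun U) = 0 := by
        change (1 ⊗ₜ[ℝ] MvPolynomial.pderiv c ((Multiset.map MvPolynomial.X {c'}).prod :
          MvPolynomial D.EvenCoord ℝ)) ⊗ₜ[ℝ] _ = (0 : _ ⊗[ℝ] _)
        rw [Multiset.map_singleton, Multiset.prod_singleton, MvPolynomial.pderiv_X_of_ne h,
          TensorProduct.tmul_zero, TensorProduct.zero_tmul]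
      rw [this]; exact zero_mem _
  · rw [h1]; exact zero_mem _

theorem oddPartial_mem_homog (c : D.OddCoord) {a : ℤ} {v : D.Fun U} (hv : v ∈ D.homog U a) :
    GradedFun.oddPartial c v ∈ D.homog U (a - c.1.deg) := by
  classical
  have h1 (f : Smooth U) (s : Multiset D.EvenCoord) :
      (GradedFun.oddPartial c (GradedFun.monomial f s []) : D.Fun U) = 0 := by
    change _ ⊗ₜ[ℝ] CliffordAlgebra.contractLeft _
      (1 : CliffordAlgebra (0 : QuadraticForm ℝ (D.OddCoord →₀ ℝ))) = (0 : _ ⊗[ℝ] _)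
    rw [CliffordAlgebra.contractLeft_one, TensorProduct.tmul_zero]
  refine D.derivation_mem_homog U (GradedFun.oddPartial_isSuperDerivation c c.2)
    (fun f => ?_) (fun c' => ?_) (fun c' => ?_) hv
  · rw [h1]; exact zero_mem _
  · rw [h1]; exact zero_mem _
  · have h2 : (GradedFun.oddPartial c (GradedFun.monomial 1 0 [c']) : D.Fun U) =
        (Finsupp.single c' (1 : ℝ) c) • (1 : D.Fun U) := by
      change (1 ⊗ₜ[ℝ] 1) ⊗ₜ[ℝ] CliffordAlgebra.contractLeft (Finsupp.lapply c)
        ([CliffordAlgebra.ι (0 : QuadraticForm ℝ (D.OddCoord →₀ ℝ)) (Finsupp.single c' 1)].prod) = _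
      rw [List.prod_singleton, CliffordAlgebra.contractLeft_ι, Algebra.algebraMap_eq_smul_one,
        TensorProduct.tmul_smul]
      rfl
    rw [h2]
    by_cases h : c' = c
    · subst h
      rw [sub_self]
      exact Submodule.smul_mem _ _ (D.one_mem_homog U)
    · rw [Finsupp.single_eq_of_ne (Ne.symm h), zero_smul]
      exact zero_mem _

/-- The coordinate derivations of the algebra of functions. -/
def calculus : SuperCalculus (D.Fun U) D.Coord where
  P := GradedFun.parity
  deg := Coord.deg
  del := D.partialDeriv U
  isParity := GradedFun.isParity
  der c := by
    unfold partialDeriv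
    split_ifs with h h'
    · rw [h]
      exact GradedFun.basePartial_isSuperDerivation _ Even.zero
    · exact GradedFun.evenPartial_isSuperDerivation _ h'
    · exact GradedFun.oddPartial_isSuperDerivation _ (Nat.not_even_iff_odd.1 h')
  comm c c' v := by
    have hodd (h : ¬Even c.deg) (h' : ¬Even c'.deg) : (-1 : ℝ) ^ (c.deg * c'.deg) = -1 :=
      ((Nat.not_even_iff_odd.1 h).mul (Nat.not_even_iff_odd.1 h')).neg_one_pow
    have heven (h : Even c.deg) : (-1 : ℝ) ^ (c.deg * c'.deg) = 1 := (h.mul_right _).neg_one_pow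
    have heven' (h : Even c'.deg) : (-1 : ℝ) ^ (c.deg * c'.deg) = 1 := (h.mul_left _).neg_one_pow
    unfold partialDeriv
    split_ifs with h1 h2 h3 h4 h5 h6 h7 h8
    · rw [heven (h1 ▸ Even.zero), one_smul, GradedFun.basePartial_comm_basePartial]
    · rw [heven (h1 ▸ Even.zero), one_smul, GradedFun.basePartial_comm_evenPartial]
    · rw [heven (h1 ▸ Even.zero), one_smul, GradedFun.basePartial_comm_oddPartial]
    · rw [heven h4, one_smul, GradedFun.basePartial_comm_evenPartial]
    · rw [heven h4, one_smul, GradedFun.evenPartial_comm_evenPartial]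
    · rw [heven h4, one_smul, GradedFun.evenPartial_comm_oddPartial]
    · rw [heven' (h7 ▸ Even.zero), one_smul, GradedFun.basePartial_comm_oddPartial]
    · rw [heven' h8, one_smul, GradedFun.evenPartial_comm_oddPartial]
    · rw [hodd h4 h8, neg_one_smul, GradedFun.oddPartial_comm_oddPartial]

theorem isGrading : (D.calculus U).IsGrading (D.homog U) where
  one_mem := D.one_mem_homog U
  mul_mem := D.mul_mem_homog U
  P_mem := D.parity_mem_homog U
  del_mem {a v} c hv := by
    change D.partialDeriv U c v ∈ D.homog U (a - c.deg)
    unfold partialDeriv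
    split_ifs with h h'
    · rw [h]
      exact D.basePartial_mem_homog U _ hv
    · exact D.evenPartial_mem_homog U ⟨c, h, h'⟩ hv
    · exact D.oddPartial_mem_homog U ⟨c, Nat.not_even_iff_odd.1 h'⟩ hv

/-! ### The edge operators in Darboux coordinates. -/

/-- The summands of the edge operator. -/
abbrev EdgeIndex : Type :=
  Fin D.numX ⊕ (Σ k, Fin (D.numPsi k)) ⊕ Fin D.numXi × Fin D.numXi

/-- The coefficients of the edge operator. -/
def edgeWeight : D.EdgeIndex → ℝ
  | .inl _ => 1
  | .inr (.inl _) => 1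
  | .inr (.inr (a, b)) => 1 / 2 * D.κ⁻¹ a b

/-- The coordinates differentiated at the source of an edge. -/
def edgeSource : D.EdgeIndex → D.Coord
  | .inl μ => .x μ
  | .inr (.inl ⟨k, α⟩) => .psi k α
  | .inr (.inr (a, _)) => .xi a

/-- The coordinates differentiated at the target of an edge. -/
def edgeTarget : D.EdgeIndex → D.Coord
  | .inl μ => .p μ
  | .inr (.inl ⟨k, α⟩) => .chi k α
  | .inr (.inr (_, b)) => .xi b

theorem deg_xi_add_deg_xi (a b : Fin D.numXi) :
    (Coord.xi a : D.Coord).deg + (Coord.xi b : D.Coord).deg = n := by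
  have hn : Even n := by
    by_contra h
    have := D.numXi_of_odd (Nat.not_even_iff_odd.1 h)
    exact (this ▸ a).elim0
  simp only [Coord.deg]
  obtain ⟨m, rfl⟩ := hn
  omega

theorem deg_source_add_deg_target (q : D.EdgeIndex) :
    (D.calculus U).deg (D.edgeSource q) + (D.calculus U).deg (D.edgeTarget q) = n := by
  rcases q with μ | ⟨k, α⟩ | ⟨a, b⟩
  · exact zero_add n
  · change (k : ℕ) + 1 + (n - (k + 1)) = n
    have := k.2
    omega
  · exact D.deg_xi_add_deg_xi a b

theorem directedEdge_eq {N : ℕ} (i j : Fin N) :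
    D.directedEdge i j =
      (D.calculus U).edge D.edgeWeight D.edgeSource D.edgeTarget N i j := by
  rw [SuperCalculus.edge, Fintype.sum_sum_type, Fintype.sum_sum_type, Fintype.sum_sigma,
    Fintype.sum_prod_type, directedEdge, ← add_assoc, Finset.smul_sum]
  simp only [edgeWeight, one_smul, Finset.smul_sum, smul_smul]
  rfl

/-- The transpose of κ is ε κ with ε = -(-1)^(n / 2). As ε² = 1, inverting gives the same symmetry
for the inverse matrix. -/
theorem kappa_inv_symm (a b : Fin D.numXi) :
    D.κ⁻¹ a b = -(-1) ^ (n / 2) * D.κ⁻¹ b a := by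
  set ε : ℝ := -(-1) ^ (n / 2) with hε
  have hεε : ε * ε = 1 := by
    rw [hε, neg_mul_neg, ← mul_pow]; simp
  have h : D.κ.transpose = ε • D.κ := by
    ext a b
    rw [Matrix.transpose_apply, Matrix.smul_apply, smul_eq_mul, D.symm b a]
  have h2 : D.κ⁻¹.transpose = ε • D.κ⁻¹ := by
    rw [Matrix.transpose_nonsing_inv, h]
    refine Matrix.inv_eq_left_inv ?_
    rw [Matrix.smul_mul, Matrix.mul_smul, smul_smul, hεε, one_smul,
      Matrix.nonsing_inv_mul _ D.isUnit_det]
  have h3 := congrFun (congrFun h2 b) a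
  rwa [Matrix.transpose_apply, Matrix.smul_apply, smul_eq_mul] at h3

/-- Exchanging the two derivations costs (-1) to the product of their degrees. This is 1 for x, p;
for the ξ term it combines with the symmetry of the inverse of κ to (-1)^(n + 1). -/
theorem directedEdge_symm {N : ℕ} (i j : Fin N) :
    D.directedEdge (U := U) j i =
      (∑ μ, D.deriv₂ (.p μ) (.x μ) i j)
        + (∑ k, ∑ α, (-1 : ℝ) ^ ((Coord.psi k α : D.Coord).deg * (Coord.chi k α : D.Coord).deg) •
            D.deriv₂ (.chi k α) (.psi k α) i j)
        + (-1 : ℝ) ^ (n + 1) • (1 / 2 : ℝ) • ∑ a, ∑ b, D.κ⁻¹ a b • D.deriv₂ (.xi a) (.xi b) i j := by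
  have hxi (a b : Fin D.numXi) : (D.calculus U).deg (.xi a) * (D.calculus U).deg (.xi b) =
      n / 2 * (n / 2) := rfl
  -- The existence of ξ forces n even. Then (n / 2)² has the parity of n / 2, so exchange and
  -- symmetry together give -1, which is (-1)^(n + 1).
  have hw (a b : Fin D.numXi) : 1 / 2 * D.κ⁻¹ a b * (-1) ^ (n / 2 * (n / 2)) =
      (-1) ^ (n + 1) * (1 / 2) * D.κ⁻¹ b a := by
    have hn := D.deg_xi_add_deg_xi a b
    simp only [Coord.deg] at hn
    have h1 : Even n := ⟨n / 2, hn.symm⟩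
    have h2 : (-1 : ℝ) ^ (n / 2 * (n / 2)) = (-1) ^ (n / 2) := by
      rcases Nat.even_or_odd (n / 2) with h | h
      · rw [h.neg_one_pow, (h.mul_left _).neg_one_pow]
      · rw [h.neg_one_pow, (h.mul h).neg_one_pow]
    have h3 : (-1 : ℝ) ^ (n / 2) * (-1) ^ (n / 2) = 1 := by rw [← mul_pow]; simp
    rw [D.kappa_inv_symm a b, h2, pow_succ, h1.neg_one_pow]
    linear_combination (-1 / 2 * D.κ⁻¹ b a) * h3
  rw [directedEdge_eq, SuperCalculus.edge_symm, Fintype.sum_sum_type, Fintype.sum_sum_type,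
    Fintype.sum_sigma, Fintype.sum_prod_type, ← add_assoc]
  simp only [edgeWeight, edgeSource, edgeTarget, one_mul, hxi, hw]
  congr 1
  · congr 1
    refine Finset.sum_congr rfl fun μ _ => ?_
    have : (D.calculus U).deg (.x μ) = 0 := rfl
    rw [this, zero_mul, pow_zero, one_smul]
    rfl
  · rw [Finset.sum_comm]
    simp only [Finset.smul_sum, smul_smul, mul_assoc]
    rfl

theorem undirectedEdge_eq {N : ℕ} (i j : Fin N) :
    D.undirectedEdge (U := U) i j =
      D.directedEdge i j + (-1 : ℝ) ^ (n + 1) • D.directedEdge j i := by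
  rw [D.directedEdge_symm U i j, directedEdge, undirectedEdge]
  split_ifs with hn
  -- For n odd, one of the degrees of ψ and χ is even, as they add up to n.
  · have hpc (k : Fin ((n - 1) / 2)) (α : Fin (D.numPsi k)) :
        (-1 : ℝ) ^ ((Coord.psi k α : D.Coord).deg * (Coord.chi k α : D.Coord).deg) = 1 := by
      refine Even.neg_one_pow ?_
      have h : (Coord.psi k α : D.Coord).deg + (Coord.chi k α : D.Coord).deg = n :=
        D.deg_source_add_deg_target U (.inr (.inl ⟨k, α⟩))
      rcases Nat.even_or_odd (Coord.psi k α : D.Coord).deg with h' | h'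
      · exact h'.mul_right _
      · refine Even.mul_left ?_ _
        by_contra h''
        have := h'.add_odd (Nat.not_even_iff_odd.1 h'')
        rw [h] at this
        exact Nat.not_even_iff_odd.2 hn this
    have hx : ∑ a, ∑ b, D.κ⁻¹ a b • D.deriv₂ (U := U) (.xi a) (.xi b) i j = 0 := by
      refine Finset.sum_eq_zero fun a _ => ?_
      exact (D.numXi_of_odd hn ▸ a).elim0
    simp only [hpc, one_smul, hx, smul_zero, add_zero, undirectedEdgeOdd, hn.add_one.neg_one_pow]
    abel
  · rw [Nat.not_odd_iff_even] at hn
    -- For n even, ψ and χ have degrees of the same parity, so the product of the degrees has the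
    -- parity of the degree of ψ.
    have hpc (k : Fin ((n - 1) / 2)) (α : Fin (D.numPsi k)) :
        (-1 : ℝ) ^ ((Coord.psi k α : D.Coord).deg * (Coord.chi k α : D.Coord).deg) =
          (-1) ^ (Coord.psi k α : D.Coord).deg := by
      have h : (Coord.psi k α : D.Coord).deg + (Coord.chi k α : D.Coord).deg = n :=
        D.deg_source_add_deg_target U (.inr (.inl ⟨k, α⟩))
      rw [← h] at hn
      rcases Nat.even_or_odd (Coord.psi k α : D.Coord).deg with h' | h'
      · rw [h'.neg_one_pow, (h'.mul_right _).neg_one_pow]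
      · rw [h'.neg_one_pow, (h'.mul ((Nat.even_add'.1 hn).1 h')).neg_one_pow]
    simp only [hpc, undirectedEdgeEven, hn.add_one.neg_one_pow]
    -- The two ξ terms with coefficient 1/2 carry the same sign, which yields coefficient 1.
    module

/-- The representation of directed graphs on the functions. -/
def directedRep : OperadHom (dGra (n + 1)) (D.End U) :=
  (D.isGrading U).representation D.edgeWeight D.edgeSource D.edgeTarget
    (D.deg_source_add_deg_target U)

theorem directedRep_graphClass {N : ℕ} (Γ : Multidigraph N) :
    (D.directedRep U).toFun N (graphClass False (n + 1) Γ) =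
      graphOp (D.directedEdge (N := N + 1)) Γ.2 := by
  have h : D.directedEdge (U := U) (N := N + 1) = (D.calculus U).edge D.edgeWeight D.edgeSource
      D.edgeTarget (N + 1) := funext fun i => funext fun j => D.directedEdge_eq U i j
  rw [h]
  exact ((D.calculus U).isEdgeOperator _ _ _ (D.deg_source_add_deg_target U)).rep_graphClass Γ

theorem directedRep_orSum {N : ℕ} (Γ : Multidigraph N) :
    (D.directedRep U).toFun N (orSum (n + 1) Γ) =
      graphOp (D.undirectedEdge (N := N + 1)) Γ.2 := by
  have h : D.undirectedEdge (U := U) (N := N + 1) = fun i j =>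
      (D.calculus U).edge D.edgeWeight D.edgeSource D.edgeTarget (N + 1) i j +
      ((((-1 : ℤˣ) ^ ((n : ℤ) + 1) : ℤˣ) : ℤ) : ℝ) •
        (D.calculus U).edge D.edgeWeight D.edgeSource D.edgeTarget (N + 1) j i := by
    funext i j
    rw [undirectedEdge_eq, directedEdge_eq, directedEdge_eq]
    congr 2
    rw [show (n : ℤ) + 1 = ((n + 1 : ℕ) : ℤ) by push_cast; ring, zpow_natCast]
    simp
  rw [h]
  exact ((D.calculus U).isEdgeOperator _ _ _ (D.deg_source_add_deg_target U)).rep_orSum Γ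

end Darboux

end NPGraph

end

/-! ### The theorem. -/

theorem mainTheorem1 (n : ℕ) (D : NPGraph.Darboux n)
    (U : TopologicalSpace.Opens (D.BaseCoord → ℝ)) :
    ∃ (dRep : NPGraph.OperadHom (NPGraph.dGra (n + 1)) (D.End U))
      (Or : NPGraph.OperadHom (NPGraph.Gra (n + 1)) (NPGraph.dGra (n + 1))),
      (∀ (N : ℕ) (Γ : NPGraph.Multidigraph N) (f : Fin (N + 1) → D.Fun U),
        D.eval (dRep.toFun N (NPGraph.graphClass False (n + 1) Γ)) f =
          D.graphAction D.directedEdge Γ f) ∧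
      (∀ (N : ℕ) (Γ : NPGraph.Multidigraph N),
        Or.toFun N (NPGraph.graphClass True (n + 1) Γ) =
          ∑ s : Fin Γ.1 → Bool, (((NPGraph.flipSign (n + 1) s : ℤˣ) : ℤ) : ℝ) •
            NPGraph.graphClass False (n + 1) ⟨Γ.1, NPGraph.flipEdges s Γ.2⟩) ∧
      (∀ N, Function.Injective (Or.toFun N)) ∧
      ∀ (N : ℕ) (Γ : NPGraph.Multidigraph N) (f : Fin (N + 1) → D.Fun U),
        D.eval ((dRep.comp Or).toFun N (NPGraph.graphClass True (n + 1) Γ)) f =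
          D.graphAction D.undirectedEdge Γ f := by
  refine ⟨D.directedRep U, NPGraph.orientation (n + 1), fun N Γ f => ?_,
    fun N Γ => NPGraph.orientation_graphClass (n + 1) Γ,
    NPGraph.orMap_injective (n + 1), fun N Γ f => ?_⟩
  · rw [D.directedRep_graphClass U Γ]
    -- `graphAction` unfolds to `graphOp`, since `mult` is `mulAll` for the algebra of functions.
    rfl
  · have h : ((D.directedRep U).comp (NPGraph.orientation (n + 1))).toFun N
        (NPGraph.graphClass True (n + 1) Γ) =
        NPGraph.graphOp (D.undirectedEdge (N := N + 1)) Γ.2 :=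
      (congrArg _ (NPGraph.orientation_graphClass (n + 1) Γ)).trans (D.directedRep_orSum U Γ)
    rw [h]
    rfl
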